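/- Let $A$ be a generalized Cartan matrix of affine type $X_N^{(r)}$ (any affine type, untwisted or twisted, including $A_2^{(2)}$ and $D_3^{(2)}$; in the notation below $A_3^{(2)}$ is $D_3^{(2)}$ with its vertices renumbered), with vertices $0,1,\dots,n$, simple roots $\alpha_i$, simple coroots $\check\alpha_i$, labels $a_i$, and labels $\check a_i$ of the transposed diagram, where the vertex $0$ is chosen as in Kac's tables (so $a_0=2$ if $A=A_{2n}^{(2)}$ and $a_0=1$ otherwise). Let $\check h=\sum_{i=0}^n\check a_i$ be the dual Coxeter number, and let $\mathring{\mathfrak g}$ be the simple Lie algebra with vertices $1,\dots,n$, with real Cartan subalgebra $\mathring{\mathfrak h}$, roots $\mathring\Phi$, positive roots $\mathring\Phi^+$, Weyl group $\mathring W$ with length function $\ell$, weight lattice $\mathring P$, dominant weights $\mathring P^+$, root lattice $\mathring Q$, coroot lattice $\check{\mathring Q}$, and let $\mathring\rho$, $\check{\mathring\rho}$ be the sums of the fundamental weights $\omega_i$ and of the fundamental coweights $\check\omega_i$. Let $(\cdot|\cdot)$ be the form on $\mathring{\mathfrak h}$ with $(\check\alpha_i|\check\alpha_j)=\frac{a_i}{\check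 a_i}\langle\alpha_i,\check\alpha_j\rangle$, let $\kappa:\mathring{\mathfrak h}\to\mathring{\mathfrak h}^*$ be the induced isomorphism, and write $(\cdot|\cdot)$ also for the transported form on $\mathring{\mathfrak h}^*$. Say that $A$ is of the first kind if $A=X_N^{(1)}$ or $A=A_{2n}^{(2)}$, and of the second kind otherwise. Put $M=\kappa(\check{\mathring Q})$ and $\check\theta=\kappa^{-1}(\theta)$, with $\theta$ the highest root of $\mathring{\mathfrak g}$, if $A$ is of the first kind; put $M=\mathring Q$ and let $\check\theta$ be the highest coroot of $\mathring{\mathfrak g}$ if $A$ is of the second kind. For $k\in\mathbb N=\{0,1,2,\dots\}$ let $$P_k=\{\lambda\in\mathring P^+ \mid \langle\lambda,\check\theta\rangle\le k\}.$$ For $\lambda\in P_k$ and a character $t\in\mathrm{Hom}(\mathring P,\mathbb C^\times)$ let $J_\lambda(t)=\sum_{w\in\mathring W}(-1)^{\ell(w)}\,t\big(w(\lambda+\mathring\rho)\big)$. The adjacent matrix $A'$ is $A'=A$ if $A$ is of the first kind or $A=E_6^{(2)}$ or $A=D_4^{(3)}$, while $(A_{2n-1}^{(2)})'=D_{n+1}^{(2)}$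 and $(D_{n+1}^{(2)})'=A_{2n-1}^{(2)}$. Let $P'_k$ be the set $P_k$ for $A'$. For $A$ of the second kind the root system $\mathring\Phi'$ of $A'$ is dual to $\mathring\Phi$; let $\tau$ be the corresponding bijection of vertices (the identity between $B_n$ and $C_n$, the reversal $i\mapsto n+1-i$ for $F_4$ and $G_2$), so that $\langle\alpha'_i,\check\alpha'_j\rangle=\langle\alpha_{\tau(j)},\check\alpha_{\tau(i)}\rangle$, and let $\epsilon$ be the linear map with $\epsilon(\omega'_i)=\check\omega_{\tau(i)}$. For $\mu'\in P'_k$ let $t_{\mu'}$ be the character of $\mathring P$ $$t_{\mu'}=e^{\frac{2\pi i}{k+\check h}(\mathring\rho+\mu'|\,\cdot\,)}\ \text{ if } A \text{ is of the first kind},\qquad t_{\mu'}=e^{\frac{2\pi i}{k+\check h}\langle\,\cdot\,,\,\check{\mathring\rho}+\epsilon(\mu')\rangle}\ \text{ if } A \text{ is of the second kind}.$$ The modular matrix $S$ from $A$ to $A'$, indexed by $P_k\times P'_k$, has the entries $$S_{\lambda,\mu'}=i^{|\mathring\Phi^+|}\,\big|\mathring P/(k+\check h)M\big|^{-1/2}\,J_\lambda(t_{\mu'}).$$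 **Lemma.** For every such $A$ and every $k\in\mathbb N$ the set $P'_k$ is finite and $S\bar S^{t}=I$, the identity matrix indexed by $P_k\times P_k$. -/

import Mathlib

open scoped Matrix

noncomputable section

/-- The generalized Cartan matrices of affine type `X_N^{(r)}`; the index is the rank `n`,
so that the affine Dynkin diagram has the vertices `0, 1, …, n`.
`A_2^{(2)}` is `twistedAEven 1`, and `A_3^{(2)}` (`twistedAOdd 2`) is the diagram `D_3^{(2)}`
(`twistedD 2`) with its vertices numbered differently. -/
inductive AffineType : ℕ → Type
  /-- `A_n^{(1)}` -/
  | untwistedA (n : ℕ) (hn : 1 ≤ n) : AffineType n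
  /-- `B_n^{(1)}` -/
  | untwistedB (n : ℕ) (hn : 3 ≤ n) : AffineType n
  /-- `C_n^{(1)}` -/
  | untwistedC (n : ℕ) (hn : 2 ≤ n) : AffineType n
  /-- `D_n^{(1)}` -/
  | untwistedD (n : ℕ) (hn : 4 ≤ n) : AffineType n
  /-- `E_6^{(1)}` -/
  | untwistedE₆ : AffineType 6
  /-- `E_7^{(1)}` -/
  | untwistedE₇ : AffineType 7
  /-- `E_8^{(1)}` -/
  | untwistedE₈ : AffineType 8
  /-- `F_4^{(1)}` -/
  | untwistedF₄ : AffineType 4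
  /-- `G_2^{(1)}` -/
  | untwistedG₂ : AffineType 2
  /-- `A_{2n}^{(2)}` -/
  | twistedAEven (n : ℕ) (hn : 1 ≤ n) : AffineType n
  /-- `A_{2n-1}^{(2)}` -/
  | twistedAOdd (n : ℕ) (hn : 2 ≤ n) : AffineType n
  /-- `D_{n+1}^{(2)}` -/
  | twistedD (n : ℕ) (hn : 2 ≤ n) : AffineType n
  /-- `E_6^{(2)}` -/
  | twistedE₆ : AffineType 4
  /-- `D_4^{(3)}` -/
  | twistedD₄ : AffineType 2

namespace AffineType

/-! ### The affine Cartan matrix and its labels -/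

/-- The Cartan matrix of the diagram with the vertex `0` removed, with entries `⟨α_i, α̌_j⟩`
(vertex `i + 1` has the index `i : Fin n`). -/
def finitePart : {n : ℕ} → AffineType n → Matrix (Fin n) (Fin n) ℤ
  | _, untwistedA n _ => CartanMatrix.A n
  | _, untwistedB n _ => CartanMatrix.B n
  | _, untwistedC n _ => CartanMatrix.C n
  | _, untwistedD n _ => CartanMatrix.D n
  | _, untwistedE₆ => CartanMatrix.E₆
  | _, untwistedE₇ => CartanMatrix.E₇
  | _, untwistedE₈ => CartanMatrix.E₈
  | _, untwistedF₄ => CartanMatrix.F₄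
  | _, untwistedG₂ => CartanMatrix.G₂
  | _, twistedAEven n _ => CartanMatrix.C n
  | _, twistedAOdd n _ => CartanMatrix.C n
  | _, twistedD n _ => CartanMatrix.B n
  | _, twistedE₆ => CartanMatrix.F₄ᵀ
  | _, twistedD₄ => CartanMatrix.G₂ᵀ

/-- The numbers `⟨α_0, α̌_{j+1}⟩`. -/
def zeroRow : {n : ℕ} → AffineType n → Fin n → ℤ
  | _, untwistedA n _, j => (if j.val = 0 then -1 else 0) + (if j.val + 1 = n then -1 else 0)
  | _, untwistedB _ _, j => if j.val = 1 then -1 else 0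
  | _, untwistedC _ _, j => if j.val = 0 then -2 else 0
  | _, untwistedD _ _, j => if j.val = 1 then -1 else 0
  | _, untwistedE₆, j => if j.val = 1 then -1 else 0
  | _, untwistedE₇, j => if j.val = 0 then -1 else 0
  | _, untwistedE₈, j => if j.val = 7 then -1 else 0
  | _, untwistedF₄, j => if j.val = 0 then -1 else 0
  | _, untwistedG₂, j => if j.val = 0 then -1 else 0
  | _, twistedAEven _ _, j => if j.val = 0 then -1 else 0
  | _, twistedAOdd _ _, j => if j.val = 1 then -1 else 0
  | _, twistedD _ _, j => if j.val = 0 then -1 else 0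
  | _, twistedE₆, j => if j.val = 0 then -1 else 0
  | _, twistedD₄, j => if j.val = 0 then -1 else 0

/-- The numbers `⟨α_{i+1}, α̌_0⟩`. -/
def zeroColumn : {n : ℕ} → AffineType n → Fin n → ℤ
  | _, untwistedA n _, i => (if i.val = 0 then -1 else 0) + (if i.val + 1 = n then -1 else 0)
  | _, untwistedB _ _, i => if i.val = 1 then -1 else 0
  | _, untwistedC _ _, i => if i.val = 0 then -1 else 0
  | _, untwistedD _ _, i => if i.val = 1 then -1 else 0
  | _, untwistedE₆, i => if i.val = 1 then -1 else 0
  | _, untwistedE₇, i => if i.val = 0 then -1 else 0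
  | _, untwistedE₈, i => if i.val = 7 then -1 else 0
  | _, untwistedF₄, i => if i.val = 0 then -1 else 0
  | _, untwistedG₂, i => if i.val = 0 then -1 else 0
  | _, twistedAEven n _, i => if i.val = 0 then (if n = 1 then -4 else -2) else 0
  | _, twistedAOdd n _, i => if i.val = 1 then (if n = 2 then -2 else -1) else 0
  | _, twistedD _ _, i => if i.val = 0 then -2 else 0
  | _, twistedE₆, i => if i.val = 0 then -1 else 0
  | _, twistedD₄, i => if i.val = 0 then -1 else 0

/-- The generalized Cartan matrix `A = (⟨α_i, α̌_j⟩)`, `i, j = 0, …, n`. -/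
def cartan {n : ℕ} (T : AffineType n) : Matrix (Fin (n + 1)) (Fin (n + 1)) ℤ :=
  Matrix.of (Fin.cons (Fin.cons 2 T.zeroRow)
    (fun i => Fin.cons (T.zeroColumn i) (T.finitePart i)))

/-- The labels `a_0, …, a_n` of the affine Dynkin diagram: the coprime positive integers with
`∑ a_i α_i = δ`, that is `∑ i, a_i * A i j = 0`. -/
def label : {n : ℕ} → AffineType n → Fin (n + 1) → ℕ
  | _, untwistedA _ _, _ => 1
  | _, untwistedB _ _, i => if i.val ≤ 1 then 1 else 2
  | _, untwistedC n _, i => if i.val = 0 ∨ i.val = n then 1 else 2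
  | _, untwistedD n _, i => if i.val ≤ 1 ∨ n ≤ i.val + 1 then 1 else 2
  | _, untwistedE₆, i => ![1, 1, 2, 2, 3, 2, 1] i
  | _, untwistedE₇, i => ![1, 2, 2, 3, 4, 3, 2, 1] i
  | _, untwistedE₈, i => ![1, 2, 3, 4, 6, 5, 4, 3, 2] i
  | _, untwistedF₄, i => ![1, 2, 3, 4, 2] i
  | _, untwistedG₂, i => ![1, 2, 3] i
  | _, twistedAEven n _, i => if i.val = n then 1 else 2
  | _, twistedAOdd n _, i => if i.val ≤ 1 ∨ i.val = n then 1 else 2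
  | _, twistedD _ _, _ => 1
  | _, twistedE₆, i => ![1, 2, 3, 2, 1] i
  | _, twistedD₄, i => ![1, 2, 1] i

/-- The labels `ǎ_0, …, ǎ_n` of the diagram of the transposed matrix: the coprime positive
integers with `∑ j, A i j * ǎ_j = 0`. -/
def colabel : {n : ℕ} → AffineType n → Fin (n + 1) → ℕ
  | _, untwistedA _ _, _ => 1
  | _, untwistedB n _, i => if i.val ≤ 1 ∨ i.val = n then 1 else 2
  | _, untwistedC _ _, _ => 1
  | _, untwistedD n _, i => if i.val ≤ 1 ∨ n ≤ i.val + 1 then 1 else 2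
  | _, untwistedE₆, i => ![1, 1, 2, 2, 3, 2, 1] i
  | _, untwistedE₇, i => ![1, 2, 2, 3, 4, 3, 2, 1] i
  | _, untwistedE₈, i => ![1, 2, 3, 4, 6, 5, 4, 3, 2] i
  | _, untwistedF₄, i => ![1, 2, 3, 2, 1] i
  | _, untwistedG₂, i => ![1, 2, 1] i
  | _, twistedAEven _ _, i => if i.val = 0 then 1 else 2
  | _, twistedAOdd _ _, i => if i.val ≤ 1 then 1 else 2
  | _, twistedD n _, i => if i.val = 0 ∨ i.val = n then 1 else 2
  | _, twistedE₆, i => ![1, 2, 3, 4, 2] i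
  | _, twistedD₄, i => ![1, 2, 3] i

/-- The dual Coxeter number `ȟ = ∑ ǎ_i`. -/
def dualCoxeter {n : ℕ} (T : AffineType n) : ℕ := ∑ i, T.colabel i

/-- Whether `A = X_N^{(1)}` or `A = A_{2n}^{(2)}`. -/
def isUntwistedOrAEven : {n : ℕ} → AffineType n → Bool
  | _, twistedAOdd _ _ => false
  | _, twistedD _ _ => false
  | _, twistedE₆ => false
  | _, twistedD₄ => false
  | _, _ => true

/-! ### The finite root system

The (real) Cartan subalgebra is `Fin n → ℝ` with the simple coroots `α̌_1, …, α̌_n` as standard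
basis. Its dual is also written `Fin n → ℝ`, the weight `lam` having the coordinates
`⟨lam, α̌_j⟩`, so that the natural pairing of a weight and an element of the Cartan subalgebra is
the dot product `⬝ᵥ` and the fundamental weights are the standard basis. -/

variable {n : ℕ} (T : AffineType n)

/-- The simple root `α_i` of the finite root system. -/
def simpleRoot (i : Fin n) : Fin n → ℝ := fun j => (T.cartan i.succ j.succ : ℝ)

/-- The simple coroot `α̌_i`. -/
def simpleCoroot (_T : AffineType n) (i : Fin n) : Fin n → ℝ := Pi.single i 1

theorem finitePart_diag : ∀ {n : ℕ} (T : AffineType n) (i : Fin n), T.finitePart i i = 2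
  | _, untwistedA n _, i => by simp [finitePart, CartanMatrix.A]
  | _, untwistedB n _, i => CartanMatrix.B_diag n i
  | _, untwistedC n _, i => CartanMatrix.C_diag n i
  | _, untwistedD n _, i => CartanMatrix.D_diag n i
  | _, untwistedE₆, i => CartanMatrix.E₆_diag i
  | _, untwistedE₇, i => CartanMatrix.E₇_diag i
  | _, untwistedE₈, i => CartanMatrix.E₈_diag i
  | _, untwistedF₄, i => CartanMatrix.F₄_diag i
  | _, untwistedG₂, i => CartanMatrix.G₂_diag i
  | _, twistedAEven n _, i => CartanMatrix.C_diag n i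
  | _, twistedAOdd n _, i => CartanMatrix.C_diag n i
  | _, twistedD n _, i => CartanMatrix.B_diag n i
  | _, twistedE₆, i => CartanMatrix.F₄_diag i
  | _, twistedD₄, i => CartanMatrix.G₂_diag i

theorem simpleRoot_apply (i j : Fin n) : T.simpleRoot i j = (T.finitePart i j : ℝ) := rfl

theorem pairing_simple (i : Fin n) :
    dotProductBilin ℝ ℝ (T.simpleCoroot i) (T.simpleRoot i) = 2 := by
  simp [dotProductBilin, simpleCoroot, simpleRoot_apply, finitePart_diag]

theorem copairing_simple (i : Fin n) :
    dotProductBilin ℝ ℝ (T.simpleRoot i) (T.simpleCoroot i) = 2 := by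
  simp [dotProductBilin, simpleCoroot, simpleRoot_apply, finitePart_diag]

/-- The simple reflection `lam ↦ lam - ⟨lam, α̌_i⟩ α_i` of weights. -/
def reflection (i : Fin n) : (Fin n → ℝ) ≃ₗ[ℝ] (Fin n → ℝ) :=
  Module.reflection (T.pairing_simple i)

/-- The simple reflection `h ↦ h - ⟨α_i, h⟩ α̌_i` of the Cartan subalgebra. -/
def coreflection (i : Fin n) : (Fin n → ℝ) ≃ₗ[ℝ] (Fin n → ℝ) :=
  Module.reflection (T.copairing_simple i)

/-- The finite Weyl group, acting on weights. -/
def weylGroup : Subgroup ((Fin n → ℝ) ≃ₗ[ℝ] (Fin n → ℝ)) :=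
  Subgroup.closure (Set.range T.reflection)

/-- The finite Weyl group, acting on the Cartan subalgebra. -/
def coweylGroup : Subgroup ((Fin n → ℝ) ≃ₗ[ℝ] (Fin n → ℝ)) :=
  Subgroup.closure (Set.range T.coreflection)

/-- The length of an element of the finite Weyl group: the least number of simple reflections
in a word for it. -/
def length (w : T.weylGroup) : ℕ :=
  sInf {m | ∃ l : List (Fin n), l.length = m ∧ (l.map T.reflection).prod = w}

/-- The roots of the finite root system. -/
def roots : Set (Fin n → ℝ) := {β | ∃ w ∈ T.weylGroup, ∃ i, β = w (T.simpleRoot i)}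

/-- The coroots of the finite root system. -/
def coroots : Set (Fin n → ℝ) := {β | ∃ w ∈ T.coweylGroup, ∃ i, β = w (T.simpleCoroot i)}

/-- The positive roots of the finite root system. -/
def positiveRoots : Set (Fin n → ℝ) :=
  {β ∈ T.roots | β ∈ AddSubmonoid.closure (Set.range T.simpleRoot)}

/-- The highest root `θ`: the root such that `θ - β` is a sum of simple roots for each root `β`. -/
def highestRoot : Fin n → ℝ :=
  Classical.epsilon fun θ => θ ∈ T.roots ∧
    ∀ β ∈ T.roots, θ - β ∈ AddSubmonoid.closure (Set.range T.simpleRoot)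

/-- The highest coroot. -/
def highestCoroot : Fin n → ℝ :=
  Classical.epsilon fun θ => θ ∈ T.coroots ∧
    ∀ β ∈ T.coroots, θ - β ∈ AddSubmonoid.closure (Set.range T.simpleCoroot)

/-! ### The normalized form and the lattices -/

/-- The Gram matrix `(α̌_i | α̌_j) = a_i ǎ_i⁻¹ ⟨α_i, α̌_j⟩`, `i, j = 1, …, n`, of the normalized
form on the Cartan subalgebra. It is symmetric and positive definite. -/
def gram : Matrix (Fin n) (Fin n) ℝ :=
  Matrix.of fun i j =>
    (T.label i.succ : ℝ) / (T.colabel i.succ : ℝ) * (T.cartan i.succ j.succ : ℝ)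

/-- The isomorphism `κ` from the Cartan subalgebra to its dual, `⟨κ h, h'⟩ = (h | h')`. -/
def kappa : (Fin n → ℝ) →ₗ[ℝ] (Fin n → ℝ) := T.gram.vecMulLinear

/-- The inverse of `κ`. -/
def kappaInv : (Fin n → ℝ) →ₗ[ℝ] (Fin n → ℝ) := T.gram⁻¹.vecMulLinear

/-- The weight lattice. -/
def weightLattice (T : AffineType n) : AddSubgroup (Fin n → ℝ) where
  carrier := {lam | ∀ i, ∃ m : ℤ, lam ⬝ᵥ T.simpleCoroot i = m}
  zero_mem' i := ⟨0, by simp⟩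
  add_mem' {x y} hx hy i := by
    obtain ⟨a, ha⟩ := hx i
    obtain ⟨b, hb⟩ := hy i
    exact ⟨a + b, by rw [add_dotProduct, ha, hb]; push_cast; rfl⟩
  neg_mem' {x} hx i := by
    obtain ⟨a, ha⟩ := hx i
    exact ⟨-a, by rw [neg_dotProduct, ha]; push_cast; rfl⟩

/-- The root lattice. -/
def rootLattice : AddSubgroup (Fin n → ℝ) := AddSubgroup.closure (Set.range T.simpleRoot)

/-- The coroot lattice. -/
def corootLattice : AddSubgroup (Fin n → ℝ) := AddSubgroup.closure (Set.range T.simpleCoroot)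

/-- The lattice `M`. -/
def latticeM : AddSubgroup (Fin n → ℝ) :=
  if T.isUntwistedOrAEven then T.corootLattice.map T.kappa.toAddMonoidHom else T.rootLattice

/-- The order of the quotient of the weight lattice by `(k + ȟ) M`. -/
def quotientOrder (k : ℕ) : ℕ :=
  Nat.card (T.weightLattice ⧸
    (T.latticeM.map (nsmulAddMonoidHom (k + T.dualCoxeter))).addSubgroupOf T.weightLattice)

/-- The element `θ̌` of the Cartan subalgebra. -/
def thetaCheck : Fin n → ℝ :=
  if T.isUntwistedOrAEven then T.kappaInv T.highestRoot else T.highestCoroot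

/-- `P_k`: the dominant integral weights `lam` with `⟨lam, θ̌⟩ ≤ k`. -/
def levelWeights (k : ℕ) : Set (Fin n → ℝ) :=
  {lam | lam ∈ T.weightLattice ∧ (∀ i, 0 ≤ lam ⬝ᵥ T.simpleCoroot i) ∧ lam ⬝ᵥ T.thetaCheck ≤ k}

/-- The fundamental weight `ω_i`: `⟨ω_i, α̌_j⟩ = δ_{ij}`. -/
def fundamentalWeight (_T : AffineType n) (i : Fin n) : Fin n → ℝ := Pi.single i 1

/-- The fundamental coweight `ω̌_i`: `⟨α_j, ω̌_i⟩ = δ_{ij}`. -/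
def fundamentalCoweight (i : Fin n) : Fin n → ℝ :=
  (Matrix.of T.simpleRoot)⁻¹ *ᵥ Pi.single i 1

/-- The sum `ρ` of the fundamental weights. -/
def rho : Fin n → ℝ := ∑ i, T.fundamentalWeight i

/-- The sum `ρ̌` of the fundamental coweights. -/
def rhoCheck : Fin n → ℝ := ∑ i, T.fundamentalCoweight i

/-! ### The adjacent type -/

/-- The adjacent matrix `A'`. -/
def adjacent : {n : ℕ} → AffineType n → AffineType n
  | _, twistedAOdd n hn => twistedD n hn
  | _, twistedD n hn => twistedAOdd n hn
  | _, T => T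

/-- The bijection of vertices under which the finite root system of `A'` is dual to the one of
`A`, when `A` is twisted and not `A_{2n}^{(2)}`: the identity between `B_n` and `C_n`, and the
reversal of the diagram for `F_4` and `G_2`. -/
def dualVertex : {n : ℕ} → AffineType n → Fin n ≃ Fin n
  | _, twistedE₆ => Fin.revPerm
  | _, twistedD₄ => Fin.revPerm
  | _, _ => Equiv.refl _

/-- Under `dualVertex`, the finite Cartan matrix of `A'` is the transpose of the one of `A`. -/
theorem finitePart_adjacent : ∀ {n : ℕ} (T : AffineType n), T.isUntwistedOrAEven = false →
    ∀ i j, T.adjacent.finitePart i j = T.finitePart (T.dualVertex j) (T.dualVertex i)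
  | _, twistedAOdd n _, _, i, j =>
    congrFun (congrFun (CartanMatrix.C_transpose n).symm i) j
  | _, twistedD n _, _, i, j =>
    congrFun (congrFun (CartanMatrix.B_transpose n).symm i) j
  | _, twistedE₆, _, i, j => by fin_cases i <;> fin_cases j <;> rfl
  | _, twistedD₄, _, i, j => by fin_cases i <;> fin_cases j <;> rfl

/-- The linear isomorphism `ε` from the dual Cartan subalgebra of `A'` to the Cartan subalgebra
of `A` taking the fundamental weights of `A'` to the corresponding fundamental coweights of `A`
(`A` twisted and not `A_{2n}^{(2)}`). -/
def epsilon : (Fin n → ℝ) →ₗ[ℝ] (Fin n → ℝ) :=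
  Fintype.linearCombination ℝ fun i => T.fundamentalCoweight (T.dualVertex i)

/-! ### The modular matrix -/

/-- The element `x ↦ exp (2πi ⟨x, h⟩)` of the torus of characters of the weight lattice. -/
def torusExp (h : Fin n → ℝ) : AddChar T.weightLattice ℂ where
  toFun x := Complex.exp (2 * Real.pi * Complex.I * ((x : Fin n → ℝ) ⬝ᵥ h : ℝ))
  map_zero_eq_one' := by simp
  map_add_eq_mul' x y := by
    rw [← Complex.exp_add, AddSubgroup.coe_add, add_dotProduct]
    push_cast
    ring_nf

/-- The torus element `t_{μ'}` of a weight `μ'` of `A'`. -/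
def torusPoint (k : ℕ) (mu : Fin n → ℝ) : AddChar T.weightLattice ℂ :=
  T.torusExp (((k + T.dualCoxeter : ℕ) : ℝ)⁻¹ •
    if T.isUntwistedOrAEven then T.kappaInv (T.rho + mu) else T.rhoCheck + T.epsilon mu)

theorem rho_mem : T.rho ∈ T.weightLattice := by
  intro i
  refine ⟨1, ?_⟩
  simp [rho, fundamentalWeight, simpleCoroot, Finset.sum_apply, Pi.single_apply]

theorem reflection_mem (i : Fin n) {x : Fin n → ℝ} (hx : x ∈ T.weightLattice) :
    T.reflection i x ∈ T.weightLattice := by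
  intro j
  obtain ⟨a, ha⟩ := hx i
  obtain ⟨b, hb⟩ := hx j
  refine ⟨b - a * T.finitePart i j, ?_⟩
  have h1 : T.reflection i x = x - (x ⬝ᵥ T.simpleCoroot i) • T.simpleRoot i := by
    simp [reflection, Module.reflection_apply, dotProductBilin, dotProduct_comm]
  rw [h1, sub_dotProduct, smul_dotProduct, hb, ha]
  simp [simpleCoroot, simpleRoot_apply]

theorem weyl_mem {w : (Fin n → ℝ) ≃ₗ[ℝ] (Fin n → ℝ)} (hw : w ∈ T.weylGroup) :
    ∀ {x : Fin n → ℝ}, x ∈ T.weightLattice → w x ∈ T.weightLattice := by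
  induction hw using Subgroup.closure_induction'' with
  | mem w hw => obtain ⟨i, rfl⟩ := hw; exact T.reflection_mem i
  | inv_mem w hw =>
    obtain ⟨i, rfl⟩ := hw
    intro x hx
    have h : (T.reflection i)⁻¹ = T.reflection i := Module.reflection_inv _
    rw [h]
    exact T.reflection_mem i hx
  | one => exact fun hx => hx
  | mul w v _ _ hw hv => exact fun hx => hw (hv hx)

/-- The alternating sum `J_lam(t) = ∑_w (-1)^{ℓ(w)} w(lam + ρ)(t)` over the (finite) Weyl group,
where a weight `x` is evaluated at the character `t` of the weight lattice as `t x`. -/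
def altSum (lam : T.weightLattice) (t : AddChar T.weightLattice ℂ) : ℂ :=
  ∑ᶠ w : T.weylGroup, (-1) ^ T.length w *
    t ⟨(w : (Fin n → ℝ) ≃ₗ[ℝ] (Fin n → ℝ)) (lam + T.rho),
      T.weyl_mem w.2 (add_mem lam.2 T.rho_mem)⟩

/-- The modular matrix `S` from `A` to `A'` at level `k`. -/
def modularS (k : ℕ) : Matrix (T.levelWeights k) (T.adjacent.levelWeights k) ℂ :=
  Matrix.of fun lam mu =>
    Complex.I ^ T.positiveRoots.ncard * ((Real.sqrt (T.quotientOrder k))⁻¹ : ℝ) *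
      T.altSum ⟨lam, lam.2.1⟩ (T.torusPoint k mu)

end AffineType

end

/-! ### Vectors of norm two in integral lattices with an obtuse basis -/

namespace Matrix

variable {ι : Type*} [Fintype ι]

/-! Put `K = k + ȟ`, let `W` be the finite Weyl group and `P` the weight lattice. The prefactor of
`S` has absolute square `1 / |P/KM|`, so the claim is that `J_λ(t) * conj J_λ'(t)`, summed over the
points `t = t_μ'`, gives `|P/KM|` if `λ = λ'` and `0` otherwise. The proof evaluates the sum of the
same products over all characters of the finite group `P/KM` in two ways.

Expanding both alternating sums and using orthogonality of characters, only the pairs `(w, v)` with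
`w(λ+ρ) - v(λ'+ρ) ∈ KM` survive. Both `λ+ρ` and `λ'+ρ` lie in the open alcove of the affine Weyl
group `W ⋉ KM`, and no nontrivial element of that group takes a point of the alcove into the alcove.
Hence `w = v` and `λ = λ'`, and the total is `|W| |P/KM|` or `0`.

On the other hand, the characters of `P/KM` are `exp(2πi ⟨·, y⟩ / K)` with `y` in the Cartan
subalgebra modulo `K` times the coroot lattice, subject to an integrality condition. Up to `W`, the
point `y` lies in the closed alcove of a second affine Weyl group, `W` extended by `K` times the
coroot lattice. If `y` is on a wall, an element of sign `-1` fixes the character and `J` vanishes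
there. If `y` is in the interior, its orbit is free, and integrality says precisely that the
character is some `t_μ'` with `μ' ∈ P'_k`; this uses that `A` and `A'` have the same dual Coxeter
number. The products are `W`-invariant, so the total is `|W|` times the desired sum.

The averaging argument is `AddChar.finite_and_sum_alternating`. The geometry is proved once for an
abstract `CartanDatum` and applied to both affine groups: `eq_one_of_add_mem_alcove` (freeness) and
`exists_mem_closedAlcove` (fundamental domain). Freeness rests on the fact that an affine root has
simple coordinates of one sign, which is reduced to vectors of norm two in an even lattice with an
obtuse basis. `HasData` collects all that depends on the type. -/

theorem IsSymm.dotProduct_mulVec_comm {R : Type*} [CommRing R] {S : Matrix ι ι R} (hS : S.IsSymm)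
    (x y : ι → R) : x ⬝ᵥ S *ᵥ y = y ⬝ᵥ S *ᵥ x := by
  rw [dotProduct_comm, ← vecMul_transpose, hS.eq, ← dotProduct_mulVec]

theorem IsSymm.dotProduct_mulVec_sub_self {R : Type*} [CommRing R] {S : Matrix ι ι R}
    (hS : S.IsSymm) (x y : ι → R) :
    (x - y) ⬝ᵥ S *ᵥ (x - y) = x ⬝ᵥ S *ᵥ x - 2 * (x ⬝ᵥ S *ᵥ y) + y ⬝ᵥ S *ᵥ y := by
  simp only [mulVec_sub, sub_dotProduct, dotProduct_sub, hS.dotProduct_mulVec_comm y x]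
  ring

theorem IsSymm.even_dotProduct_mulVec_self {S : Matrix ι ι ℤ} (hS : S.IsSymm)
    (hd : ∀ i, Even (S i i)) (x : ι → ℤ) : Even (x ⬝ᵥ S *ᵥ x) := by
  classical
  rw [← Finset.univ_sum_single x]
  refine Finset.sum_induction _ (fun x => Even (x ⬝ᵥ S *ᵥ x)) ?_ (by simp) ?_
  · intro a b ha hb
    have h : (a + b) ⬝ᵥ S *ᵥ (a + b) = a ⬝ᵥ S *ᵥ a + b ⬝ᵥ S *ᵥ b + 2 * (a ⬝ᵥ S *ᵥ b) := by
      simp only [mulVec_add, add_dotProduct, dotProduct_add, hS.dotProduct_mulVec_comm b a]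
      ring
    rw [h]
    exact (ha.add hb).add (even_two_mul _)
  · intro i _
    simp only [single_dotProduct, mulVec_single, Pi.smul_apply, col_apply]
    exact ((hd i).mul_right _).mul_left _

/-- The Gram matrix of an obtuse basis of an even positive definite integral lattice. -/
structure IsObtuseEven (S : Matrix ι ι ℤ) : Prop where
  symm : S.IsSymm
  even_diag : ∀ i, Even (S i i)
  nonpos : ∀ i j, i ≠ j → S i j ≤ 0
  posDef : ∀ x : ι → ℤ, x ≠ 0 → 0 < x ⬝ᵥ S *ᵥ x

namespace IsObtuseEven

variable {S : Matrix ι ι ℤ} (hS : S.IsObtuseEven)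
include hS

/-- Positive norms are even, hence at least two. The arguments below live on this gap: a vector of
norm two cannot split into two nonzero parts at an obtuse angle. -/
theorem two_le {x : ι → ℤ} (hx : x ≠ 0) : 2 ≤ x ⬝ᵥ S *ᵥ x := by
  have h1 := hS.posDef x hx
  obtain ⟨a, ha⟩ := hS.symm.even_dotProduct_mulVec_self hS.even_diag x
  omega

/-- Disjoint supports leave only off-diagonal entries. -/
theorem dotProduct_nonpos {p q : ι → ℤ} (hp : 0 ≤ p) (hq : 0 ≤ q) (hpq : ∀ i, p i * q i = 0) :
    p ⬝ᵥ S *ᵥ q ≤ 0 := by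
  simp only [dotProduct, mulVec, Finset.mul_sum]
  refine Finset.sum_nonpos fun i _ => Finset.sum_nonpos fun j _ => ?_
  by_cases h : i = j
  · subst h
    rw [show p i * (S i i * q i) = S i i * (p i * q i) by ring, hpq, mul_zero]
  · have h1 := hS.nonpos i j h
    have h2 := mul_nonneg (hp i) (hq j)
    calc p i * (S i j * q j) = S i j * (p i * q j) := by ring
      _ ≤ 0 := mul_nonpos_of_nonpos_of_nonneg h1 h2

/-- In `x = x⁺ - x⁻` the two parts have nonpositive inner product, so the norm of `x` is at least
the sum of their norms; if both were nonzero it would be at least four. -/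
theorem nonneg_or_nonpos {x : ι → ℤ} (hx : x ⬝ᵥ S *ᵥ x = 2) : 0 ≤ x ∨ x ≤ 0 := by
  have hpq : ∀ i, (x⁺) i * (x⁻) i = 0 := fun i => by
    rcases le_total 0 (x i) with h | h <;> simp [Pi.posPart_apply, Pi.negPart_apply, h]
  have h1 := hS.dotProduct_nonpos (posPart_nonneg x) (negPart_nonneg x) hpq
  have h2 := hS.symm.dotProduct_mulVec_sub_self (x⁺) (x⁻)
  rw [posPart_sub_negPart, hx] at h2
  by_cases hp : x⁺ = 0
  · exact Or.inr (posPart_eq_zero.1 hp)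
  by_cases hq : x⁻ = 0
  · exact Or.inl (negPart_eq_zero.1 hq)
  have h3 := hS.two_le hp
  have h4 := hS.two_le hq
  omega

/-- Write `v - x = p - q` with disjoint supports. If `q ≠ 0`, dominance of `v` gives `(x, q) ≥ (q,
q)`, so `x - q` has norm at most `2 - (q, q) ≤ 0` and `x = q`. Then `p = v` has full support, which
forces `q = 0` after all. -/
theorem le_of_dominant {v : ι → ℤ} (hv : ∀ i, 0 < v i) (hv' : ∀ i, 0 ≤ (S *ᵥ v) i)
    {x : ι → ℤ} (hx : x ⬝ᵥ S *ᵥ x = 2) : x ≤ v := by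
  set p := (v - x)⁺ with hp
  set q := (v - x)⁻ with hq
  have hpq : ∀ i, p i * q i = 0 := fun i => by
    rcases le_total (x i) (v i) with h | h <;>
      simp [hp, hq, Pi.posPart_apply, Pi.negPart_apply, h]
  have h1 := hS.dotProduct_nonpos (posPart_nonneg (v - x)) (negPart_nonneg (v - x)) hpq
  rw [← hp, ← hq] at h1
  have hvx : v - x = p - q := (posPart_sub_negPart _).symm
  have hq0 : 0 ≤ q := negPart_nonneg _
  by_cases h0 : q = 0
  · exact sub_nonneg.1 (negPart_eq_zero.1 h0)
  exfalso
  have hxe : x = v - p + q := by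
    rw [← sub_sub_self v x, hvx]; abel
  have h2 : x ⬝ᵥ S *ᵥ q = q ⬝ᵥ S *ᵥ v - p ⬝ᵥ S *ᵥ q + q ⬝ᵥ S *ᵥ q := by
    rw [hS.symm.dotProduct_mulVec_comm q v]
    conv_lhs => rw [hxe]
    simp only [add_dotProduct, sub_dotProduct]
  have h3 : 0 ≤ q ⬝ᵥ S *ᵥ v := Finset.sum_nonneg fun i _ => mul_nonneg (hq0 i) (hv' i)
  have h4 := hS.symm.dotProduct_mulVec_sub_self x q
  have h5 := hS.two_le h0
  have h6 : x - q = 0 := by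
    by_contra hne
    have := hS.two_le hne
    omega
  have h7 : p = v := by
    rw [hxe] at h6
    have : v - p = 0 := by simpa using h6
    exact (sub_eq_zero.1 this).symm
  refine h0 (funext fun i => ?_)
  have := hpq i
  rw [h7] at this
  exact (mul_eq_zero.1 this).resolve_left (hv i).ne'

end IsObtuseEven

/-- A symmetric matrix with nonpositive entries off the diagonal is bounded below by a diagonal
form if it maps a positive vector to a positive vector. -/
theorem IsSymm.sum_le_dotProduct_mulVec_self {S : Matrix ι ι ℝ} (hS : S.IsSymm)
    (h : ∀ i j, i ≠ j → S i j ≤ 0) {v : ι → ℝ} (hv : ∀ i, 0 < v i) (x : ι → ℝ) :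
    ∑ i, (S *ᵥ v) i / v i * x i ^ 2 ≤ x ⬝ᵥ S *ᵥ x := by
  -- This double sum equals twice the left side minus twice the right side of the claim.
  have h1 : ∑ i, ∑ j, S i j * (v i * v j) * (x i / v i - x j / v j) ^ 2 ≤ 0 := by
    refine Finset.sum_nonpos fun i _ => Finset.sum_nonpos fun j _ => ?_
    by_cases hij : i = j
    · simp [hij]
    · have := mul_nonneg (mul_nonneg (hv i).le (hv j).le) (sq_nonneg (x i / v i - x j / v j))
      calc _ = S i j * (v i * v j * (x i / v i - x j / v j) ^ 2) := by ring
        _ ≤ 0 := mul_nonpos_of_nonpos_of_nonneg (h i j hij) this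
  have h2 : ∀ i j, S i j * (v i * v j) * (x i / v i - x j / v j) ^ 2 =
      S i j * v j / v i * x i ^ 2 + S i j * v i / v j * x j ^ 2 - 2 * (x i * (S i j * x j)) := by
    intro i j
    have := (hv i).ne'
    have := (hv j).ne'
    field_simp
    ring
  have h3 : ∑ i, ∑ j, S i j * v j / v i * x i ^ 2 = ∑ i, (S *ᵥ v) i / v i * x i ^ 2 := by
    simp only [mulVec, dotProduct, Finset.sum_div, Finset.sum_mul]
  have h4 : ∑ i, ∑ j, S i j * v i / v j * x j ^ 2 = ∑ i, (S *ᵥ v) i / v i * x i ^ 2 := by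
    rw [Finset.sum_comm, ← h3]
    simp only [hS.apply]
  have h5 : ∑ i, ∑ j, x i * (S i j * x j) = x ⬝ᵥ S *ᵥ x := by
    simp only [mulVec, dotProduct, Finset.mul_sum]
  have h6 : ∑ i, ∑ j, 2 * (x i * (S i j * x j)) = 2 * (x ⬝ᵥ S *ᵥ x) := by
    simp only [← h5, Finset.mul_sum]
  simp only [h2, Finset.sum_sub_distrib, Finset.sum_add_distrib, h3, h4, h6] at h1
  linarith

end Matrix

/-! ### Finite root systems from Cartan matrices -/

/-- A Cartan matrix `C i j = ⟨α_i, α̌_j⟩` of finite type together with the half squared lengths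
`d i` of the simple roots (the short ones have `d i = 1`, the long ones `d i = r`) and the
coordinates `mark` and `comark` of the highest root and of its coroot. The vector `u` certifies
that the form is positive definite. -/
structure CartanDatum (ι : Type*) [Fintype ι] where
  C : Matrix ι ι ℤ
  r : ℤ
  d : ι → ℤ
  e : ι → ℤ
  mark : ι → ℤ
  comark : ι → ℤ
  u : ι → ℤ
  diag : ∀ i, C i i = 2
  nonpos : ∀ i j, i ≠ j → C i j ≤ 0
  r_le : r ≤ 3
  d_pos : ∀ i, 0 < d i
  e_pos : ∀ i, 0 < e i
  d_mul_e : ∀ i, d i * e i = r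
  length_mem : ∀ i, d i = 1 ∨ d i = r
  symm : ∀ i j, C i j * d j = C j i * d i
  u_pos : ∀ i, 0 < u i
  mulVec_u : ∀ i, 0 < (C *ᵥ u) i
  mark_pos : ∀ i, 0 < mark i
  comark_pos : ∀ i, 0 < comark i
  d_mul_mark : ∀ i, d i * mark i = r * comark i
  dominant : ∀ i, 0 ≤ (C *ᵥ comark) i
  mark_comark : mark ⬝ᵥ C *ᵥ comark = 2

namespace CartanDatum

variable {ι : Type*} [Fintype ι] (D : CartanDatum ι)

include D in
theorem nonempty : Nonempty ι := by
  by_contra h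
  rw [not_nonempty_iff] at h
  simpa using D.mark_comark

theorem r_pos : 0 < D.r := by
  obtain ⟨i⟩ := D.nonempty
  rw [← D.d_mul_e i]
  exact mul_pos (D.d_pos i) (D.e_pos i)

/-- The Gram matrix of the simple roots. -/
def gramRoot : Matrix ι ι ℤ := Matrix.of fun i j => D.C i j * D.d j

/-- The Gram matrix of the simple coroots. -/
def gramCoroot : Matrix ι ι ℤ := Matrix.of fun i j => D.e i * D.C i j

theorem gramRoot_mulVec (x : ι → ℤ) : D.gramRoot *ᵥ x = D.C *ᵥ fun i => D.d i * x i := by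
  ext i
  simp [gramRoot, Matrix.mulVec, dotProduct, mul_assoc]

theorem dotProduct_gramCoroot (x y : ι → ℤ) :
    x ⬝ᵥ D.gramCoroot *ᵥ y = (fun i => D.e i * x i) ⬝ᵥ D.C *ᵥ y := by
  simp only [gramCoroot, Matrix.mulVec, dotProduct, Matrix.of_apply, Finset.mul_sum]
  exact Finset.sum_congr rfl fun i _ => Finset.sum_congr rfl fun j _ => by ring

theorem gramRoot_isSymm : D.gramRoot.IsSymm := by
  ext i j
  exact D.symm j i

theorem e_symm (i j : ι) : D.e i * D.C i j = D.e j * D.C j i := by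
  have h := D.symm i j
  have hi := D.d_mul_e i
  have hj := D.d_mul_e j
  have : D.d i * D.d j * (D.e i * D.C i j) = D.d i * D.d j * (D.e j * D.C j i) := by
    linear_combination (D.d i * D.e i) * h + D.d i * D.C j i * (hi - hj)
  exact mul_left_cancel₀ (mul_pos (D.d_pos i) (D.d_pos j)).ne' this

theorem gramCoroot_isSymm : D.gramCoroot.IsSymm := by
  ext i j
  exact D.e_symm j i

/-- The form of the root lattice is bounded below by a multiple of the standard one. -/
theorem exists_le_gramRoot : ∃ ε : ℝ, 0 < ε ∧ ∀ x : ι → ℝ,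
    ε * ∑ i, x i ^ 2 ≤ x ⬝ᵥ D.gramRoot.map (Int.cast : ℤ → ℝ) *ᵥ x := by
  have hd : ∀ i, (0 : ℝ) < D.d i := fun i => by exact_mod_cast D.d_pos i
  have hu : ∀ i, (0 : ℝ) < D.u i := fun i => by exact_mod_cast D.u_pos i
  -- Dividing by `d` turns the Gram matrix back into `C`, so that it maps `v` to the positive vector
  -- `C u`.
  set v : ι → ℝ := fun i => D.u i / D.d i
  have hv : ∀ i, 0 < v i := fun i => div_pos (hu i) (hd i)
  have hS : ∀ i, 0 < (D.gramRoot.map (Int.cast : ℤ → ℝ) *ᵥ v) i := by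
    intro i
    have : (D.gramRoot.map (Int.cast : ℤ → ℝ) *ᵥ v) i = ((D.C *ᵥ D.u) i : ℤ) := by
      simp only [Matrix.mulVec, dotProduct, gramRoot, Matrix.map_apply, Matrix.of_apply, v]
      push_cast
      refine Finset.sum_congr rfl fun j _ => ?_
      have := (hd j).ne'
      field_simp
    rw [this]
    exact_mod_cast D.mulVec_u i
  obtain ⟨i₀⟩ := D.nonempty
  -- The smallest diagonal coefficient serves as `ε`.
  obtain ⟨k, -, hk⟩ := Finset.exists_min_image Finset.univ
    (fun i => (D.gramRoot.map (Int.cast : ℤ → ℝ) *ᵥ v) i / v i) ⟨i₀, Finset.mem_univ _⟩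
  refine ⟨_, div_pos (hS k) (hv k), fun x => ?_⟩
  have hsymm : (D.gramRoot.map (Int.cast : ℤ → ℝ)).IsSymm := D.gramRoot_isSymm.map _
  refine le_trans ?_ (hsymm.sum_le_dotProduct_mulVec_self (fun i j hij => ?_) hv x)
  · rw [Finset.mul_sum]
    exact Finset.sum_le_sum fun i hi =>
      mul_le_mul_of_nonneg_right (hk i hi) (sq_nonneg _)
  · have : D.C i j * D.d j ≤ 0 :=
      mul_nonpos_of_nonpos_of_nonneg (D.nonpos i j hij) (D.d_pos j).le
    change ((D.C i j * D.d j : ℤ) : ℝ) ≤ 0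
    exact_mod_cast this

theorem gramRoot_posDef {x : ι → ℤ} (hx : x ≠ 0) : 0 < x ⬝ᵥ D.gramRoot *ᵥ x := by
  obtain ⟨ε, hε, h⟩ := D.exists_le_gramRoot
  have h1 := h fun i => x i
  have h2 : ((fun i => (x i : ℝ)) ⬝ᵥ D.gramRoot.map (Int.cast : ℤ → ℝ) *ᵥ fun i => (x i : ℝ)) =
      ((x ⬝ᵥ D.gramRoot *ᵥ x : ℤ) : ℝ) := by
    simp [Matrix.mulVec, dotProduct]
  rw [h2] at h1
  obtain ⟨i, hi⟩ := Function.ne_iff.1 hx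
  have h3 : 0 < ∑ i, (x i : ℝ) ^ 2 := by
    refine Finset.sum_pos' (fun _ _ => sq_nonneg _) ⟨i, Finset.mem_univ _, ?_⟩
    have : (x i : ℝ) ≠ 0 := by exact_mod_cast hi
    positivity
  exact_mod_cast (mul_pos hε h3).trans_le h1

theorem gramRoot_isObtuseEven : D.gramRoot.IsObtuseEven where
  symm := D.gramRoot_isSymm
  even_diag i := by simp [gramRoot, D.diag]
  nonpos i j h := mul_nonpos_of_nonpos_of_nonneg (D.nonpos i j h) (D.d_pos j).le
  posDef _ := D.gramRoot_posDef

/-- Multiplication of the coordinates by `e` embeds the coroot lattice in the root lattice and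
scales the form by `r`, so positive definiteness passes to the coroots. -/
theorem gramRoot_e_mul (x : ι → ℤ) :
    (fun i => D.e i * x i) ⬝ᵥ D.gramRoot *ᵥ (fun i => D.e i * x i) =
      D.r * (x ⬝ᵥ D.gramCoroot *ᵥ x) := by
  rw [gramRoot_mulVec, dotProduct_gramCoroot]
  have : (fun i => D.d i * (D.e i * x i)) = D.r • x := by
    ext i
    rw [← mul_assoc, D.d_mul_e, Pi.smul_apply, smul_eq_mul]
  rw [this, Matrix.mulVec_smul, dotProduct_smul, smul_eq_mul]

theorem gramCoroot_isObtuseEven : D.gramCoroot.IsObtuseEven where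
  symm := D.gramCoroot_isSymm
  even_diag i := by simp [gramCoroot, D.diag]
  nonpos i j h := mul_nonpos_of_nonneg_of_nonpos (D.e_pos i).le (D.nonpos i j h)
  posDef x hx := by
    have h : (fun i => D.e i * x i) ≠ 0 := by
      intro h
      refine hx (funext fun i => ?_)
      exact (mul_eq_zero.1 (congrFun h i)).resolve_left (D.e_pos i).ne'
    have h1 := D.gramRoot_posDef h
    rw [gramRoot_e_mul] at h1
    exact pos_of_mul_pos_right h1 D.r_pos.le

/-- The value of the root with coordinates `c` on the coroot with coordinates `c'`. -/
def pairing (c c' : ι → ℤ) : ℤ := c ⬝ᵥ D.C *ᵥ c'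

@[simp] theorem pairing_neg_left (c c' : ι → ℤ) : D.pairing (-c) c' = -D.pairing c c' := by
  simp [pairing]

@[simp] theorem pairing_neg_right (c c' : ι → ℤ) : D.pairing c (-c') = -D.pairing c c' := by
  simp [pairing, Matrix.mulVec_neg]

theorem pairing_sub_left (a b c : ι → ℤ) :
    D.pairing (a - b) c = D.pairing a c - D.pairing b c := by
  simp [pairing]

theorem pairing_sub_right (a b c : ι → ℤ) :
    D.pairing a (b - c) = D.pairing a b - D.pairing a c := by
  simp [pairing, Matrix.mulVec_sub]

theorem pairing_smul_left (n : ℤ) (a b : ι → ℤ) :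
    D.pairing (n • a) b = n * D.pairing a b := by
  rw [pairing, smul_dotProduct, smul_eq_mul, pairing]

theorem pairing_smul_right (n : ℤ) (a b : ι → ℤ) :
    D.pairing a (n • b) = n * D.pairing a b := by
  rw [pairing, Matrix.mulVec_smul, dotProduct_smul, smul_eq_mul, pairing]

theorem pairing_single_right [DecidableEq ι] (c : ι → ℤ) (i : ι) :
    D.pairing c (Pi.single i 1) = ∑ l, c l * D.C l i := by
  simp [pairing, dotProduct]

/-- `c` and `č` are the coordinates of a root and of its coroot, and `N` is half the squared
length of the root. -/
structure IsRoot (N : ℤ) (c č : ι → ℤ) : Prop where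
  length_mem : N = 1 ∨ N = D.r
  pairing_self : D.pairing c č = 2
  d_mul : ∀ i, D.d i * c i = N * č i

namespace IsRoot

variable {D} {N N' : ℤ} {c č c' č' : ι → ℤ}

theorem N_pos (h : D.IsRoot N c č) : 0 < N := by
  rcases h.length_mem with h | h <;> rw [h]
  exacts [one_pos, D.r_pos]

/-- By `d_mul` the form identifies the root with `N` times its coroot. -/
theorem form_right (h : D.IsRoot N c č) (x : ι → ℤ) :
    x ⬝ᵥ D.gramRoot *ᵥ c = N * D.pairing x č := by
  rw [gramRoot_mulVec, show (fun i => D.d i * c i) = N • č from funext h.d_mul,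
    Matrix.mulVec_smul, dotProduct_smul, smul_eq_mul, pairing]

theorem mul_pairing_comm (h : D.IsRoot N c č) (h' : D.IsRoot N' c' č') :
    N' * D.pairing c č' = N * D.pairing c' č := by
  rw [← h.form_right, ← h'.form_right, D.gramRoot_isSymm.dotProduct_mulVec_comm]

theorem ne_zero (h : D.IsRoot N c č) : c ≠ 0 := by
  rintro rfl
  simpa [pairing] using h.pairing_self

theorem neg (h : D.IsRoot N c č) : D.IsRoot N (-c) (-č) where
  length_mem := h.length_mem
  pairing_self := by simp [h.pairing_self]
  d_mul i := by simp [h.d_mul i]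

/-- A reflection is an isometry and keeps `N`; that roots and coroots stay matched is the symmetry
`mul_pairing_comm`. -/
theorem reflect (h : D.IsRoot N c č) (h' : D.IsRoot N' c' č') :
    D.IsRoot N (c - D.pairing c č' • c') (č - D.pairing c' č • č') where
  length_mem := h.length_mem
  pairing_self := by
    rw [pairing_sub_left, pairing_sub_right, pairing_smul_left, pairing_smul_right,
      pairing_sub_right, pairing_smul_right, h.pairing_self, h'.pairing_self]
    ring
  d_mul i := by
    simp only [Pi.sub_apply, Pi.smul_apply, smul_eq_mul]
    linear_combination h.d_mul i - D.pairing c č' * h'.d_mul i -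
      č' i * h.mul_pairing_comm h'

/-- The norm of the root is `2N`, so the root determines `N`, and then `d_mul` determines the
coroot. -/
theorem coroot_eq (h : D.IsRoot N c č) (h' : D.IsRoot N' c č') : N = N' ∧ č = č' := by
  have h1 := h.form_right c
  rw [h'.form_right, h.pairing_self, h'.pairing_self] at h1
  have h2 : N = N' := by omega
  refine ⟨h2, funext fun i => mul_left_cancel₀ h.N_pos.ne' ?_⟩
  rw [← h.d_mul, h'.d_mul, h2]

theorem e_mul_of_long (h : D.IsRoot D.r c č) : c = fun i => D.e i * č i := by
  ext i
  have h1 := h.d_mul i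
  rw [← D.d_mul_e i, mul_assoc] at h1
  exact mul_left_cancel₀ (D.d_pos i).ne' h1

theorem coroot_norm_of_long (h : D.IsRoot D.r c č) : č ⬝ᵥ D.gramCoroot *ᵥ č = 2 := by
  rw [dotProduct_gramCoroot, ← h.e_mul_of_long]
  exact h.pairing_self

/-- A short root has norm two in the root lattice. A long one has norm `2r`, but its coroot has norm
two in the coroot lattice, and the two have coordinates of the same signs since `e` is positive. -/
theorem nonneg_or_nonpos (h : D.IsRoot N c č) : 0 ≤ c ∨ c ≤ 0 := by
  rcases h.length_mem with rfl | rfl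
  · refine D.gramRoot_isObtuseEven.nonneg_or_nonpos ?_
    rw [h.form_right, h.pairing_self, one_mul]
  · have h2 := h.e_mul_of_long
    rcases D.gramCoroot_isObtuseEven.nonneg_or_nonpos h.coroot_norm_of_long with h3 | h3
    · left
      rw [h2]
      exact fun i => mul_nonneg (D.e_pos i).le (h3 i)
    · right
      rw [h2]
      exact fun i => mul_nonpos_of_nonneg_of_nonpos (D.e_pos i).le (h3 i)

/-- The same split into short and long: roots are compared with the dominant vector `mark`, coroots
of long roots with `comark`. -/
theorem le_mark (h : D.IsRoot N c č) : c ≤ D.mark := by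
  rcases h.length_mem with rfl | rfl
  · refine D.gramRoot_isObtuseEven.le_of_dominant D.mark_pos (fun i => ?_) ?_
    · rw [gramRoot_mulVec, show (fun i => D.d i * D.mark i) = D.r • D.comark from
        funext D.d_mul_mark, Matrix.mulVec_smul]
      exact mul_nonneg D.r_pos.le (D.dominant i)
    · rw [h.form_right, h.pairing_self, one_mul]
  · have h1 : č ≤ D.comark := by
      refine D.gramCoroot_isObtuseEven.le_of_dominant D.comark_pos (fun i => ?_)
        h.coroot_norm_of_long
      have : (D.gramCoroot *ᵥ D.comark) i = D.e i * (D.C *ᵥ D.comark) i := by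
        simp [gramCoroot, Matrix.mulVec, dotProduct, Finset.mul_sum, mul_assoc]
      rw [this]
      exact mul_nonneg (D.e_pos i).le (D.dominant i)
    intro i
    refine le_of_mul_le_mul_left ?_ (D.d_pos i)
    rw [h.d_mul, D.d_mul_mark]
    exact mul_le_mul_of_nonneg_left (h1 i) D.r_pos.le

/-- The root system is reduced. -/
theorem eq_one_of_smul {t : ℤ} (ht : 0 < t) (h : D.IsRoot N c č)
    (h' : D.IsRoot N' (t • c) č') : t = 1 := by
  -- The form is quadratic. Since `N ≥ 1` and `N' ≤ 3`, the relation `t² N = N'` leaves only `t =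
  -- 1`.
  have h1 : t * t * N = N' := by
    have h2 := h.form_right c
    have h3 := h'.form_right (t • c)
    rw [h.pairing_self] at h2
    rw [h'.pairing_self, Matrix.mulVec_smul, smul_dotProduct, dotProduct_smul, h2,
      smul_eq_mul, smul_eq_mul] at h3
    linarith
  have h2 := D.r_le
  have h3 := h.N_pos
  have h4 := h'.N_pos
  have h5 : N' ≤ 3 := by rcases h'.length_mem with h | h <;> omega
  nlinarith

end IsRoot

variable [DecidableEq ι]

theorem isRoot_simple (i : ι) : D.IsRoot (D.d i) (Pi.single i 1) (Pi.single i 1) where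
  length_mem := D.length_mem i
  pairing_self := by
    rw [pairing_single_right]
    simp [Pi.single_apply, D.diag]
  d_mul j := by
    by_cases h : j = i
    · subst h; rfl
    · simp [h]

omit [DecidableEq ι] in
theorem isRoot_mark : D.IsRoot D.r D.mark D.comark where
  length_mem := Or.inr rfl
  pairing_self := D.mark_comark
  d_mul := D.d_mul_mark

end CartanDatum

/-! ### Affine roots -/

namespace CartanDatum

variable {ι : Type*} [Fintype ι] (D : CartanDatum ι)

/-- The affine root `root + level • δ`, where `N` is half the squared length of the root. -/
structure AffineRoot where
  N : ℤ
  root : ι → ℤ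
  coroot : ι → ℤ
  level : ℤ
  isRoot : D.IsRoot N root coroot

namespace AffineRoot

variable {D}

theorem ext' {a b : D.AffineRoot} (h : a.root = b.root) (h' : a.level = b.level) : a = b := by
  obtain ⟨N, c, č, j, hr⟩ := a
  obtain ⟨N', c', č', j', hr'⟩ := b
  obtain rfl : c = c' := h
  obtain rfl : j = j' := h'
  obtain ⟨rfl, rfl⟩ := hr.coroot_eq hr'
  rfl

/-- The opposite affine root. -/
def neg (a : D.AffineRoot) : D.AffineRoot := ⟨a.N, -a.root, -a.coroot, -a.level, a.isRoot.neg⟩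

/-- The image of the affine root `a` under the reflection of the affine root `b`. -/
def reflect (b a : D.AffineRoot) : D.AffineRoot where
  N := a.N
  root := a.root - D.pairing a.root b.coroot • b.root
  coroot := a.coroot - D.pairing b.root a.coroot • b.coroot
  level := a.level - D.pairing a.root b.coroot * b.level
  isRoot := a.isRoot.reflect b.isRoot

theorem reflect_reflect (b a : D.AffineRoot) : reflect b (reflect b a) = a := by
  have h : D.pairing (reflect b a).root b.coroot = -D.pairing a.root b.coroot := by
    simp only [reflect, pairing_sub_left, pairing_smul_left, b.isRoot.pairing_self]
    ring
  refine ext' ?_ ?_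
  · change (reflect b a).root - D.pairing (reflect b a).root b.coroot • b.root = _
    rw [h]
    simp [reflect]
  · change (reflect b a).level - D.pairing (reflect b a).root b.coroot * b.level = _
    rw [h]
    simp [reflect]

/-- The coordinates of an affine root with respect to the simple affine roots. -/
def coef (a : D.AffineRoot) : Option ι → ℤ
  | none => a.level
  -- The affine simple root is `δ - θ`, so each `δ` contributes the marks of `θ`.
  | some i => a.root i + a.level * D.mark i

theorem ext_coef {a b : D.AffineRoot} (h : a.coef = b.coef) : a = b := by
  have h0 : a.level = b.level := congrFun h none
  refine ext' (funext fun i => ?_) h0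
  have := congrFun h (some i)
  simp only [coef, h0] at this
  omega

theorem coef_neg (a : D.AffineRoot) : a.neg.coef = -a.coef := by
  ext (_ | i)
  · rfl
  · simp only [coef, neg, Pi.neg_apply]
    ring

theorem coef_reflect (b a : D.AffineRoot) :
    (reflect b a).coef = a.coef - D.pairing a.root b.coroot • b.coef := by
  ext (_ | i)
  · rfl
  · simp only [coef, reflect, Pi.sub_apply, Pi.smul_apply, smul_eq_mul]
    ring

/-- At level zero this is the finite statement. Otherwise the level decides the sign, because the
coordinates of a finite root are bounded by the marks on both sides. -/
theorem nonneg_or_nonpos (a : D.AffineRoot) : 0 ≤ a.coef ∨ a.coef ≤ 0 := by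
  have hm := a.isRoot.le_mark
  have hm' := a.isRoot.neg.le_mark
  rcases lt_trichotomy a.level 0 with h | h | h
  · right
    rintro (_ | i)
    · exact h.le
    · have h1 := hm i
      have h2 := D.mark_pos i
      simp only [coef, Pi.zero_apply]
      nlinarith
  · rcases a.isRoot.nonneg_or_nonpos with h1 | h1
    · left
      rintro (_ | i)
      · exact h.ge
      · simpa [coef, h] using h1 i
    · right
      rintro (_ | i)
      · exact h.le
      · simpa [coef, h] using h1 i
  · left
    rintro (_ | i)
    · exact h.le
    · have h1 := hm' i
      have h2 := D.mark_pos i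
      simp only [coef, Pi.zero_apply, Pi.neg_apply] at h1 ⊢
      nlinarith

variable [DecidableEq ι]

variable (D) in
/-- The simple affine roots; `none` is the affine vertex. -/
def simple : Option ι → D.AffineRoot
  | none => ⟨D.r, -D.mark, -D.comark, 1, D.isRoot_mark.neg⟩
  | some i => ⟨D.d i, Pi.single i 1, Pi.single i 1, 0, D.isRoot_simple i⟩

theorem coef_simple (i : Option ι) : (simple D i).coef = Pi.single i 1 := by
  ext (_ | j) <;> cases i <;> simp [coef, simple, Pi.single_apply]

theorem root_eq_sum (a : D.AffineRoot) : a.root = ∑ i, a.coef i • (simple D i).root := by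
  ext j
  simp [Fintype.sum_option, coef, simple, Finset.sum_apply, Pi.single_apply]

theorem coef_ne_zero (a : D.AffineRoot) : a.coef ≠ 0 := fun h =>
  a.isRoot.ne_zero (by rw [a.root_eq_sum, h]; simp)

/-- The root system is reduced, which excludes the multiples `t ≥ 2`; `t = 0` would give the root
zero. -/
theorem eq_simple_of_coef_eq {a : D.AffineRoot} {i : Option ι} {t : ℤ} (ht : 0 ≤ t)
    (h : a.coef = Pi.single i t) : a = simple D i := by
  have ht' : 0 < t := by
    refine lt_of_le_of_ne ht fun h0 => a.coef_ne_zero ?_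
    rw [h, ← h0, Pi.single_zero]
  have h1 : a.root = t • (simple D i).root := by
    rw [a.root_eq_sum, h, Finset.sum_eq_single i]
    · simp
    · intro j _ hj
      simp [hj]
    · simp
  have h2 : t = 1 := (simple D i).isRoot.eq_one_of_smul ht' (h1 ▸ a.isRoot)
  exact ext_coef (by rw [h, h2, coef_simple])

/-- The reflection changes only the coefficient at `i`. If it made the root negative, all other
coefficients would vanish and `a` would be the simple root itself. -/
theorem reflect_simple_nonneg {a : D.AffineRoot} {i : Option ι} (h : 0 ≤ a.coef)
    (hi : a ≠ simple D i) : 0 ≤ (reflect (simple D i) a).coef := by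
  rcases (reflect (simple D i) a).nonneg_or_nonpos with h1 | h1
  · exact h1
  · refine absurd (eq_simple_of_coef_eq (t := a.coef i) (h i) ?_) hi
    ext j
    by_cases hj : j = i
    · rw [hj, Pi.single_eq_same]
    · have h2 := h1 j
      rw [coef_reflect, coef_simple] at h2
      simp only [Pi.sub_apply, Pi.smul_apply, Pi.single_eq_of_ne hj, smul_zero, sub_zero] at h2
      rw [Pi.single_eq_of_ne hj]
      exact le_antisymm h2 (h j)

/-- The form ignores `δ`, so expanding one factor of `(root, root) > 0` over the affine simple roots
must produce a positive term. -/
theorem exists_pairing_pos {a : D.AffineRoot} (h : 0 ≤ a.coef) :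
    ∃ i, 0 < a.coef i ∧ 0 < D.pairing a.root (simple D i).coroot := by
  by_contra! hcon
  have h1 := D.gramRoot_posDef a.isRoot.ne_zero
  have h2 : a.root ⬝ᵥ D.gramRoot *ᵥ a.root =
      ∑ i, a.coef i * ((simple D i).N * D.pairing a.root (simple D i).coroot) := by
    conv_lhs => rw [D.gramRoot_isSymm.dotProduct_mulVec_comm]
    conv_lhs => enter [1]; rw [a.root_eq_sum]
    rw [sum_dotProduct]
    refine Finset.sum_congr rfl fun i _ => ?_
    rw [smul_dotProduct, D.gramRoot_isSymm.dotProduct_mulVec_comm,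
      (simple D i).isRoot.form_right, smul_eq_mul]
  rw [h2] at h1
  refine h1.not_ge (Finset.sum_nonpos fun i _ => ?_)
  rcases (h i).lt_or_eq with h3 | h3
  · exact mul_nonpos_of_nonneg_of_nonpos h3.le
      (mul_nonpos_of_nonneg_of_nonpos (simple D i).isRoot.N_pos.le (hcon i h3))
  · rw [← h3]; simp

/-- Every positive affine root is obtained from a simple one by simple reflections, each of which
is applied at a vertex of the support. -/
theorem induction_pos {Q : D.AffineRoot → Prop} (hs : ∀ i, Q (simple D i))
    (hr : ∀ a i, 0 < a.coef i → Q (reflect (simple D i) a) → Q a) (a : D.AffineRoot)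
    (ha : 0 ≤ a.coef) : Q a := by
  -- Induction on the height, which drops under a simple reflection with positive pairing.
  induction hm : (∑ i, a.coef i).toNat using Nat.strong_induction_on generalizing a with
  | _ m ih =>
    obtain ⟨i, hi, hp⟩ := exists_pairing_pos ha
    by_cases has : a = simple D i
    · exact has ▸ hs i
    have h1 := reflect_simple_nonneg ha has
    refine hr a i hi (ih _ ?_ _ h1 rfl)
    have h2 : ∑ j, (reflect (simple D i) a).coef j =
        ∑ j, a.coef j - D.pairing a.root (simple D i).coroot := by
      rw [coef_reflect, coef_simple]
      simp [Finset.sum_sub_distrib, ← Finset.mul_sum]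
    have h3 : 0 ≤ ∑ j, (reflect (simple D i) a).coef j := Finset.sum_nonneg fun j _ => h1 j
    omega

end AffineRoot

end CartanDatum

/-! ### The affine Weyl group -/

namespace CartanDatum

variable {ι : Type*} [Fintype ι] (D : CartanDatum ι)

/-- A real vector space with simple coroots `b i` and simple roots `f i`. -/
structure Realization (V : Type*) [AddCommGroup V] [Module ℝ V] where
  b : ι → V
  f : ι → V →ₗ[ℝ] ℝ
  f_b : ∀ i j, f i (b j) = D.C i j

namespace Realization

variable {D} {V : Type*} [AddCommGroup V] [Module ℝ V] (R : D.Realization V)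

/-- The root with coordinates `c`. -/
def rootFun (c : ι → ℤ) : V →ₗ[ℝ] ℝ := ∑ i, (c i : ℝ) • R.f i

/-- The coroot with coordinates `č`. -/
def corootVec (č : ι → ℤ) : V := ∑ i, (č i : ℝ) • R.b i

theorem rootFun_apply (c : ι → ℤ) (y : V) : R.rootFun c y = ∑ i, c i * R.f i y := by
  simp [rootFun]

theorem rootFun_corootVec (c č : ι → ℤ) : R.rootFun c (R.corootVec č) = D.pairing c č := by
  rw [rootFun_apply, corootVec]
  simp only [map_sum, map_smul, R.f_b, smul_eq_mul, pairing, dotProduct, Matrix.mulVec]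
  push_cast
  simp only [mul_comm]

theorem rootFun_sub (c c' : ι → ℤ) : R.rootFun (c - c') = R.rootFun c - R.rootFun c' := by
  ext y
  simp [rootFun_apply, sub_mul]

theorem rootFun_smul (t : ℤ) (c : ι → ℤ) : R.rootFun (t • c) = (t : ℝ) • R.rootFun c := by
  simp [rootFun, Finset.smul_sum, smul_smul]

theorem rootFun_neg (c : ι → ℤ) : R.rootFun (-c) = -R.rootFun c := by
  ext y
  simp [rootFun_apply]

theorem corootVec_sub (c c' : ι → ℤ) :
    R.corootVec (c - c') = R.corootVec c - R.corootVec c' := by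
  simp [corootVec, sub_smul]

theorem corootVec_smul (t : ℤ) (c : ι → ℤ) :
    R.corootVec (t • c) = (t : ℝ) • R.corootVec c := by
  simp [corootVec, Finset.smul_sum, smul_smul]

theorem corootVec_neg (c : ι → ℤ) : R.corootVec (-c) = -R.corootVec c := by
  simp [corootVec]

variable (K : ℝ)

/-- The value of an affine root at a point, where `δ` has the value `K`. -/
def eval (a : D.AffineRoot) (y : V) : ℝ := R.rootFun a.root y + a.level * K

theorem eval_sub_smul (a b : D.AffineRoot) (t : ℝ) (y : V) :
    R.eval K a (y - t • R.corootVec b.coroot) =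
      R.eval K a y - t * D.pairing a.root b.coroot := by
  simp only [eval, map_sub, map_smul, rootFun_corootVec, smul_eq_mul]
  ring

theorem eval_reflect (b a : D.AffineRoot) (y : V) :
    R.eval K (b.reflect a) y = R.eval K a y - R.eval K b y * D.pairing a.root b.coroot := by
  simp only [eval, AffineRoot.reflect, rootFun_sub, rootFun_smul, LinearMap.sub_apply,
    LinearMap.smul_apply, smul_eq_mul]
  push_cast
  ring

theorem eval_neg (a : D.AffineRoot) (y : V) : R.eval K a.neg y = -R.eval K a y := by
  simp only [eval, AffineRoot.neg, rootFun_neg, LinearMap.neg_apply]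
  push_cast
  ring

/-- The affine reflection of an affine root. -/
def affineReflection (a : D.AffineRoot) : Equiv.Perm V :=
  Function.Involutive.toPerm (fun y => y - R.eval K a y • R.corootVec a.coroot) fun y => by
    beta_reduce
    rw [eval_sub_smul, a.isRoot.pairing_self, sub_sub, ← add_smul]
    push_cast
    rw [show R.eval K a y + (R.eval K a y - R.eval K a y * 2) = 0 by ring, zero_smul, sub_zero]

theorem affineReflection_apply (a : D.AffineRoot) (y : V) :
    R.affineReflection K a y = y - R.eval K a y • R.corootVec a.coroot := rfl

theorem affineReflection_mul_self (a : D.AffineRoot) :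
    R.affineReflection K a * R.affineReflection K a = 1 :=
  Equiv.ext (Function.Involutive.toPerm_involutive _)

theorem eval_affineReflection (b a : D.AffineRoot) (y : V) :
    R.eval K a (R.affineReflection K b y) = R.eval K (b.reflect a) y := by
  rw [affineReflection_apply, eval_sub_smul, eval_reflect]

theorem eval_affineReflection_self (a : D.AffineRoot) (y : V) :
    R.eval K a (R.affineReflection K a y) = -R.eval K a y := by
  rw [affineReflection_apply, eval_sub_smul, a.isRoot.pairing_self]
  push_cast
  ring

theorem affineReflection_neg (a : D.AffineRoot) :
    R.affineReflection K a.neg = R.affineReflection K a := by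
  ext y
  rw [affineReflection_apply, affineReflection_apply, eval_neg]
  simp [AffineRoot.neg, corootVec_neg]

theorem affineReflection_conj (b a : D.AffineRoot) :
    R.affineReflection K b * R.affineReflection K a * R.affineReflection K b =
      R.affineReflection K (b.reflect a) := by
  ext y
  simp only [Equiv.Perm.mul_apply]
  rw [affineReflection_apply (a := a), eval_affineReflection, affineReflection_apply (a := b),
    eval_sub_smul, eval_affineReflection_self, affineReflection_apply, affineReflection_apply]
  simp only [AffineRoot.reflect, corootVec_sub, corootVec_smul]
  module

theorem affineReflection_inv (a : D.AffineRoot) :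
    (R.affineReflection K a)⁻¹ = R.affineReflection K a :=
  inv_eq_of_mul_eq_one_left (R.affineReflection_mul_self K a)

variable [DecidableEq ι]

theorem eval_eq_sum (a : D.AffineRoot) (y : V) :
    R.eval K a y = ∑ i, a.coef i * R.eval K (AffineRoot.simple D i) y := by
  simp only [Fintype.sum_option, AffineRoot.coef, eval, AffineRoot.simple, rootFun_apply,
    Pi.neg_apply, Pi.single_apply]
  simp only [Int.cast_neg, neg_mul, Finset.sum_neg_distrib, Int.cast_one, one_mul, Int.cast_add,
    Int.cast_mul, Int.cast_ite, Int.cast_zero, ite_mul, zero_mul, Finset.sum_ite_eq',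
    Finset.mem_univ, if_true, add_zero, add_mul, Finset.sum_add_distrib, mul_add, Finset.mul_sum,
    mul_neg, mul_assoc]
  ring

/-- The open fundamental alcove. -/
def alcove : Set V := {y | ∀ i, 0 < R.eval K (AffineRoot.simple D i) y}

variable {K}

theorem eval_pos {a : D.AffineRoot} (ha : 0 ≤ a.coef) {y : V} (hy : y ∈ R.alcove K) :
    0 < R.eval K a y := by
  rw [eval_eq_sum]
  obtain ⟨i, hi⟩ := Function.ne_iff.1 a.coef_ne_zero
  refine Finset.sum_pos' (fun i _ => mul_nonneg (by exact_mod_cast ha i) (hy i).le)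
    ⟨i, Finset.mem_univ _, mul_pos ?_ (hy i)⟩
  exact_mod_cast lt_of_le_of_ne (ha i) (Ne.symm hi)

/-- The product of simple affine reflections along a word. -/
def wordProd (R : D.Realization V) (K : ℝ) (l : List (Option ι)) : Equiv.Perm V :=
  (l.map fun i => R.affineReflection K (AffineRoot.simple D i)).prod

@[simp] theorem wordProd_cons (i : Option ι) (l : List (Option ι)) :
    R.wordProd K (i :: l) = R.affineReflection K (AffineRoot.simple D i) * R.wordProd K l := by
  simp [wordProd]

/-- This is the exchange condition. A root positive at `x` and negative at the end of the word
changes sign at some letter; there the transported root is simple, and that letter may be deleted at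
the cost of the reflection of `a` in front. -/
theorem exists_word_of_eval_neg {x : V} (hx : x ∈ R.alcove K) (l : List (Option ι))
    {a : D.AffineRoot} (ha : 0 ≤ a.coef) (h : R.eval K a (R.wordProd K l x) < 0) :
    ∃ l', l'.length < l.length ∧ R.wordProd K l = R.affineReflection K a * R.wordProd K l' := by
  induction l generalizing a with
  | nil => exact absurd h (R.eval_pos ha hx).not_gt
  | cons i t ih =>
    by_cases hi : a = AffineRoot.simple D i
    · exact ⟨t, by simp, by rw [wordProd_cons, hi]⟩
    · have h1 := AffineRoot.reflect_simple_nonneg ha hi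
      rw [wordProd_cons, Equiv.Perm.mul_apply, eval_affineReflection] at h
      obtain ⟨l', hl, he⟩ := ih h1 h
      refine ⟨i :: l', by simpa using hl, ?_⟩
      rw [wordProd_cons, wordProd_cons, he, ← affineReflection_conj]
      simp only [← mul_assoc, affineReflection_mul_self, one_mul]

/-- The affine Weyl group acts simply transitively on alcoves: an element that takes a point of
the alcove into the alcove is trivial. -/
theorem wordProd_eq_one {x : V} (hx : x ∈ R.alcove K) (l : List (Option ι))
    (h : R.wordProd K l x ∈ R.alcove K) : R.wordProd K l = 1 := by
  induction hm : l.length using Nat.strong_induction_on generalizing l with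
  | _ m ih =>
    rcases l with _ | ⟨i, t⟩
    · rfl
    have h1 := h i
    rw [wordProd_cons, Equiv.Perm.mul_apply, eval_affineReflection_self] at h1
    -- Before the last reflection `i` the point lay on the negative side of its wall, so exchange
    -- produces a second factor `i`, which cancels the first.
    obtain ⟨l', hl, he⟩ := R.exists_word_of_eval_neg hx t (a := AffineRoot.simple D i)
      (by rw [AffineRoot.coef_simple]; exact Pi.single_nonneg.2 zero_le_one) (by linarith)
    have h2 : R.wordProd K (i :: t) = R.wordProd K l' := by
      rw [wordProd_cons, he, ← mul_assoc, affineReflection_mul_self, one_mul]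
    rw [h2] at h ⊢
    exact ih _ (by simp at hm; omega) l' h rfl

variable (K) in
/-- The affine Weyl group. -/
def affineWeylGroup : Subgroup (Equiv.Perm V) :=
  Subgroup.closure (Set.range fun i => R.affineReflection K (AffineRoot.simple D i))

theorem exists_wordProd {g : Equiv.Perm V} (hg : g ∈ R.affineWeylGroup K) :
    ∃ l, g = R.wordProd K l := by
  induction hg using Subgroup.closure_induction_left with
  | one => exact ⟨[], rfl⟩
  | mul_left x hx y _ ih =>
    obtain ⟨i, rfl⟩ := hx
    obtain ⟨l, rfl⟩ := ih
    exact ⟨i :: l, by simp⟩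
  | inv_mul_cancel x hx y _ ih =>
    obtain ⟨i, rfl⟩ := hx
    obtain ⟨l, rfl⟩ := ih
    exact ⟨i :: l, by simp [affineReflection_inv]⟩

theorem eq_one_of_mem_alcove {g : Equiv.Perm V} (hg : g ∈ R.affineWeylGroup K) {x : V}
    (hx : x ∈ R.alcove K) (h : g x ∈ R.alcove K) : g = 1 := by
  obtain ⟨l, rfl⟩ := R.exists_wordProd hg
  exact R.wordProd_eq_one hx l h

theorem simple_mem_affineWeylGroup (i : Option ι) :
    R.affineReflection K (AffineRoot.simple D i) ∈ R.affineWeylGroup K :=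
  Subgroup.subset_closure ⟨i, rfl⟩

/-- Conjugation by simple reflections leads from a simple root to any positive one, and opposite
roots define the same reflection. -/
theorem affineReflection_mem (a : D.AffineRoot) :
    R.affineReflection K a ∈ R.affineWeylGroup K := by
  have key : ∀ a : D.AffineRoot, 0 ≤ a.coef →
      R.affineReflection K a ∈ R.affineWeylGroup K := by
    refine AffineRoot.induction_pos R.simple_mem_affineWeylGroup fun a i _ h => ?_
    rw [← AffineRoot.reflect_reflect (AffineRoot.simple D i) a, ← affineReflection_conj]
    have hi := R.simple_mem_affineWeylGroup (K := K) i
    exact mul_mem (mul_mem hi h) hi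
  rcases a.nonneg_or_nonpos with h | h
  · exact key a h
  · rw [← affineReflection_neg]
    exact key _ (by rw [AffineRoot.coef_neg]; exact neg_nonneg.2 h)

/-- Translations by coroots lie in the affine Weyl group. -/
theorem addRight_mem (z : ι → ℤ) : Equiv.addRight (K • R.corootVec z) ∈ R.affineWeylGroup K := by
  let T : AddSubgroup (ι → ℤ) :=
    { carrier := {z | Equiv.addRight (K • R.corootVec z) ∈ R.affineWeylGroup K}
      zero_mem' := by
        have h1 : Equiv.addRight (K • R.corootVec 0) = 1 := by
          ext y
          simp [corootVec]
        rw [Set.mem_ofPred_eq, h1]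
        exact one_mem _
      add_mem' := by
        intro z z' h h'
        have h1 : Equiv.addRight (K • R.corootVec (z + z')) =
            Equiv.addRight (K • R.corootVec z) * Equiv.addRight (K • R.corootVec z') := by
          ext y
          simp only [Equiv.coe_addRight, Equiv.Perm.mul_apply, corootVec, Pi.add_apply,
            Int.cast_add, add_smul, Finset.sum_add_distrib]
          module
        rw [Set.mem_ofPred_eq, h1]
        exact mul_mem h h'
      neg_mem' := by
        intro z h
        have h1 : Equiv.addRight (K • R.corootVec (-z)) =
            (Equiv.addRight (K • R.corootVec z))⁻¹ := by
          refine eq_inv_of_mul_eq_one_left (Equiv.ext fun y => ?_)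
          simp [corootVec_neg]
        rw [Set.mem_ofPred_eq, h1]
        exact inv_mem h }
  have key : ∀ i, Pi.single i 1 ∈ T := by
    intro i
    -- The reflections of `α_i` and of `-α_i - δ` have parallel mirrors; their product is the
    -- translation by `K α̌_i`.
    let a : D.AffineRoot := ⟨_, _, _, -1, (D.isRoot_simple i).neg⟩
    have h1 := mul_mem (R.simple_mem_affineWeylGroup (K := K) (some i))
      (R.affineReflection_mem (K := K) a)
    have h2 : R.affineReflection K (AffineRoot.simple D (some i)) * R.affineReflection K a =
        Equiv.addRight (K • R.corootVec (Pi.single i 1)) := by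
      ext y
      have h3 : D.pairing (AffineRoot.simple D (some i)).root a.coroot = -2 := by
        simpa [AffineRoot.simple, a] using (D.isRoot_simple i).pairing_self
      rw [Equiv.Perm.mul_apply, affineReflection_apply, affineReflection_apply (a := a),
        eval_sub_smul, h3]
      simp only [eval, AffineRoot.simple, a, Equiv.coe_addRight, corootVec_neg, rootFun_neg,
        LinearMap.neg_apply]
      push_cast
      module
    rwa [h2] at h1
  have hz : z = ∑ i, z i • Pi.single i (1 : ℤ) := by
    ext j
    simp [Finset.sum_apply, Pi.single_apply]
  change z ∈ T
  rw [hz]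
  exact sum_mem fun i _ => zsmul_mem (key i) _

end Realization

end CartanDatum

/-- A reflection has determinant `-1`. -/
theorem Module.det_reflection {V : Type*} [AddCommGroup V] [Module ℝ V] [Module.Free ℝ V]
    [Module.Finite ℝ V] {x : V} {f : Module.Dual ℝ V} (h : f x = 2) :
    LinearMap.det (Module.reflection h : V →ₗ[ℝ] V) = -1 := by
  have h1 : (Module.reflection h : V →ₗ[ℝ] V) = LinearMap.transvection f (-x) := by
    ext y
    simp [LinearMap.transvection, Module.reflection_apply, sub_eq_add_neg]
  rw [h1, LinearMap.transvection.det, map_neg, h]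
  norm_num

namespace CartanDatum

variable {ι : Type*} [Fintype ι] {D : CartanDatum ι} [DecidableEq ι]

/-! ### The finite Weyl group -/

namespace Realization

variable {V : Type*} [AddCommGroup V] [Module ℝ V] (R : D.Realization V)

omit [DecidableEq ι] in
theorem f_b_self (i : ι) : R.f i (R.b i) = 2 := by rw [R.f_b, D.diag]; norm_num

/-- The simple reflections. -/
def reflection (i : ι) : V ≃ₗ[ℝ] V := Module.reflection (R.f_b_self i)

omit [DecidableEq ι] in
theorem reflection_apply (i : ι) (y : V) : R.reflection i y = y - R.f i y • R.b i :=
  Module.reflection_apply _ _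

/-- The finite Weyl group. -/
def weylGroup : Subgroup (V ≃ₗ[ℝ] V) := Subgroup.closure (Set.range R.reflection)

omit [DecidableEq ι] in
theorem reflection_mem (i : ι) : R.reflection i ∈ R.weylGroup := Subgroup.subset_closure ⟨i, rfl⟩

theorem affineReflection_simple (K : ℝ) (i : ι) (y : V) :
    R.affineReflection K (AffineRoot.simple D (some i)) y = R.reflection i y := by
  simp [affineReflection_apply, reflection_apply, eval, AffineRoot.simple, rootFun_apply,
    corootVec, Pi.single_apply]

theorem toEquiv_mem_affineWeylGroup (K : ℝ) {w : V ≃ₗ[ℝ] V} (hw : w ∈ R.weylGroup) :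
    w.toEquiv ∈ R.affineWeylGroup K := by
  induction hw using Subgroup.closure_induction with
  | mem w hw =>
    obtain ⟨i, rfl⟩ := hw
    convert R.simple_mem_affineWeylGroup (K := K) (some i) using 1
    ext y
    exact (R.affineReflection_simple K i y).symm
  | one => exact one_mem _
  | mul w v _ _ hw hv => exact mul_mem hw hv
  | inv w _ hw => exact inv_mem hw

/-- An element of the affine Weyl group that takes a point of the open alcove into the open alcove
is trivial. -/
theorem eq_one_of_add_mem_alcove {K : ℝ} {w : V ≃ₗ[ℝ] V} (hw : w ∈ R.weylGroup) (z : ι → ℤ)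
    {x : V} (hx : x ∈ R.alcove K) (h : w x + K • R.corootVec z ∈ R.alcove K) :
    w = 1 ∧ K • R.corootVec z = 0 := by
  have h1 := R.eq_one_of_mem_alcove
    (mul_mem (R.addRight_mem (K := K) z) (R.toEquiv_mem_affineWeylGroup K hw)) hx h
  have h2 : ∀ y, w y + K • R.corootVec z = y := fun y => Equiv.congr_fun h1 y
  -- The value at the origin isolates the translation part.
  have h3 : K • R.corootVec z = 0 := by simpa using h2 0
  refine ⟨LinearEquiv.ext fun y => ?_, h3⟩
  simpa [h3] using h2 y

/-- Reflections of roots are conjugate to simple reflections. -/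
theorem exists_reflection {N : ℤ} {c č : ι → ℤ} (h : D.IsRoot N c č) (hc : 0 ≤ c) :
    ∃ w ∈ R.weylGroup, ∃ i, ∀ y, (w * R.reflection i * w⁻¹) y =
      y - R.rootFun c y • R.corootVec č := by
  -- The affine induction also serves the finite system: at level zero the affine vertex is never in
  -- the support, so only finite simple reflections are applied.
  have key : ∀ a : D.AffineRoot, 0 ≤ a.coef → a.level = 0 →
      ∃ w ∈ R.weylGroup, ∃ i, (w * R.reflection i * w⁻¹).toEquiv =
        R.affineReflection 0 a := by
    refine AffineRoot.induction_pos (fun i h => ?_) fun a i hi ih h => ?_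
    · cases i with
      | none => simp [AffineRoot.simple] at h
      | some i =>
        refine ⟨1, one_mem _, i, Equiv.ext fun y => ?_⟩
        rw [affineReflection_simple]
        simp
    · cases i with
      | none => simp [AffineRoot.coef, h] at hi
      | some i =>
        obtain ⟨w, hw, j, hj⟩ := ih (by simp [AffineRoot.reflect, AffineRoot.simple, h])
        refine ⟨R.reflection i * w, mul_mem (R.reflection_mem i) hw, j, Equiv.ext fun y => ?_⟩
        have h1 := R.affineReflection_conj 0 (AffineRoot.simple D (some i))
          ((AffineRoot.simple D (some i)).reflect a)
        rw [AffineRoot.reflect_reflect, ← hj] at h1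
        rw [← h1]
        have h2 : (R.reflection i)⁻¹ = R.reflection i := rfl
        simp only [mul_inv_rev, h2, Equiv.Perm.mul_apply, affineReflection_simple,
          LinearEquiv.coe_toEquiv, LinearEquiv.mul_apply]
  obtain ⟨w, hw, i, hi⟩ := key ⟨N, c, č, 0, h⟩ (by
    rintro (_ | i)
    · exact le_rfl
    · simpa [AffineRoot.coef] using hc i) rfl
  refine ⟨w, hw, i, fun y => ?_⟩
  have := Equiv.congr_fun hi y
  simpa [affineReflection_apply, eval] using this

omit [DecidableEq ι] in
theorem det_reflection [Module.Free ℝ V] [Module.Finite ℝ V] (i : ι) :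
    LinearMap.det (R.reflection i : V →ₗ[ℝ] V) = -1 := Module.det_reflection _

/-- The Weyl group preserves the coroot lattice. -/
theorem exists_apply_corootVec {w : V ≃ₗ[ℝ] V} (hw : w ∈ R.weylGroup) :
    ∀ z : ι → ℤ, ∃ z', w (R.corootVec z) = R.corootVec z' := by
  have hs : ∀ i, ∀ z : ι → ℤ, ∃ z', R.reflection i (R.corootVec z) = R.corootVec z' := by
    intro i z
    have h1 : R.f i = R.rootFun (Pi.single i 1) := by
      ext y
      simp [rootFun_apply, Pi.single_apply]
    have h2 : R.b i = R.corootVec (Pi.single i 1) := by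
      simp [corootVec, Pi.single_apply]
    refine ⟨z - D.pairing (Pi.single i 1) z • Pi.single i 1, ?_⟩
    rw [reflection_apply, h1, h2, rootFun_corootVec, corootVec_sub, corootVec_smul]
  induction hw using Subgroup.closure_induction'' with
  | mem w hw => obtain ⟨i, rfl⟩ := hw; exact hs i
  | inv_mem w hw => obtain ⟨i, rfl⟩ := hw; exact hs i
  | one => exact fun z => ⟨z, rfl⟩
  | mul w v _ _ hw hv =>
    intro z
    obtain ⟨z', hz'⟩ := hv z
    obtain ⟨z'', hz''⟩ := hw z'
    exact ⟨z'', by rw [LinearEquiv.mul_apply, hz', hz'']⟩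

end Realization

/-! ### The highest root -/

section HighestRoot

variable {V : Type*} [AddCommGroup V] [Module ℝ V] {a : ι → V} {g : ι → V ≃ₗ[ℝ] V}

/-- The Weyl group orbits of the simple roots consist of the vectors whose coordinates form a
root. -/
theorem exists_weyl_simple_iff (D : CartanDatum ι)
    (hg : ∀ i l, g i (a l) = a l - (D.C l i : ℝ) • a i)
    (β : V) :
    (∃ w ∈ Subgroup.closure (Set.range g), ∃ i, β = w (a i)) ↔
      ∃ N c č, D.IsRoot N c č ∧ β = ∑ i, (c i : ℝ) • a i := by
  have hs : ∀ (i : ι) (c : ι → ℤ), g i (∑ l, (c l : ℝ) • a l) =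
      ∑ l, ((c - D.pairing c (Pi.single i 1) • Pi.single i 1 : ι → ℤ) l : ℝ) • a l := by
    intro i c
    simp only [map_sum, map_smul, hg, smul_sub, Finset.sum_sub_distrib, pairing_single_right,
      Pi.sub_apply, Int.cast_sub, sub_smul, smul_smul, ← Finset.sum_smul]
    congr 1
    simp [Pi.single_apply]
  -- The maps `g i` are prescribed only on the vectors `a l`, so they are known to be involutive
  -- only on their combinations.
  have hginv : ∀ i (c : ι → ℤ), (g i)⁻¹ (∑ l, (c l : ℝ) • a l) = g i (∑ l, (c l : ℝ) • a l) := by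
    intro i c
    change (g i).symm _ = _
    rw [LinearEquiv.symm_apply_eq, hs, hs, sub_sub, ← add_smul]
    simp only [pairing_sub_left, pairing_smul_left, (D.isRoot_simple i).pairing_self]
    rw [show D.pairing c (Pi.single i 1) + (D.pairing c (Pi.single i 1) -
      D.pairing c (Pi.single i 1) * 2) = 0 by ring, zero_smul, sub_zero]
  constructor
  · rintro ⟨w, hw, i, rfl⟩
    have key : ∀ N c č, D.IsRoot N c č → ∃ N' c' č', D.IsRoot N' c' č' ∧
        w (∑ i, (c i : ℝ) • a i) = ∑ i, (c' i : ℝ) • a i := by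
      induction hw using Subgroup.closure_induction'' with
      | mem w hw =>
        obtain ⟨i, rfl⟩ := hw
        exact fun N c č h => ⟨_, _, _, h.reflect (D.isRoot_simple i), hs i c⟩
      | inv_mem w hw =>
        obtain ⟨i, rfl⟩ := hw
        exact fun N c č h => ⟨_, _, _, h.reflect (D.isRoot_simple i), by rw [hginv, hs i c]⟩
      | one => exact fun N c č h => ⟨N, c, č, h, rfl⟩
      | mul w v _ _ hw hv =>
        intro N c č h
        obtain ⟨N', c', č', h', e'⟩ := hv N c č h
        obtain ⟨N'', c'', č'', h'', e''⟩ := hw N' c' č' h'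
        exact ⟨N'', c'', č'', h'', by rw [LinearEquiv.mul_apply, e', e'']⟩
    simpa [Pi.single_apply] using key _ _ _ (D.isRoot_simple i)
  · rintro ⟨N, c, č, h, rfl⟩
    have key : ∀ b : D.AffineRoot, 0 ≤ b.coef → b.level = 0 →
        ∃ w ∈ Subgroup.closure (Set.range g), ∃ i, ∑ i, (b.root i : ℝ) • a i = w (a i) := by
      refine AffineRoot.induction_pos (fun i h => ?_) fun b i hi ih h => ?_
      · cases i with
        | none => simp [AffineRoot.simple] at h
        | some i => exact ⟨1, one_mem _, i, by simp [AffineRoot.simple, Pi.single_apply]⟩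
      · cases i with
        | none => simp [AffineRoot.coef, h] at hi
        | some i =>
          obtain ⟨w, hw, j, hj⟩ := ih (by simp [AffineRoot.reflect, AffineRoot.simple, h])
          refine ⟨g i * w, mul_mem (Subgroup.subset_closure ⟨i, rfl⟩) hw, j, ?_⟩
          rw [LinearEquiv.mul_apply, ← hj, hs]
          conv_lhs => rw [← AffineRoot.reflect_reflect (AffineRoot.simple D (some i)) b]
          rfl
    have key' : ∀ N c č, D.IsRoot N c č → 0 ≤ c →
        ∃ w ∈ Subgroup.closure (Set.range g), ∃ i, ∑ i, (c i : ℝ) • a i = w (a i) := by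
      intro N c č h hc
      refine key ⟨N, c, č, 0, h⟩ ?_ rfl
      rintro (_ | i)
      · exact le_rfl
      · simpa [AffineRoot.coef] using hc i
    rcases h.nonneg_or_nonpos with hc | hc
    · exact key' N c č h hc
    · obtain ⟨w, hw, i, e⟩ := key' _ _ _ h.neg (neg_nonneg.2 hc)
      refine ⟨w * g i, mul_mem hw (Subgroup.subset_closure ⟨i, rfl⟩), i, ?_⟩
      have h2 : g i (a i) = -a i := by
        rw [hg, D.diag]
        push_cast
        module
      rw [LinearEquiv.mul_apply, h2, map_neg, ← e]
      simp

/-- The marks are the coordinates of the highest root. -/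
theorem epsilon_highest (D : CartanDatum ι) [Nonempty V]
    (hg : ∀ i l, g i (a l) = a l - (D.C l i : ℝ) • a i) (ha : LinearIndependent ℝ a) {Φ : Set V}
    (hΦ : Φ = {β | ∃ w ∈ Subgroup.closure (Set.range g), ∃ i, β = w (a i)}) :
    (Classical.epsilon fun θ => θ ∈ Φ ∧ ∀ β ∈ Φ, θ - β ∈ AddSubmonoid.closure (Set.range a)) =
      ∑ i, (D.mark i : ℝ) • a i := by
  have hmem : ∀ β, β ∈ Φ ↔ ∃ N c č, D.IsRoot N c č ∧ β = ∑ i, (c i : ℝ) • a i := by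
    intro β
    rw [hΦ]
    exact D.exists_weyl_simple_iff hg β
  have hcone : ∀ x ∈ AddSubmonoid.closure (Set.range a), ∃ t : ι → ℝ, 0 ≤ t ∧
      x = ∑ i, t i • a i := by
    intro x hx
    induction hx using AddSubmonoid.closure_induction with
    | mem x hx =>
      obtain ⟨i, rfl⟩ := hx
      exact ⟨Pi.single i 1, Pi.single_nonneg.2 zero_le_one, by simp [Pi.single_apply]⟩
    | zero => exact ⟨0, le_rfl, by simp⟩
    | add x y _ _ hx hy =>
      obtain ⟨t, ht, rfl⟩ := hx
      obtain ⟨s, hs, rfl⟩ := hy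
      exact ⟨t + s, add_nonneg ht hs, by simp [add_smul, Finset.sum_add_distrib]⟩
  have hθ : (∑ i, (D.mark i : ℝ) • a i) ∈ Φ := (hmem _).2 ⟨_, _, _, D.isRoot_mark, rfl⟩
  have hex : ∃ θ, θ ∈ Φ ∧ ∀ β ∈ Φ, θ - β ∈ AddSubmonoid.closure (Set.range a) := by
    refine ⟨_, hθ, fun β hβ => ?_⟩
    obtain ⟨N, c, č, h, rfl⟩ := (hmem β).1 hβ
    rw [← Finset.sum_sub_distrib]
    refine sum_mem fun i _ => ?_
    have h1 : (D.mark i : ℝ) • a i - (c i : ℝ) • a i = (D.mark i - c i).toNat • a i := by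
      rw [← sub_smul, ← Nat.cast_smul_eq_nsmul ℝ, ← Int.cast_natCast, Int.toNat_of_nonneg
        (sub_nonneg.2 (h.le_mark i)), Int.cast_sub]
    rw [h1]
    exact nsmul_mem (AddSubmonoid.subset_closure (Set.mem_range_self i)) _
  -- The chosen root has coordinates at most the marks by `le_mark`. Since its difference with the
  -- root of the marks lies in the cone, they are also at least the marks.
  obtain ⟨h1, h2⟩ := Classical.epsilon_spec hex
  set θ := Classical.epsilon fun θ => θ ∈ Φ ∧
    ∀ β ∈ Φ, θ - β ∈ AddSubmonoid.closure (Set.range a)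
  obtain ⟨N, c, č, h, hc⟩ := (hmem θ).1 h1
  obtain ⟨t, ht, e⟩ := hcone _ (h2 _ hθ)
  rw [hc]
  refine Finset.sum_congr rfl fun i _ => ?_
  have h3 : ∑ i, ((c i : ℝ) - D.mark i - t i) • a i = 0 := by
    simp only [sub_smul, Finset.sum_sub_distrib]
    rw [← hc, e, sub_self]
  have h4 := Fintype.linearIndependent_iff.1 ha _ h3 i
  have h5 : (c i : ℝ) ≤ D.mark i := by exact_mod_cast h.le_mark i
  have h6 : 0 ≤ t i := ht i
  rw [show (c i : ℝ) = D.mark i by linarith]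

end HighestRoot

end CartanDatum

namespace CartanDatum

variable {ι : Type*} [Fintype ι] (D : CartanDatum ι) [DecidableEq ι]

/-! ### Fundamental domain of the affine Weyl group -/

/-- The realization on coordinates with respect to the simple coroots. -/
def standard : D.Realization (ι → ℝ) where
  b i := Pi.single i 1
  f i := (LinearMap.proj i).comp (D.C.map (Int.cast : ℤ → ℝ)).mulVecLin
  f_b i j := by simp

theorem standard_f (i : ι) (y : ι → ℝ) :
    D.standard.f i y = (D.C.map (Int.cast : ℤ → ℝ) *ᵥ y) i := rfl

theorem standard_corootVec (z : ι → ℤ) : D.standard.corootVec z = fun i => (z i : ℝ) := by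
  ext j
  simp [Realization.corootVec, standard, Finset.sum_apply, Pi.single_apply]

/-- The form on the Cartan subalgebra in coordinates with respect to the simple coroots. -/
def coform : Matrix ι ι ℝ := D.gramCoroot.map (Int.cast : ℤ → ℝ)

omit [DecidableEq ι] in
theorem coform_isSymm : D.coform.IsSymm := D.gramCoroot_isSymm.map _

-- The substitution `x ↦ e x` reduces this to the root lattice: it multiplies the form by `r` and,
-- as `e ≥ 1`, does not decrease the sum of squares.
omit [DecidableEq ι] in
theorem exists_le_coform : ∃ ε : ℝ, 0 < ε ∧ ∀ x : ι → ℝ,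
    ε * ∑ i, x i ^ 2 ≤ x ⬝ᵥ D.coform *ᵥ x := by
  obtain ⟨ε, hε, h⟩ := D.exists_le_gramRoot
  have hr : (0 : ℝ) < D.r := by exact_mod_cast D.r_pos
  refine ⟨ε / D.r, div_pos hε hr, fun x => ?_⟩
  have h1 := h fun i => D.e i * x i
  have h2 : (fun i => D.e i * x i) ⬝ᵥ D.gramRoot.map (Int.cast : ℤ → ℝ) *ᵥ
      (fun i => D.e i * x i) = D.r * (x ⬝ᵥ D.coform *ᵥ x) := by
    simp only [coform, gramRoot, gramCoroot, Matrix.mulVec, dotProduct, Matrix.map_apply,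
      Matrix.of_apply, Finset.mul_sum]
    refine Finset.sum_congr rfl fun i _ => Finset.sum_congr rfl fun j _ => ?_
    rw [← D.d_mul_e j]
    push_cast
    ring
  rw [h2] at h1
  have h3 : ∑ i, x i ^ 2 ≤ ∑ i, (D.e i * x i) ^ 2 := by
    refine Finset.sum_le_sum fun i _ => ?_
    have : (1 : ℝ) ≤ D.e i := by exact_mod_cast D.e_pos i
    rw [mul_pow]
    nlinarith [sq_nonneg (x i), mul_self_nonneg ((D.e i : ℝ) - 1)]
  rw [div_mul_eq_mul_div, div_le_iff₀ hr, mul_comm _ (D.r : ℝ)]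
  exact (mul_le_mul_of_nonneg_left h3 hε.le).trans h1

theorem coform_corootVec {N : ℤ} {c č : ι → ℤ} (h : D.IsRoot N c č) (y : ι → ℝ) :
    N * (y ⬝ᵥ D.coform *ᵥ D.standard.corootVec č) = D.r * D.standard.rootFun c y := by
  rw [D.coform_isSymm.dotProduct_mulVec_comm, standard_corootVec, Realization.rootFun_apply]
  simp only [dotProduct, Finset.mul_sum]
  refine Finset.sum_congr rfl fun i _ => ?_
  have h1 : (D.coform *ᵥ y) i = D.e i * D.standard.f i y := by
    rw [standard_f]
    simp [coform, gramCoroot, Matrix.mulVec, dotProduct, Finset.mul_sum, mul_assoc]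
  rw [h1]
  have h2 : (N * č i : ℝ) = D.d i * c i := by exact_mod_cast (h.d_mul i).symm
  have h3 : (D.d i * D.e i : ℝ) = D.r := by exact_mod_cast D.d_mul_e i
  linear_combination D.e i * D.standard.f i y * h2 + c i * D.standard.f i y * h3

/-- The distance to a point `p` after an affine reflection. -/
theorem coform_affineReflection (K : ℝ) (a : D.AffineRoot) (p y : ι → ℝ) :
    a.N * ((D.standard.affineReflection K a y - p) ⬝ᵥ D.coform *ᵥ
      (D.standard.affineReflection K a y - p)) =
    a.N * ((y - p) ⬝ᵥ D.coform *ᵥ (y - p)) +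
      2 * D.r * (D.standard.eval K a y * D.standard.eval K a p) := by
  have h1 := D.coform_corootVec a.isRoot (y - p)
  have h2 := D.coform_corootVec a.isRoot (D.standard.corootVec a.coroot)
  rw [D.standard.rootFun_corootVec, a.isRoot.pairing_self] at h2
  rw [Realization.affineReflection_apply, sub_right_comm,
    D.coform_isSymm.dotProduct_mulVec_sub_self, Matrix.mulVec_smul, dotProduct_smul,
    dotProduct_smul, smul_dotProduct]
  simp only [smul_eq_mul]
  have h3 : D.standard.rootFun a.root (y - p) =
      D.standard.eval K a y - D.standard.eval K a p := by
    simp only [Realization.eval, map_sub]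
    ring
  rw [h3] at h1
  push_cast at h2
  linear_combination (-2 * D.standard.eval K a y) * h1 + D.standard.eval K a y ^ 2 * h2

/-- For `K = 0` and `p = 0` the correction term in `coform_affineReflection` vanishes. -/
theorem coform_apply {w : (ι → ℝ) ≃ₗ[ℝ] (ι → ℝ)} (hw : w ∈ D.standard.weylGroup) :
    ∀ y, w y ⬝ᵥ D.coform *ᵥ w y = y ⬝ᵥ D.coform *ᵥ y := by
  have hs : ∀ i y, D.standard.reflection i y ⬝ᵥ D.coform *ᵥ D.standard.reflection i y =
      y ⬝ᵥ D.coform *ᵥ y := by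
    intro i y
    have h1 := D.coform_affineReflection 0 (AffineRoot.simple D (some i)) 0 y
    rw [D.standard.affineReflection_simple] at h1
    have h2 : D.standard.eval 0 (AffineRoot.simple D (some i)) 0 = 0 := by
      simp [Realization.eval]
    rw [h2, mul_zero, mul_zero, add_zero, sub_zero, sub_zero] at h1
    refine mul_left_cancel₀ ?_ h1
    exact_mod_cast (AffineRoot.simple D (some i)).isRoot.N_pos.ne'
  induction hw using Subgroup.closure_induction'' with
  | mem w hw => obtain ⟨i, rfl⟩ := hw; exact hs i
  | inv_mem w hw => obtain ⟨i, rfl⟩ := hw; exact hs i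
  | one => exact fun z => rfl
  | mul w v _ _ hw hv => exact fun y => by rw [LinearEquiv.mul_apply, hw, hv]

theorem finite_coform_le (t : ι → ℝ) {K : ℝ} (hK : 0 < K) (m : ℝ) :
    {z : ι → ℤ | (t + K • fun i => (z i : ℝ)) ⬝ᵥ D.coform *ᵥ
      (t + K • fun i => (z i : ℝ)) ≤ m}.Finite := by
  obtain ⟨ε, hε, h⟩ := D.exists_le_coform
  -- The summand `1` makes `B ≥ 1`, so that `x² ≤ B` implies `|x| ≤ B`.
  set B := |m| / ε + 1 with hB
  have hB1 : 1 ≤ B := by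
    have : 0 ≤ |m| / ε := div_nonneg (abs_nonneg m) hε.le
    linarith
  refine (Set.finite_Icc (fun i => ⌈(-B - t i) / K⌉) (fun i => ⌊(B - t i) / K⌋)).subset ?_
  intro z hz
  have h1 := (h _).trans hz
  have h2 : ∀ i, (t i + K * z i) ^ 2 ≤ B := by
    intro i
    have h3 : (t i + K * z i) ^ 2 ≤ ∑ i, (t + K • fun i => (z i : ℝ)) i ^ 2 :=
      Finset.single_le_sum (f := fun i => (t + K • fun i => (z i : ℝ)) i ^ 2)
        (fun i _ => sq_nonneg _) (Finset.mem_univ i)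
    have h4 : ε * (t i + K * z i) ^ 2 ≤ |m| :=
      (mul_le_mul_of_nonneg_left h3 hε.le).trans (h1.trans (le_abs_self m))
    have h5 : (t i + K * z i) ^ 2 ≤ |m| / ε := by
      rw [le_div_iff₀ hε]
      linarith
    linarith
  have h3 : ∀ i, |t i + K * z i| ≤ B := by
    intro i
    refine abs_le_of_sq_le_sq ?_ (by linarith)
    have := h2 i
    nlinarith
  constructor
  · intro i
    refine Int.ceil_le.2 ?_
    rw [div_le_iff₀ hK]
    have := (abs_le.1 (h3 i)).1
    linarith
  · intro i
    refine Int.le_floor.2 ?_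
    rw [le_div_iff₀ hK]
    have := (abs_le.1 (h3 i)).2
    linarith

/-- An element is determined by the images of the simple coroots, and these are lattice vectors of
fixed norm, of which there are finitely many. -/
instance finite_weylGroup : Finite D.standard.weylGroup := by
  let S : ι → Set (ι → ℤ) := fun i => {z | ((0 : ι → ℝ) + (1 : ℝ) • fun i => (z i : ℝ)) ⬝ᵥ
    D.coform *ᵥ ((0 : ι → ℝ) + (1 : ℝ) • fun i => (z i : ℝ)) ≤
      Pi.single i 1 ⬝ᵥ D.coform *ᵥ Pi.single i 1}
  have h1 : ∀ (w : D.standard.weylGroup) (i : ι), ∃ z : ι → ℤ,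
      (w : (ι → ℝ) ≃ₗ[ℝ] (ι → ℝ)) (Pi.single i 1) = fun i => (z i : ℝ) := by
    intro w i
    obtain ⟨z, hz⟩ := D.standard.exists_apply_corootVec w.2 (Pi.single i 1)
    rw [standard_corootVec, standard_corootVec] at hz
    refine ⟨z, ?_⟩
    rw [← hz]
    congr 1
    ext j
    simp [Pi.single_apply]
  choose F hF using h1
  have h2 : ∀ w i, F w i ∈ S i := by
    intro w i
    rw [Set.mem_ofPred_eq, zero_add, one_smul, ← hF, D.coform_apply w.2]
  have (i : ι) : Finite (S i) := (D.finite_coform_le 0 one_pos _).to_subtype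
  refine Finite.of_injective (fun w i => (⟨F w i, h2 w i⟩ : S i)) fun w v hwv => ?_
  refine Subtype.ext (LinearEquiv.toLinearMap_injective (LinearMap.pi_ext' fun i =>
    LinearMap.ext_ring ?_))
  have h3 : F w i = F v i := congrArg Subtype.val (congrFun hwv i)
  change (w : (ι → ℝ) ≃ₗ[ℝ] (ι → ℝ)) (Pi.single i 1) = (v : (ι → ℝ) ≃ₗ[ℝ] (ι → ℝ)) (Pi.single i 1)
  rw [hF, hF, h3]

/-- All simple roots are positive on `u`, where the highest root has the value `m`; after scaling by
`K / (m + 1)` that value is below `K`. -/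
theorem alcove_nonempty {K : ℝ} (hK : 0 < K) : (D.standard.alcove K).Nonempty := by
  set m : ℝ := ∑ i, D.mark i * (D.C *ᵥ D.u) i with hm
  have hm0 : 0 ≤ m := Finset.sum_nonneg fun i _ =>
    mul_nonneg (by exact_mod_cast (D.mark_pos i).le) (by exact_mod_cast (D.mulVec_u i).le)
  have hf : ∀ i, D.standard.f i ((K / (m + 1)) • fun i => (D.u i : ℝ)) =
      K / (m + 1) * (D.C *ᵥ D.u) i := by
    intro i
    rw [map_smul, standard_f, smul_eq_mul]
    simp [Matrix.mulVec, dotProduct]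
  refine ⟨(K / (m + 1)) • fun i => (D.u i : ℝ), ?_⟩
  rintro (_ | i)
  · simp only [Realization.eval, AffineRoot.simple, Realization.rootFun_neg, LinearMap.neg_apply,
      Realization.rootFun_apply, hf]
    have h1 : ∑ i, (D.mark i : ℝ) * (K / (m + 1) * (D.C *ᵥ D.u) i) = K / (m + 1) * m := by
      rw [hm, Finset.mul_sum]
      exact Finset.sum_congr rfl fun i _ => by ring
    rw [h1]
    have h2 : K / (m + 1) * m < K := by
      rw [div_mul_eq_mul_div, div_lt_iff₀ (by linarith)]
      nlinarith
    push_cast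
    linarith
  · have h1 : D.standard.eval K (AffineRoot.simple D (some i))
        ((K / (m + 1)) • fun i => (D.u i : ℝ)) = K / (m + 1) * (D.C *ᵥ D.u) i := by
      rw [← hf]
      simp [Realization.eval, AffineRoot.simple, Realization.rootFun_apply, Pi.single_apply]
    rw [h1]
    have : (0 : ℝ) < (D.C *ᵥ D.u) i := by exact_mod_cast D.mulVec_u i
    positivity

/-- The affine reflections in the walls of the alcove are compositions of an element of the finite
Weyl group and a translation. -/
theorem exists_affineReflection_simple (K : ℝ) (i : Option ι) :
    ∃ w ∈ D.standard.weylGroup, ∃ z : ι → ℤ, LinearMap.det (w : (ι → ℝ) →ₗ[ℝ] (ι → ℝ)) = -1 ∧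
      ∀ y, D.standard.affineReflection K (AffineRoot.simple D i) y =
        w y + K • D.standard.corootVec z := by
  cases i with
  | some i =>
    refine ⟨_, D.standard.reflection_mem i, 0, D.standard.det_reflection i, fun y => ?_⟩
    rw [D.standard.affineReflection_simple]
    simp [Realization.corootVec]
  | none =>
    -- For the affine vertex the linear part is the reflection of the highest root, odd because
    -- conjugate to a simple one, and the translation is by `K θ̌`.
    obtain ⟨w, hw, i, h⟩ := D.standard.exists_reflection D.isRoot_mark
      (fun i => (D.mark_pos i).le)
    refine ⟨_, mul_mem (mul_mem hw (D.standard.reflection_mem i)) (inv_mem hw), D.comark, ?_,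
      fun y => ?_⟩
    · have h1 : LinearEquiv.det (w * D.standard.reflection i * w⁻¹) =
          LinearEquiv.det (D.standard.reflection i) := by
        rw [map_mul, map_mul, map_inv, mul_comm, inv_mul_cancel_left]
      rw [← LinearEquiv.coe_det, h1, LinearEquiv.coe_det, D.standard.det_reflection]
    · rw [h, Realization.affineReflection_apply]
      simp only [AffineRoot.simple, Realization.eval, Realization.rootFun_neg,
        Realization.corootVec_neg, LinearMap.neg_apply]
      push_cast
      module

/-- Every point can be moved into the closed alcove by the affine Weyl group. -/
theorem exists_mem_closedAlcove {K : ℝ} (hK : 0 < K) (y : ι → ℝ) :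
    ∃ w ∈ D.standard.weylGroup, ∃ z : ι → ℤ,
      ∀ i, 0 ≤ D.standard.eval K (AffineRoot.simple D i) (w y + K • D.standard.corootVec z) := by
  obtain ⟨p, hp⟩ := D.alcove_nonempty hK
  -- `F` is the squared distance from a point of the orbit to the interior point `p`. It attains a
  -- minimum because `W` is finite and the lattice is discrete.
  set F : D.standard.weylGroup × (ι → ℤ) → ℝ := fun g =>
    ((g.1 : (ι → ℝ) ≃ₗ[ℝ] (ι → ℝ)) y + K • D.standard.corootVec g.2 - p) ⬝ᵥ D.coform *ᵥ
      ((g.1 : (ι → ℝ) ≃ₗ[ℝ] (ι → ℝ)) y + K • D.standard.corootVec g.2 - p) with hF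
  have hfin : {g | F g ≤ F (1, 0)}.Finite := by
    refine (Set.finite_iUnion fun w : D.standard.weylGroup =>
      (D.finite_coform_le ((w : (ι → ℝ) ≃ₗ[ℝ] (ι → ℝ)) y - p) hK (F (1, 0))).image
        (Prod.mk w)).subset ?_
    rintro ⟨w, z⟩ hg
    refine Set.mem_iUnion.2 ⟨w, z, ?_, rfl⟩
    rw [Set.mem_ofPred_eq] at hg ⊢
    rwa [← standard_corootVec D z, sub_add_eq_add_sub]
  obtain ⟨⟨w, z⟩, hg, hmin⟩ := Set.exists_min_image _ F hfin ⟨(1, 0), le_refl (F (1, 0))⟩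
  refine ⟨w, w.2, z, fun i => ?_⟩
  by_contra! hneg
  -- If the minimizer and `p` lay on opposite sides of a wall, reflecting in that wall would bring
  -- the point closer to `p`.
  obtain ⟨v, hv, z₁, -, hvz⟩ := D.exists_affineReflection_simple K i
  obtain ⟨z₂, hz₂⟩ := D.standard.exists_apply_corootVec hv z
  have h1 : F (⟨v, hv⟩ * w, z₂ + z₁) < F (w, z) := by
    have h2 : ((⟨v, hv⟩ * w : D.standard.weylGroup) : (ι → ℝ) ≃ₗ[ℝ] (ι → ℝ)) y +
        K • D.standard.corootVec (z₂ + z₁) =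
        D.standard.affineReflection K (AffineRoot.simple D i)
          ((w : (ι → ℝ) ≃ₗ[ℝ] (ι → ℝ)) y + K • D.standard.corootVec z) := by
      rw [hvz, map_add, map_smul, hz₂, Subgroup.coe_mul, LinearEquiv.mul_apply]
      simp only [Realization.corootVec, Pi.add_apply, Int.cast_add, add_smul,
        Finset.sum_add_distrib]
      module
    have h3 := D.coform_affineReflection K (AffineRoot.simple D i) p
      ((w : (ι → ℝ) ≃ₗ[ℝ] (ι → ℝ)) y + K • D.standard.corootVec z)
    have hN : (0 : ℝ) < (AffineRoot.simple D i).N := by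
      exact_mod_cast (AffineRoot.simple D i).isRoot.N_pos
    have hr : (0 : ℝ) < D.r := by exact_mod_cast D.r_pos
    have h4 := mul_neg_of_neg_of_pos hneg (hp i)
    simp only [hF, h2]
    refine lt_of_mul_lt_mul_left ?_ hN.le
    rw [h3]
    nlinarith
  exact h1.not_ge (hmin _ (h1.le.trans hg))

end CartanDatum

namespace CartanDatum

/-! ### The classical and exceptional root systems -/

theorem sum_fin_ite (n m : ℕ) (x : ℤ) :
    ∑ j : Fin n, (if j.val = m then x else 0) = if m < n then x else 0 := by
  rw [Fin.sum_univ_eq_sum_range (fun j => if j = m then x else 0), Finset.sum_ite_eq']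
  simp

theorem sum_fin_ite_succ (n m : ℕ) (hm : m ≤ n) (x : ℕ → ℤ) :
    ∑ j : Fin n, (if j.val + 1 = m then x j.val else 0) = if 0 < m then x (m - 1) else 0 := by
  rcases m with _ | m
  · simp
  · have : ∀ j : Fin n, (if j.val + 1 = m + 1 then x j.val else 0) =
        if j.val = m then x m else 0 := by
      intro j
      by_cases h : j.val = m <;> simp [h]
    rw [Finset.sum_congr rfl fun j _ => this j, sum_fin_ite]
    simp
    omega

/-- In types A, B and C each row has at most three nonzero entries. The vector is a function on `ℕ`
so that its neighbouring values need no bounds; the truncated `i - 1` occurs only for `0 < i`. -/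
theorem sum_tridiagonal {n : ℕ} (i : Fin n) {M : Fin n → ℤ} (y z : ℤ) (v : ℕ → ℤ)
    (hM : ∀ j, M j = if i = j then 2 else if j.val + 1 = i.val then y else
      if i.val + 1 = j.val then z else 0) :
    ∑ j, M j * v j = 2 * v i + (if 0 < i.val then y * v (i - 1) else 0) +
      (if i.val + 1 < n then z * v (i + 1) else 0) := by
  have h : ∀ j, M j * v j = (if j.val = i.val then 2 * v i else 0) +
      (if j.val + 1 = i.val then y * v j else 0) +
      (if j.val = i.val + 1 then z * v (i + 1) else 0) := by
    intro j
    simp only [hM, Fin.ext_iff]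
    split_ifs with h1
    all_goals first
      | omega
      | ring1
      | (rw [h1]; ring1)
      | (have h2 : j.val = i.val + 1 := by omega
         rw [h2]; ring1)
  rw [Finset.sum_congr rfl fun j _ => h j, Finset.sum_add_distrib, Finset.sum_add_distrib,
    sum_fin_ite, sum_fin_ite, sum_fin_ite_succ n i i.2.le fun j => y * v j, if_pos i.2]

theorem A_mulVec {n : ℕ} (v : ℕ → ℤ) (i : Fin n) :
    (CartanMatrix.A n *ᵥ fun j => v j) i = 2 * v i + (if 0 < i.val then -1 * v (i - 1) else 0) +
      (if i.val + 1 < n then -1 * v (i + 1) else 0) := by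
  refine sum_tridiagonal i _ _ v fun j => ?_
  simp only [CartanMatrix.A, Matrix.of_apply]
  grind

theorem B_mulVec {n : ℕ} (v : ℕ → ℤ) (i : Fin n) :
    (CartanMatrix.B n *ᵥ fun j => v j) i = 2 * v i + (if 0 < i.val then -1 * v (i - 1) else 0) +
      (if i.val + 1 < n then (if i.val + 2 = n then -2 else -1) * v (i + 1) else 0) := by
  refine sum_tridiagonal i _ _ v fun j => ?_
  simp only [CartanMatrix.B, Matrix.of_apply]
  grind

theorem C_mulVec {n : ℕ} (v : ℕ → ℤ) (i : Fin n) :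
    (CartanMatrix.C n *ᵥ fun j => v j) i =
      2 * v i + (if 0 < i.val then (if i.val + 1 = n then -2 else -1) * v (i - 1) else 0) +
      (if i.val + 1 < n then -1 * v (i + 1) else 0) := by
  refine sum_tridiagonal i _ _ v fun j => ?_
  simp only [CartanMatrix.C, Matrix.of_apply]
  grind

theorem D_mulVec {n : ℕ} (hn : 3 ≤ n) (v : ℕ → ℤ) (i : Fin n) :
    (CartanMatrix.D n *ᵥ fun j => v j) i = 2 * v i + (if 0 < i.val then -1 * v (i - 1) else 0) +
      (if i.val + 1 < n then -1 * v (i + 1) else 0) +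
      (if i.val + 1 = n then v (n - 2) - v (n - 3) else 0) +
      (if i.val + 2 = n then v (n - 1) else 0) + (if i.val + 3 = n then -v (n - 1) else 0) := by
  -- The diagram `D_n` arises from `A_n` by moving the last vertex from its neighbour `n - 2` to `n
  -- - 3`.
  have h : ∀ j : Fin n, CartanMatrix.D n i j = CartanMatrix.A n i j +
      (if j.val = n - 2 then (if i.val + 1 = n then 1 else 0) else 0) +
      (if j.val = n - 3 then (if i.val + 1 = n then -1 else 0) else 0) +
      (if j.val = n - 1 then (if i.val + 2 = n then 1 else 0) else 0) +
      (if j.val = n - 1 then (if i.val + 3 = n then -1 else 0) else 0) := by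
    intro j
    simp only [CartanMatrix.D, CartanMatrix.A, Matrix.of_apply]
    grind (splits := 20)
  have hm : ∀ (m : ℕ) (x : ℤ) (j : Fin n), (if j.val = m then x else 0) * v j =
      if j.val = m then x * v m else 0 := by
    intro m x j
    by_cases hj : j.val = m <;> simp [hj]
  have hA := A_mulVec v i
  simp only [Matrix.mulVec, dotProduct] at hA ⊢
  simp only [h, add_mul, hm, Finset.sum_add_distrib, hA, sum_fin_ite]
  have hi := i.2
  have h1 : n - 1 < n := by omega
  have h2 : n - 2 < n := by omega
  have h3 : n - 3 < n := by omega
  simp only [h1, h2, h3, if_true, ite_mul, zero_mul, one_mul, neg_mul]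
  split_ifs <;> ring

end CartanDatum

/-! ### Explicit data for each finite type -/

namespace CartanDatum

/-- The root system of type `A_n`. -/
def typeA (n : ℕ) (hn : 1 ≤ n) : CartanDatum (Fin n) where
  C := CartanMatrix.A n
  r := 1
  d _ := 1
  e _ := 1
  mark _ := 1
  comark _ := 1
  -- In every type `u` gives the coroot coordinates of a multiple of `ρ̌`: all entries of `C u` are
  -- 2 in types A, C, E, they are 4 in types B, D, and 1 for `F_4` and `G_2`.
  u := fun i => (i + 1 : ℤ) * (n - i)
  diag i := congrFun (CartanMatrix.A_diag n) i
  nonpos := CartanMatrix.A_apply_le_zero_of_ne n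
  r_le := by norm_num
  d_pos _ := one_pos
  e_pos _ := one_pos
  d_mul_e _ := rfl
  length_mem _ := Or.inl rfl
  symm i j := by
    rw [← congrFun (congrFun (CartanMatrix.A_transpose n) i) j, Matrix.transpose_apply]
  u_pos i := by
    have := i.2
    exact mul_pos (by positivity) (by omega)
  mulVec_u i := by
    rw [A_mulVec (fun i => (i + 1 : ℤ) * (n - i))]
    obtain ⟨i, hi⟩ := i
    rcases i with _ | i
    · simp only
      split_ifs <;> push_cast <;> omega
    · simp only [Nat.add_sub_cancel]
      split_ifs <;> first
        | omega
        | (push_cast; linarith)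
        | (obtain rfl : n = i + 2 := by omega
           push_cast; linarith)
  mark_pos _ := one_pos
  comark_pos _ := one_pos
  d_mul_mark _ := rfl
  dominant i := by
    rw [A_mulVec fun _ => 1]
    split_ifs <;> norm_num
  mark_comark := by
    -- The two end vertices contribute `1` each; for `n = 1` they coincide.
    have h : ∀ i : Fin n, (CartanMatrix.A n *ᵥ fun _ => 1) i =
        (if i.val = 0 then 1 else 0) + (if i.val = n - 1 then 1 else 0) := by
      intro i
      rw [A_mulVec fun _ => 1]
      have := i.2
      split_ifs <;> omega
    simp only [dotProduct, h, one_mul, Finset.sum_add_distrib, sum_fin_ite]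
    rw [if_pos (by omega), if_pos (by omega)]
    norm_num

/-- The root system of type `B_n`. -/
def typeB (n : ℕ) (hn : 2 ≤ n) : CartanDatum (Fin n) where
  C := CartanMatrix.B n
  r := 2
  d i := if i.val + 1 = n then 1 else 2
  e i := if i.val + 1 = n then 2 else 1
  mark i := if i.val = 0 then 1 else 2
  comark i := if i.val = 0 ∨ i.val + 1 = n then 1 else 2
  u := fun i => if i.val + 1 = n then (n : ℤ) * (n + 1) else 2 * (i + 1 : ℤ) * (2 * n - i)
  diag := CartanMatrix.B_diag n
  nonpos := CartanMatrix.B_off_diag_nonpos n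
  r_le := by norm_num
  d_pos i := by split_ifs <;> norm_num
  e_pos i := by split_ifs <;> norm_num
  d_mul_e i := by split_ifs <;> norm_num
  length_mem i := by split_ifs <;> simp
  symm i j := by
    simp only [CartanMatrix.B, Matrix.of_apply]
    grind (splits := 20)
  u_pos i := by
    have := i.2
    split_ifs
    · positivity
    · exact mul_pos (by positivity) (by omega)
  mulVec_u i := by
    rw [B_mulVec (fun i => if i + 1 = n then (n : ℤ) * (n + 1)
      else 2 * (i + 1 : ℤ) * (2 * n - i))]
    obtain ⟨i, hi⟩ := i
    rcases i with _ | i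
    · simp only
      split_ifs <;> first | omega | (subst_vars; norm_num)
    · simp only [Nat.add_sub_cancel]
      split_ifs <;> push_cast <;> first | omega | (subst_vars; push_cast; linarith)
  mark_pos i := by split_ifs <;> norm_num
  comark_pos i := by split_ifs <;> norm_num
  d_mul_mark i := by
    split_ifs <;> omega
  dominant i := by
    rw [B_mulVec fun i => if i = 0 ∨ i + 1 = n then 1 else 2]
    have := i.2
    split_ifs <;> omega
  mark_comark := by
    have h : ∀ i : Fin n, (CartanMatrix.B n *ᵥ fun i =>
        if i.val = 0 ∨ i.val + 1 = n then 1 else 2) i = if i.val = 1 then 1 else 0 := by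
      intro i
      rw [B_mulVec fun i => if i = 0 ∨ i + 1 = n then 1 else 2]
      have := i.2
      split_ifs <;> first | omega | (simp only [false_or] at *; omega)
    have h' : ∀ i : Fin n, (if i.val = 0 then (1 : ℤ) else 2) * (if i.val = 1 then 1 else 0) =
        if i.val = 1 then 2 else 0 := by
      intro i
      split_ifs <;> omega
    simp only [dotProduct, h, h', sum_fin_ite]
    rw [if_pos (by omega)]

/-- The root system of type `C_n`. -/
def typeC (n : ℕ) (hn : 1 ≤ n) : CartanDatum (Fin n) where
  C := CartanMatrix.C n
  r := 2
  -- For `n = 1` the only simple root counts as long, with `e = 1`; this normalization is used for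
  -- `A_2^{(2)}`.
  d i := if i.val + 1 = n then 2 else 1
  e i := if i.val + 1 = n then 1 else 2
  mark i := if i.val + 1 = n then 1 else 2
  comark _ := 1
  u := fun i => (i + 1 : ℤ) * (2 * n - 1 - i)
  diag := CartanMatrix.C_diag n
  nonpos := CartanMatrix.C_off_diag_nonpos n
  r_le := by norm_num
  d_pos i := by split_ifs <;> norm_num
  e_pos i := by split_ifs <;> norm_num
  d_mul_e i := by split_ifs <;> norm_num
  length_mem i := by split_ifs <;> simp
  symm i j := by
    simp only [CartanMatrix.C, Matrix.of_apply]
    grind (splits := 20)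
  u_pos i := by
    have := i.2
    exact mul_pos (by positivity) (by omega)
  mulVec_u i := by
    rw [C_mulVec (fun i => (i + 1 : ℤ) * (2 * n - 1 - i))]
    obtain ⟨i, hi⟩ := i
    rcases i with _ | i
    · simp only
      split_ifs <;> push_cast <;> omega
    · simp only [Nat.add_sub_cancel]
      split_ifs <;> push_cast <;> first | omega | (subst_vars; push_cast; linarith)
  mark_pos i := by split_ifs <;> norm_num
  comark_pos _ := one_pos
  d_mul_mark i := by
    split_ifs <;> omega
  dominant i := by
    rw [C_mulVec fun _ => 1]
    split_ifs <;> omega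
  mark_comark := by
    have h : ∀ i : Fin n, (if i.val + 1 = n then (1 : ℤ) else 2) *
        (CartanMatrix.C n *ᵥ fun _ => 1) i = if i.val = 0 then 2 else 0 := by
      intro i
      rw [C_mulVec fun _ => 1]
      have := i.2
      split_ifs <;> omega
    simp only [dotProduct, h, sum_fin_ite]
    rw [if_pos (by omega)]

/-- The root system of type `D_n`. -/
def typeD (n : ℕ) (hn : 4 ≤ n) : CartanDatum (Fin n) where
  C := CartanMatrix.D n
  r := 1
  d _ := 1
  e _ := 1
  mark i := if i.val = 0 ∨ n ≤ i.val + 2 then 1 else 2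
  comark i := if i.val = 0 ∨ n ≤ i.val + 2 then 1 else 2
  u := fun i => if n ≤ i.val + 2 then (n : ℤ) * (n - 1) else 2 * (i + 1 : ℤ) * (2 * n - 2 - i)
  diag := CartanMatrix.D_diag n
  nonpos := CartanMatrix.D_off_diag_nonpos n
  r_le := by norm_num
  d_pos _ := one_pos
  e_pos _ := one_pos
  d_mul_e _ := rfl
  length_mem _ := Or.inl rfl
  symm i j := by
    rw [← congrFun (congrFun (CartanMatrix.D_transpose n) i) j, Matrix.transpose_apply]
  u_pos i := by
    have := i.2
    split_ifs
    · exact mul_pos (by omega) (by omega)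
    · exact mul_pos (by positivity) (by omega)
  mulVec_u i := by
    rw [D_mulVec (by omega) (fun i => if n ≤ i + 2 then (n : ℤ) * (n - 1)
      else 2 * (i + 1 : ℤ) * (2 * n - 2 - i))]
    obtain ⟨m, rfl⟩ := Nat.exists_eq_add_of_le hn
    obtain ⟨i, hi⟩ := i
    rcases i with _ | i
    · simp (disch := omega) only [if_pos, if_neg]
      push_cast
      linarith
    · simp only [Nat.add_sub_cancel, show 4 + m - 1 = m + 3 by omega,
        show 4 + m - 2 = m + 2 by omega, show 4 + m - 3 = m + 1 by omega]
      rcases (by omega : i < m ∨ i = m ∨ i = m + 1 ∨ i = m + 2) with h | rfl | rfl | rfl <;>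
        simp (disch := omega) only [if_pos, if_neg] <;> push_cast <;> linarith
  mark_pos i := by split_ifs <;> norm_num
  comark_pos i := by split_ifs <;> norm_num
  d_mul_mark _ := rfl
  dominant i := by
    rw [D_mulVec (by omega) fun i => if i = 0 ∨ n ≤ i + 2 then 1 else 2]
    obtain ⟨m, rfl⟩ := Nat.exists_eq_add_of_le hn
    obtain ⟨i, hi⟩ := i
    rcases (by omega : i = 0 ∨ i = 1 ∨ i = m + 1 ∨ i = m + 2 ∨ i = m + 3 ∨ 1 < i ∧ i < m + 1)
      with rfl | rfl | rfl | rfl | rfl | h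
    all_goals
      rcases Nat.eq_zero_or_pos m with hm | hm <;>
      simp (disch := omega) only [if_pos, if_neg, true_or, if_true] <;>
      norm_num
  mark_comark := by
    obtain ⟨m, rfl⟩ := Nat.exists_eq_add_of_le hn
    have h : ∀ i : Fin (4 + m), (if i.val = 0 ∨ 4 + m ≤ i.val + 2 then (1 : ℤ) else 2) *
        (CartanMatrix.D (4 + m) *ᵥ fun i => if i.val = 0 ∨ 4 + m ≤ i.val + 2 then 1 else 2) i =
          if i.val = 1 then 2 else 0 := by
      intro i
      rw [D_mulVec (by omega) fun i => if i = 0 ∨ 4 + m ≤ i + 2 then 1 else 2]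
      obtain ⟨i, hi⟩ := i
      rcases (by omega : i = 0 ∨ i = 1 ∨ i = m + 1 ∨ i = m + 2 ∨ i = m + 3 ∨ 1 < i ∧ i < m + 1)
        with rfl | rfl | rfl | rfl | rfl | h
      all_goals
        rcases Nat.eq_zero_or_pos m with hm | hm <;>
        simp (disch := omega) only [if_pos, if_neg, true_or, if_true] <;>
        norm_num <;> omega
    simp only [dotProduct, h, sum_fin_ite]
    rw [if_pos (by omega)]

/-- The root system of type `E_6`. -/
def typeE₆ : CartanDatum (Fin 6) where
  C := CartanMatrix.E₆
  r := 1
  d _ := 1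
  e _ := 1
  mark := ![1, 2, 2, 3, 2, 1]
  comark := ![1, 2, 2, 3, 2, 1]
  u := ![16, 22, 30, 42, 30, 16]
  diag := by decide
  nonpos := CartanMatrix.E₆_off_diag_nonpos
  r_le := by decide
  d_pos := by decide
  e_pos := by decide
  d_mul_e := by decide
  length_mem := by decide
  symm := by decide
  u_pos := by decide
  mulVec_u := by decide
  mark_pos := by decide
  comark_pos := by decide
  d_mul_mark := by decide
  dominant := by decide
  mark_comark := by decide

/-- The root system of type `E_7`. -/
def typeE₇ : CartanDatum (Fin 7) where
  C := CartanMatrix.E₇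
  r := 1
  d _ := 1
  e _ := 1
  mark := ![2, 2, 3, 4, 3, 2, 1]
  comark := ![2, 2, 3, 4, 3, 2, 1]
  u := ![34, 49, 66, 96, 75, 52, 27]
  diag := by decide
  nonpos := CartanMatrix.E₇_off_diag_nonpos
  r_le := by decide
  d_pos := by decide
  e_pos := by decide
  d_mul_e := by decide
  length_mem := by decide
  symm := by decide
  u_pos := by decide
  mulVec_u := by decide
  mark_pos := by decide
  comark_pos := by decide
  d_mul_mark := by decide
  dominant := by decide
  mark_comark := by decide

/-- The root system of type `E_8`. -/
def typeE₈ : CartanDatum (Fin 8) where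
  C := CartanMatrix.E₈
  r := 1
  d _ := 1
  e _ := 1
  mark := ![2, 3, 4, 6, 5, 4, 3, 2]
  comark := ![2, 3, 4, 6, 5, 4, 3, 2]
  u := ![92, 136, 182, 270, 220, 168, 114, 58]
  diag := by decide
  nonpos := CartanMatrix.E₈_off_diag_nonpos
  r_le := by decide
  d_pos := by decide
  e_pos := by decide
  d_mul_e := by decide
  length_mem := by decide
  symm := by decide
  u_pos := by decide
  mulVec_u := by decide
  mark_pos := by decide
  comark_pos := by decide
  d_mul_mark := by decide
  dominant := by decide
  mark_comark := by decide

/-- The root system of type `F_4`. -/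
def typeF₄ : CartanDatum (Fin 4) where
  C := CartanMatrix.F₄
  r := 2
  d := ![2, 2, 1, 1]
  e := ![1, 1, 2, 2]
  mark := ![2, 3, 4, 2]
  comark := ![2, 3, 2, 1]
  u := ![11, 21, 15, 8]
  diag := by decide
  nonpos := CartanMatrix.F₄_off_diag_nonpos
  r_le := by decide
  d_pos := by decide
  e_pos := by decide
  d_mul_e := by decide
  length_mem := by decide
  symm := by decide
  u_pos := by decide
  mulVec_u := by decide
  mark_pos := by decide
  comark_pos := by decide
  d_mul_mark := by decide
  dominant := by decide
  mark_comark := by decide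

/-- The root system of type `F_4` with the vertices in reverse order. -/
def typeF₄Dual : CartanDatum (Fin 4) where
  C := CartanMatrix.F₄ᵀ
  r := 2
  d := ![1, 1, 2, 2]
  e := ![2, 2, 1, 1]
  mark := ![2, 4, 3, 2]
  comark := ![1, 2, 3, 2]
  u := ![8, 15, 21, 11]
  diag := by decide
  nonpos i j h := CartanMatrix.F₄_off_diag_nonpos j i h.symm
  r_le := by decide
  d_pos := by decide
  e_pos := by decide
  d_mul_e := by decide
  length_mem := by decide
  symm := by decide
  u_pos := by decide
  mulVec_u := by decide
  mark_pos := by decide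
  comark_pos := by decide
  d_mul_mark := by decide
  dominant := by decide
  mark_comark := by decide

/-- The root system of type `G_2`. -/
def typeG₂ : CartanDatum (Fin 2) where
  C := CartanMatrix.G₂
  r := 3
  d := ![3, 1]
  e := ![1, 3]
  mark := ![2, 3]
  comark := ![2, 1]
  u := ![5, 3]
  diag := by decide
  nonpos := CartanMatrix.G₂_off_diag_nonpos
  r_le := by decide
  d_pos := by decide
  e_pos := by decide
  d_mul_e := by decide
  length_mem := by decide
  symm := by decide
  u_pos := by decide
  mulVec_u := by decide
  mark_pos := by decide
  comark_pos := by decide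
  d_mul_mark := by decide
  dominant := by decide
  mark_comark := by decide

/-- The root system of type `G_2` with the vertices in reverse order. -/
def typeG₂Dual : CartanDatum (Fin 2) where
  C := CartanMatrix.G₂ᵀ
  r := 3
  d := ![1, 3]
  e := ![3, 1]
  mark := ![3, 2]
  comark := ![1, 2]
  u := ![3, 5]
  diag := by decide
  nonpos i j h := CartanMatrix.G₂_off_diag_nonpos j i h.symm
  r_le := by decide
  d_pos := by decide
  e_pos := by decide
  d_mul_e := by decide
  length_mem := by decide
  symm := by decide
  u_pos := by decide
  mulVec_u := by decide
  mark_pos := by decide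
  comark_pos := by decide
  d_mul_mark := by decide
  dominant := by decide
  mark_comark := by decide

end CartanDatum

noncomputable section

namespace AffineType

/-! ### The root systems of an affine type -/

/-- The numbers `κ(α̌_i) = mult i • α_i` if `A` is of the first kind, and `1` otherwise. -/
def mult {n : ℕ} (T : AffineType n) (i : Fin n) : ℝ :=
  if T.isUntwistedOrAEven then (T.label i.succ : ℝ) / T.colabel i.succ else 1

/-- The root system `D` of the finite part of `A` and the root system `D'` with the simple coroots
`mult i • α_i`, whose affine Weyl groups act on the Cartan subalgebra and on the weights. -/
structure HasData {n : ℕ} (T : AffineType n) (D D' : CartanDatum (Fin n)) : Prop where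
  mult_pos : ∀ i, 0 < T.mult i
  C_eq : D.C = T.finitePart
  -- This turns the alcove inequality in the Cartan subalgebra into the level condition for `A'`;
  -- `mark_eq'` does the same for weights and `A`.
  mark_eq : ∀ i, (D.mark i : ℝ) =
    T.mult i * T.adjacent.colabel (T.dualVertex.symm i).succ
  mult_mul : ∀ i j, T.mult i * D'.C i j = T.mult j * T.finitePart j i
  mult_symm : T.isUntwistedOrAEven = true → ∀ i j,
    T.mult i * T.finitePart i j = T.mult j * T.finitePart j i
  mark_eq' : ∀ i, (D'.mark i : ℝ) = T.mult i * T.colabel i.succ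
  -- That is, `M` is contained in the weight lattice.
  integral : ∀ i j, ∃ m : ℤ, T.mult i * T.finitePart i j = m

theorem hasData_of_first {n : ℕ} {T : AffineType n} (hT : T.isUntwistedOrAEven = true)
    (hadj : T.adjacent = T) (hdual : T.dualVertex = Equiv.refl _) (D : CartanDatum (Fin n))
    (hC : D.C = T.finitePart) (s : ℤ) (hs : 0 < s) (hmark : ∀ i, D.mark i = T.label i.succ)
    (hcomark : ∀ i : Fin n, (T.colabel i.succ : ℤ) = s * D.comark i)
    (hdvd : ∀ i j, s ∣ D.e i * D.C i j) : T.HasData D D := by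
  have hs' : (s : ℝ) ≠ 0 := by exact_mod_cast hs.ne'
  -- Both `a_i / ǎ_i` and `e_i / s` equal `mark_i / (s comark_i)`. The scale `s` is the ratio of the
  -- colabels to the coordinates of the coroot of the highest root.
  have h1 : ∀ i, T.mult i = D.e i / s := by
    intro i
    rw [mult, if_pos hT]
    have h2 : (T.label i.succ : ℝ) = D.mark i := by exact_mod_cast (hmark i).symm
    have h3 : (T.colabel i.succ : ℝ) = s * D.comark i := by exact_mod_cast hcomark i
    have h4 : (D.comark i : ℝ) ≠ 0 := by exact_mod_cast (D.comark_pos i).ne'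
    have h5 : (D.d i : ℝ) ≠ 0 := by exact_mod_cast (D.d_pos i).ne'
    have h6 : (D.d i * D.mark i : ℝ) = D.r * D.comark i := by exact_mod_cast D.d_mul_mark i
    have h7 : (D.d i * D.e i : ℝ) = D.r := by exact_mod_cast D.d_mul_e i
    rw [h2, h3, div_eq_div_iff (mul_ne_zero hs' h4) hs']
    refine mul_left_cancel₀ h5 ?_
    linear_combination s * h6 - s * D.comark i * h7
  have h8 : ∀ i : Fin n, (T.colabel i.succ : ℝ) ≠ 0 := by
    intro i
    have h3 : (T.colabel i.succ : ℝ) = s * D.comark i := by exact_mod_cast hcomark i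
    rw [h3]
    exact mul_ne_zero hs' (by exact_mod_cast (D.comark_pos i).ne')
  have h9 : ∀ i : Fin n, (D.mark i : ℝ) = T.mult i * T.colabel i.succ := by
    intro i
    rw [mult, if_pos hT, div_mul_cancel₀ _ (h8 i)]
    exact_mod_cast hmark i
  have h10 : ∀ i j, T.mult i * T.finitePart i j = T.mult j * T.finitePart j i := by
    intro i j
    rw [h1, h1, ← hC]
    have : (D.e i * D.C i j : ℝ) = D.e j * D.C j i := by exact_mod_cast D.e_symm i j
    rw [div_mul_eq_mul_div, div_mul_eq_mul_div, this]
  refine ⟨fun i => ?_, hC, ?_, fun i j => ?_, fun _ => h10, h9, fun i j => ?_⟩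
  · rw [h1]
    exact div_pos (by exact_mod_cast D.e_pos i) (by exact_mod_cast hs)
  · rw [hadj, hdual]
    exact h9
  · rw [hC, h10]
  · obtain ⟨m, hm⟩ := hdvd i j
    refine ⟨m, ?_⟩
    have : (D.e i * D.C i j : ℝ) = s * m := by exact_mod_cast hm
    rw [h1, ← hC, div_mul_eq_mul_div, this, mul_div_cancel_left₀ _ hs']

theorem hasData_of_second {n : ℕ} {T : AffineType n} (hT : T.isUntwistedOrAEven = false)
    (D D' : CartanDatum (Fin n)) (hC : D.C = T.finitePart) (hC' : D'.C = T.finitePartᵀ)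
    (hmark : ∀ i, D.mark i = T.adjacent.colabel (T.dualVertex.symm i).succ)
    (hmark' : ∀ i, D'.mark i = T.colabel i.succ) : T.HasData D D' := by
  have h1 : ∀ i, T.mult i = 1 := fun i => by simp [mult, hT]
  refine ⟨fun i => ?_, hC, fun i => ?_, fun i j => ?_, fun h => ?_, fun i => ?_, fun i j => ?_⟩
  · rw [h1]
    exact one_pos
  · rw [h1, one_mul]
    exact_mod_cast hmark i
  · rw [h1, h1, hC', Matrix.transpose_apply]
  · rw [hT] at h
    contradiction
  · rw [h1, one_mul]
    exact_mod_cast hmark' i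
  · exact ⟨T.finitePart i j, by rw [h1, one_mul]⟩

-- In the first kind both data coincide, with `s = 1` except for `A_{2n}^{(2)}`, where `s = 2`. In
-- the second kind the second datum is the dual one, which exchanges `B_n` and `C_n` and the two
-- orderings of `F_4` and of `G_2`.
open CartanDatum in
theorem exists_hasData : ∀ {n : ℕ} (T : AffineType n), ∃ D D', T.HasData D D'
  | _, untwistedA n hn => ⟨_, _, hasData_of_first rfl rfl rfl (typeA n hn) rfl 1 one_pos
      (fun _ => rfl) (fun _ => rfl) fun _ _ => one_dvd _⟩
  | _, untwistedB n hn => ⟨_, _, hasData_of_first rfl rfl rfl (typeB n (by omega)) rfl 1 one_pos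
      (fun i => by simp only [typeB, label, Fin.val_succ]; grind)
      (fun i => by simp only [typeB, colabel, Fin.val_succ]; grind)
      fun _ _ => one_dvd _⟩
  | _, untwistedC n hn => ⟨_, _, hasData_of_first rfl rfl rfl (typeC n (by omega)) rfl 1 one_pos
      (fun i => by simp only [typeC, label, Fin.val_succ]; grind)
      (fun i => rfl)
      fun _ _ => one_dvd _⟩
  | _, untwistedD n hn => ⟨_, _, hasData_of_first rfl rfl rfl (typeD n hn) rfl 1 one_pos
      (fun i => by simp only [typeD, label, Fin.val_succ]; grind)
      (fun i => by simp only [typeD, colabel, Fin.val_succ]; grind)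
      fun _ _ => one_dvd _⟩
  | _, untwistedE₆ => ⟨_, _, hasData_of_first rfl rfl rfl typeE₆ rfl 1 one_pos
      (by decide) (by decide) fun _ _ => one_dvd _⟩
  | _, untwistedE₇ => ⟨_, _, hasData_of_first rfl rfl rfl typeE₇ rfl 1 one_pos
      (by decide) (by decide) fun _ _ => one_dvd _⟩
  | _, untwistedE₈ => ⟨_, _, hasData_of_first rfl rfl rfl typeE₈ rfl 1 one_pos
      (by decide) (by decide) fun _ _ => one_dvd _⟩
  | _, untwistedF₄ => ⟨_, _, hasData_of_first rfl rfl rfl typeF₄ rfl 1 one_pos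
      (by decide) (by decide) fun _ _ => one_dvd _⟩
  | _, untwistedG₂ => ⟨_, _, hasData_of_first rfl rfl rfl typeG₂ rfl 1 one_pos
      (by decide) (by decide) fun _ _ => one_dvd _⟩
  | _, twistedAEven n hn => ⟨_, _, hasData_of_first rfl rfl rfl (typeC n hn) rfl 2 two_pos
      (fun i => by simp only [typeC, label, Fin.val_succ]; grind)
      (fun i => by simp [typeC, colabel])
      fun i j => by
        have := i.2
        simp only [typeC, CartanMatrix.C, Matrix.of_apply]
        split_ifs <;> omega⟩
  | _, twistedAOdd n hn => ⟨_, _, hasData_of_second rfl (typeC n (by omega)) (typeB n hn) rfl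
      (CartanMatrix.C_transpose n).symm
      (fun i => by
        simp only [typeC, colabel, adjacent, dualVertex, Equiv.refl_symm, Equiv.refl_apply,
          Fin.val_succ]
        grind)
      (fun i => by simp only [typeB, colabel, Fin.val_succ]; grind)⟩
  | _, twistedD n hn => ⟨_, _, hasData_of_second rfl (typeB n hn) (typeC n (by omega)) rfl
      (CartanMatrix.B_transpose n).symm
      (fun i => by
        simp only [typeB, colabel, adjacent, dualVertex, Equiv.refl_symm, Equiv.refl_apply,
          Fin.val_succ]
        grind)
      (fun i => by simp only [typeC, colabel, Fin.val_succ]; grind)⟩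
  | _, twistedE₆ => ⟨_, _, hasData_of_second rfl typeF₄Dual typeF₄ rfl rfl
      (by decide) (by decide)⟩
  | _, twistedD₄ => ⟨_, _, hasData_of_second rfl typeG₂Dual typeG₂ rfl rfl
      (by decide) (by decide)⟩

/-- The colabel of the vertex `0` is `1` in every type, even for `A_{2n}^{(2)}`, whose label `a_0`
is `2`. -/
theorem sum_colabel : ∀ {n : ℕ} (T : AffineType n),
    ∑ i : Fin n, T.colabel i.succ + 1 = T.dualCoxeter := by
  intro n T
  rw [dualCoxeter, Fin.sum_univ_succ, add_comm]
  congr 1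
  cases T <;> rfl

theorem dualCoxeter_twistedAOdd (n : ℕ) (hn : 2 ≤ n) :
    (twistedAOdd n hn).dualCoxeter = 2 * n := by
  have h : ∀ i : Fin (n + 1), (((twistedAOdd n hn).colabel i : ℕ) : ℤ) =
      2 - (if i.val = 0 then 1 else 0) - (if i.val = 1 then 1 else 0) := by
    intro i
    simp only [colabel]
    split_ifs <;> omega
  have h1 : (((twistedAOdd n hn).dualCoxeter : ℕ) : ℤ) = 2 * n := by
    rw [dualCoxeter, Nat.cast_sum]
    simp only [h, Finset.sum_sub_distrib, CartanDatum.sum_fin_ite]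
    rw [if_pos (by omega), if_pos (by omega), Fin.sum_const]
    simp
    ring
  exact_mod_cast h1

theorem dualCoxeter_twistedD (n : ℕ) (hn : 2 ≤ n) :
    (twistedD n hn).dualCoxeter = 2 * n := by
  have h : ∀ i : Fin (n + 1), (((twistedD n hn).colabel i : ℕ) : ℤ) =
      2 - (if i.val = 0 then 1 else 0) - (if i.val = n then 1 else 0) := by
    intro i
    simp only [colabel]
    split_ifs <;> omega
  have h1 : (((twistedD n hn).dualCoxeter : ℕ) : ℤ) = 2 * n := by
    rw [dualCoxeter, Nat.cast_sum]
    simp only [h, Finset.sum_sub_distrib, CartanDatum.sum_fin_ite]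
    rw [if_pos (by omega), if_pos (by omega), Fin.sum_const]
    simp
    ring
  exact_mod_cast h1

/-- Only the pair `A_{2n-1}^{(2)}`, `D_{n+1}^{(2)}` needs a computation: both numbers are `2n`. So
the alcoves for `A` and for `A'` are scaled by the same `K`. -/
theorem dualCoxeter_adjacent {n : ℕ} (T : AffineType n) :
    T.adjacent.dualCoxeter = T.dualCoxeter := by
  cases T
  case twistedAOdd hn =>
    exact (dualCoxeter_twistedD _ hn).trans (dualCoxeter_twistedAOdd _ hn).symm
  case twistedD hn =>
    exact (dualCoxeter_twistedAOdd _ hn).trans (dualCoxeter_twistedD _ hn).symm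
  all_goals rfl

end AffineType
end

noncomputable section

/-! ### Orthogonality of alternating sums of characters -/

namespace AddChar

variable {P : Type*} [AddCommGroup P] (N : AddSubgroup P)

/-- The characters that are trivial on a subgroup. -/
abbrev Annihilator : Type _ := {ψ : AddChar P ℂ // ∀ p ∈ N, ψ p = 1}

/-- A character that is trivial on a subgroup is a character of the quotient. -/
def annihilatorEquiv : AddChar (P ⧸ N) ℂ ≃ Annihilator N :=
  Equiv.ofBijective
    (fun ψ => ⟨ψ.compAddMonoidHom (QuotientAddGroup.mk' N), fun p hp => by
      rw [compAddMonoidHom_apply, QuotientAddGroup.mk'_apply,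
        (QuotientAddGroup.eq_zero_iff p).2 hp, map_zero_eq_one]⟩)
    ⟨fun ψ φ h => compAddMonoidHom_injective_left _ (QuotientAddGroup.mk'_surjective N)
      (congrArg Subtype.val h), fun ψ => ⟨toAddMonoidHomEquiv.symm
        (QuotientAddGroup.lift N (toAddMonoidHomEquiv ψ.1) fun p hp => ψ.2 p hp),
        Subtype.ext (AddChar.ext _ _ fun _ => rfl)⟩⟩

theorem annihilatorEquiv_apply (ψ : AddChar (P ⧸ N) ℂ) (p : P) :
    (annihilatorEquiv N ψ).1 p = ψ (p : P ⧸ N) := rfl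

variable [Finite (P ⧸ N)]

instance : Finite (Annihilator N) :=
  have := Fintype.ofFinite (P ⧸ N)
  Finite.of_equiv _ (annihilatorEquiv N)

open Classical in
theorem sum_annihilator [Fintype (Annihilator N)] (p : P) :
    ∑ ψ : Annihilator N, ψ.1 p = if p ∈ N then (Nat.card (P ⧸ N) : ℂ) else 0 := by
  have := Fintype.ofFinite (P ⧸ N)
  rw [← (annihilatorEquiv N).sum_comp]
  simp only [annihilatorEquiv_apply, sum_apply_eq_ite, QuotientAddGroup.eq_zero_iff,
    Nat.card_eq_fintype_card]

theorem conj_annihilator (ψ : Annihilator N) (p : P) :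
    (starRingEnd ℂ) (ψ.1 p) = ψ.1 (-p) := by
  obtain ⟨φ, rfl⟩ := (annihilatorEquiv N).surjective ψ
  rw [annihilatorEquiv_apply, annihilatorEquiv_apply, QuotientAddGroup.mk_neg, map_neg_eq_conj]

variable {W : Type*} [Group W] [DistribMulAction W P]

/-- The character `p ↦ ψ (w • p)`. -/
def twist (ψ : AddChar P ℂ) (w : W) : AddChar P ℂ :=
  ψ.compAddMonoidHom (DistribSMul.toAddMonoidHom P w)

omit [Finite (P ⧸ N)] in
theorem twist_apply (ψ : AddChar P ℂ) (w : W) (p : P) : ψ.twist w p = ψ (w • p) := rfl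

omit [Finite (P ⧸ N)] in
theorem twist_twist (ψ : AddChar P ℂ) (w v : W) : (ψ.twist w).twist v = ψ.twist (w * v) :=
  AddChar.ext _ _ fun p => by simp only [twist_apply, mul_smul]

omit [Finite (P ⧸ N)] in
theorem twist_one (ψ : AddChar P ℂ) : ψ.twist (1 : W) = ψ :=
  AddChar.ext _ _ fun p => by simp only [twist_apply, one_smul]

variable [Fintype W] (sgn : W →* ℤˣ)

/-- The alternating sum of a character over an orbit. -/
def alternating (x : P) (ψ : AddChar P ℂ) : ℂ := ∑ w : W, ((sgn w : ℤ) : ℂ) * ψ (w • x)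

-- Antisymmetry under `W` has two uses: the products of two alternating sums are constant on orbits,
-- and an alternating sum vanishes at a character fixed by an odd element.
omit [Finite (P ⧸ N)] in
theorem alternating_twist (x : P) (ψ : AddChar P ℂ) (v : W) :
    alternating sgn x (ψ.twist v) = ((sgn v : ℤ) : ℂ) * alternating sgn x ψ := by
  rw [alternating, alternating, ← Equiv.sum_comp (Equiv.mulLeft v⁻¹), Finset.mul_sum]
  refine Finset.sum_congr rfl fun w _ => ?_
  rw [twist_apply, Equiv.coe_mulLeft, smul_smul, mul_inv_cancel_left, map_mul, map_inv,
    Int.units_inv_eq_self]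
  push_cast
  ring

omit [Fintype W] in
omit [Finite (P ⧸ N)] in
theorem sgn_mul_sgn (v : W) : ((sgn v : ℤ) : ℂ) * ((sgn v : ℤ) : ℂ) = 1 := by
  rw [← Int.cast_mul, ← Units.val_mul, Int.units_mul_self]
  simp

variable {sgn} {N}

/-- After expansion, orthogonality of characters keeps the pairs `(w, v)` with `w x - v x' ∈ N`.
Applying `v⁻¹` and the hypothesis on `x`, `x'` leaves the diagonal `w = v`, which has `|W|` terms.
-/
theorem sum_alternating_annihilator [Fintype (Annihilator N)]
    (hN : ∀ (w : W), ∀ p ∈ N, w • p ∈ N) {x x' : P}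
    (hx : ∀ w : W, w • x - x' ∈ N → w = 1 ∧ x = x') [Decidable (x = x')] :
    ∑ ψ : Annihilator N, alternating sgn x ψ.1 * (starRingEnd ℂ) (alternating sgn x' ψ.1) =
      if x = x' then (Nat.card (P ⧸ N) : ℂ) * Fintype.card W else 0 := by
  classical
  have h1 : ∀ ψ : Annihilator N, alternating sgn x ψ.1 *
      (starRingEnd ℂ) (alternating sgn x' ψ.1) = ∑ w : W, ∑ v : W,
        ((sgn w : ℤ) : ℂ) * ((sgn v : ℤ) : ℂ) * ψ.1 (w • x - v • x') := by
    intro ψ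
    rw [alternating, alternating, map_sum, Finset.sum_mul_sum]
    refine Finset.sum_congr rfl fun w _ => Finset.sum_congr rfl fun v _ => ?_
    rw [map_mul, conj_annihilator, sub_eq_add_neg, map_add_eq_mul, map_intCast]
    ring
  have h2 : ∀ w v : W, w • x - v • x' ∈ N ↔ w = v ∧ x = x' := by
    intro w v
    constructor
    · intro h
      have h3 := hN v⁻¹ _ h
      rw [smul_sub, smul_smul, smul_smul, inv_mul_cancel, one_smul] at h3
      obtain ⟨h4, h5⟩ := hx _ h3
      exact ⟨(inv_mul_eq_one.1 h4).symm, h5⟩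
    · rintro ⟨rfl, rfl⟩
      rw [sub_self]
      exact zero_mem _
  simp only [h1]
  rw [Finset.sum_comm]
  simp only [Finset.sum_comm (s := (Finset.univ : Finset (Annihilator N))), ← Finset.mul_sum,
    sum_annihilator, h2]
  by_cases hxx : x = x'
  · simp only [hxx, and_true, if_true, mul_ite, mul_zero, Finset.sum_ite_eq, Finset.mem_univ,
      sgn_mul_sgn, one_mul, Finset.sum_const, nsmul_eq_mul, Finset.card_univ]
    ring
  · simp [hxx]

/-- Orthogonality of the alternating sums over representatives `ψ μ` of the free orbits of
characters, if the alternating sums vanish at all other characters. -/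
theorem finite_and_sum_alternating {I : Type*} (hN : ∀ (w : W), ∀ p ∈ N, w • p ∈ N)
    (ψ : I → AddChar P ℂ) (hψ : ∀ μ, ∀ p ∈ N, ψ μ p = 1)
    (hinj : ∀ (w : W) μ μ', (ψ μ).twist w = ψ μ' → w = 1 ∧ μ = μ')
    (hsurj : ∀ φ : AddChar P ℂ, (∀ p ∈ N, φ p = 1) →
      (∃ (w : W) (μ : I), φ = (ψ μ).twist w) ∨ ∃ w : W, sgn w = -1 ∧ φ.twist w = φ) :
    Finite I ∧ ∀ [Fintype I] (x x' : P) [Decidable (x = x')],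
      (∀ w : W, w • x - x' ∈ N → w = 1 ∧ x = x') →
      ∑ μ, alternating sgn x (ψ μ) * (starRingEnd ℂ) (alternating sgn x' (ψ μ)) =
        if x = x' then (Nat.card (P ⧸ N) : ℂ) else 0 := by
  have hfin := Fintype.ofFinite (Annihilator N)
  -- Freeness makes this map injective; its image is the union of the orbits of the `ψ μ`, and the
  -- terms outside it vanish.
  let Φ : I × W → Annihilator N := fun g => ⟨(ψ g.1).twist g.2, fun p hp => by
    rw [twist_apply]
    exact hψ _ _ (hN _ _ hp)⟩
  have hΦ : Function.Injective Φ := by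
    rintro ⟨μ, w⟩ ⟨μ', w'⟩ h
    have h1 : (ψ μ).twist w = (ψ μ').twist w' := congrArg Subtype.val h
    have h2 : (ψ μ).twist (w * w'⁻¹) = ψ μ' := by
      rw [← twist_twist, h1, twist_twist, mul_inv_cancel, twist_one]
    obtain ⟨h3, h4⟩ := hinj _ _ _ h2
    rw [h4, mul_inv_eq_one.1 h3]
  refine ⟨?_, ?_⟩
  · exact Finite.of_injective (fun μ => Φ (μ, 1)) fun μ μ' h => (Prod.mk.inj (hΦ h)).1
  intro _ x x' _ hx
  have h1 := sum_alternating_annihilator (sgn := sgn) hN hx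
  have h2 : ∑ g : I × W, alternating sgn x (ψ g.1) *
      (starRingEnd ℂ) (alternating sgn x' (ψ g.1)) =
      ∑ φ : Annihilator N, alternating sgn x φ.1 *
        (starRingEnd ℂ) (alternating sgn x' φ.1) := by
    refine Fintype.sum_of_injective Φ hΦ _ _ (fun φ hφ => ?_) fun g => ?_
    · rcases hsurj φ.1 φ.2 with ⟨w, μ, h⟩ | ⟨w, hw, h⟩
      · exact absurd ⟨(μ, w), Subtype.ext h.symm⟩ hφ
      · have h3 := alternating_twist sgn x φ.1 w
        rw [h, hw] at h3
        have h4 : alternating sgn x φ.1 = 0 := by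
          push_cast at h3
          linear_combination h3 / 2
        rw [h4, zero_mul]
    · simp only [Φ, alternating_twist, map_mul, map_intCast]
      linear_combination (-(alternating sgn x (ψ g.1) *
        (starRingEnd ℂ) (alternating sgn x' (ψ g.1)))) * sgn_mul_sgn sgn g.2
  rw [h1, Fintype.sum_prod_type] at h2
  simp only [Finset.sum_const, Finset.card_univ, nsmul_eq_mul, ← Finset.mul_sum] at h2
  have hW : (Fintype.card W : ℂ) ≠ 0 := by exact_mod_cast Fintype.card_ne_zero
  refine mul_left_cancel₀ hW ?_
  rw [h2]
  split_ifs <;> ring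

end AddChar
end

noncomputable section

namespace AffineType

variable {n : ℕ} (T : AffineType n)

/-! ### The two actions of the finite Weyl group -/

theorem reflection_apply (i : Fin n) (x : Fin n → ℝ) :
    T.reflection i x = x - x i • T.simpleRoot i := by
  simp [reflection, Module.reflection_apply, dotProductBilin, simpleCoroot]

theorem coreflection_apply (i : Fin n) (y : Fin n → ℝ) :
    T.coreflection i y = y - (T.simpleRoot i ⬝ᵥ y) • Pi.single i 1 := by
  simp [coreflection, Module.reflection_apply, dotProductBilin, simpleCoroot]

theorem det_reflection (i : Fin n) :
    LinearMap.det (T.reflection i : (Fin n → ℝ) →ₗ[ℝ] (Fin n → ℝ)) = -1 :=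
  Module.det_reflection _

theorem exists_word {w : (Fin n → ℝ) ≃ₗ[ℝ] (Fin n → ℝ)} (hw : w ∈ T.weylGroup) :
    ∃ l : List (Fin n), (l.map T.reflection).prod = w := by
  induction hw using Subgroup.closure_induction'' with
  | mem w hw => obtain ⟨i, rfl⟩ := hw; exact ⟨[i], by simp⟩
  | inv_mem w hw =>
    obtain ⟨i, rfl⟩ := hw
    have h : (T.reflection i)⁻¹ = T.reflection i := Module.reflection_inv _
    exact ⟨[i], by simp [h]⟩
  | one => exact ⟨[], rfl⟩
  | mul w v _ _ hw hv =>
    obtain ⟨l, rfl⟩ := hw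
    obtain ⟨m, rfl⟩ := hv
    exact ⟨l ++ m, by simp⟩

/-- Each letter of a shortest word has determinant `-1`. Multiplicativity of the sign then comes
from the determinant. -/
theorem neg_one_pow_length (w : T.weylGroup) :
    (-1 : ℝ) ^ T.length w =
      LinearMap.det ((w : (Fin n → ℝ) ≃ₗ[ℝ] (Fin n → ℝ)) : (Fin n → ℝ) →ₗ[ℝ] (Fin n → ℝ)) := by
  have hne : {m | ∃ l : List (Fin n), l.length = m ∧ (l.map T.reflection).prod = w}.Nonempty := by
    obtain ⟨l, hl⟩ := T.exists_word w.2
    exact ⟨_, l, rfl, hl⟩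
  obtain ⟨l, hl, hw⟩ := Nat.sInf_mem hne
  have hl' : l.length = T.length w := hl
  rw [← hl', ← hw]
  clear hw hl hl'
  induction l with
  | nil => exact LinearMap.det_id.symm
  | cons i l ih =>
    rw [List.length_cons, pow_succ', ih, List.map_cons, List.prod_cons, ← LinearEquiv.coe_det,
      ← LinearEquiv.coe_det, map_mul, Units.val_mul, LinearEquiv.coe_det (T.reflection i),
      T.det_reflection]

/-- The sign of an element of the finite Weyl group. -/
def sign : T.weylGroup →* ℤˣ where
  toFun w := (-1) ^ T.length w
  map_one' := by
    have h := T.neg_one_pow_length 1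
    refine Units.ext ?_
    have h1 : ((-1 : ℝ)) ^ T.length 1 = 1 := by
      exact h.trans LinearMap.det_id
    push_cast
    exact_mod_cast h1
  map_mul' w v := by
    refine Units.ext ?_
    have h1 : ((-1 : ℝ)) ^ T.length (w * v) = (-1) ^ T.length w * (-1) ^ T.length v := by
      rw [T.neg_one_pow_length, T.neg_one_pow_length, T.neg_one_pow_length, Subgroup.coe_mul,
        ← LinearEquiv.coe_det, ← LinearEquiv.coe_det, ← LinearEquiv.coe_det, map_mul,
        Units.val_mul]
    push_cast
    exact_mod_cast h1

theorem sign_apply (w : T.weylGroup) : T.sign w = (-1) ^ T.length w := rfl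

theorem cast_sign (w : T.weylGroup) : ((T.sign w : ℤ) : ℝ) =
    LinearMap.det ((w : (Fin n → ℝ) ≃ₗ[ℝ] (Fin n → ℝ)) : (Fin n → ℝ) →ₗ[ℝ] (Fin n → ℝ)) := by
  rw [← T.neg_one_pow_length, sign_apply]
  push_cast
  rfl

instance : DistribMulAction T.weylGroup T.weightLattice where
  smul w x := ⟨(w : (Fin n → ℝ) ≃ₗ[ℝ] (Fin n → ℝ)) (x : Fin n → ℝ), T.weyl_mem w.2 x.2⟩
  one_smul _ := rfl
  mul_smul _ _ _ := rfl
  smul_zero w := Subtype.ext (w : (Fin n → ℝ) ≃ₗ[ℝ] (Fin n → ℝ)).map_zero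
  smul_add w _ _ := Subtype.ext ((w : (Fin n → ℝ) ≃ₗ[ℝ] (Fin n → ℝ)).map_add _ _)

theorem coe_smul (w : T.weylGroup) (x : T.weightLattice) :
    ((w • x : T.weightLattice) : Fin n → ℝ) = (w : (Fin n → ℝ) ≃ₗ[ℝ] (Fin n → ℝ)) x := rfl

theorem altSum_eq_alternating [Fintype T.weylGroup] (lam : T.weightLattice)
    (t : AddChar T.weightLattice ℂ) :
    T.altSum lam t = AddChar.alternating T.sign (lam + ⟨T.rho, T.rho_mem⟩) t := by
  rw [altSum, finsum_eq_sum_of_fintype, AddChar.alternating]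
  refine Finset.sum_congr rfl fun w _ => ?_
  rw [sign_apply]
  push_cast
  rfl

theorem mem_weightLattice {x : Fin n → ℝ} :
    x ∈ T.weightLattice ↔ ∃ m : Fin n → ℤ, x = fun i => (m i : ℝ) := by
  constructor
  · intro hx
    choose m hm using hx
    exact ⟨m, funext fun i => by rw [← hm, simpleCoroot, dotProduct_single, mul_one]⟩
  · rintro ⟨m, rfl⟩ i
    exact ⟨m i, by rw [simpleCoroot, dotProduct_single, mul_one]⟩

theorem rho_eq : T.rho = fun _ => 1 := by
  ext j
  simp [rho, fundamentalWeight, Pi.single_apply]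

theorem gram_apply (hT : T.isUntwistedOrAEven = true) (i j : Fin n) :
    T.gram i j = T.mult i * T.finitePart i j := by
  rw [mult, if_pos hT]
  rfl

namespace HasData

variable {T} {D D' : CartanDatum (Fin n)} (h : T.HasData D D')
include h

theorem simpleRoot_dotProduct (i : Fin n) (y : Fin n → ℝ) :
    T.simpleRoot i ⬝ᵥ y = D.standard.f i y := by
  rw [D.standard_f, h.C_eq]
  rfl

theorem coreflection_eq (i : Fin n) : T.coreflection i = D.standard.reflection i := by
  ext1 y
  rw [coreflection_apply, h.simpleRoot_dotProduct, CartanDatum.Realization.reflection_apply]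
  rfl

theorem reflection_dotProduct (i : Fin n) (x y : Fin n → ℝ) :
    T.reflection i x ⬝ᵥ y = x ⬝ᵥ D.standard.reflection i y := by
  rw [← h.coreflection_eq, reflection_apply, coreflection_apply, sub_dotProduct, dotProduct_sub,
    smul_dotProduct, dotProduct_smul, dotProduct_single, mul_one, smul_eq_mul, smul_eq_mul,
    mul_comm]

/-- Adjoints under the pairing carry the Weyl group on weights to the one on the Cartan subalgebra,
where the exponents of the characters live. -/
theorem exists_adjoint {w : (Fin n → ℝ) ≃ₗ[ℝ] (Fin n → ℝ)} (hw : w ∈ T.weylGroup) :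
    ∃ v ∈ D.standard.weylGroup, ∀ x y, w x ⬝ᵥ y = x ⬝ᵥ v y := by
  induction hw using Subgroup.closure_induction'' with
  | mem w hw =>
    obtain ⟨i, rfl⟩ := hw
    exact ⟨_, D.standard.reflection_mem i, h.reflection_dotProduct i⟩
  | inv_mem w hw =>
    obtain ⟨i, rfl⟩ := hw
    have hi : (T.reflection i)⁻¹ = T.reflection i := Module.reflection_inv _
    rw [hi]
    exact ⟨_, D.standard.reflection_mem i, h.reflection_dotProduct i⟩
  | one => exact ⟨1, one_mem _, fun _ _ => rfl⟩
  | mul w₁ w₂ _ _ h₁ h₂ =>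
    obtain ⟨v₁, hv₁, h₁⟩ := h₁
    obtain ⟨v₂, hv₂, h₂⟩ := h₂
    exact ⟨v₂ * v₁, mul_mem hv₂ hv₁, fun x y => by
      rw [LinearEquiv.mul_apply, LinearEquiv.mul_apply, h₁, h₂]⟩

/-- The determinant is recorded because the oddness of an element is detected on the Cartan side. -/
theorem exists_coadjoint {v : (Fin n → ℝ) ≃ₗ[ℝ] (Fin n → ℝ)} (hv : v ∈ D.standard.weylGroup) :
    ∃ w ∈ T.weylGroup, LinearMap.det (w : (Fin n → ℝ) →ₗ[ℝ] (Fin n → ℝ)) =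
      LinearMap.det (v : (Fin n → ℝ) →ₗ[ℝ] (Fin n → ℝ)) ∧ ∀ x y, w x ⬝ᵥ y = x ⬝ᵥ v y := by
  have hs : ∀ i, ∃ w ∈ T.weylGroup, LinearMap.det (w : (Fin n → ℝ) →ₗ[ℝ] (Fin n → ℝ)) =
      LinearMap.det (D.standard.reflection i : (Fin n → ℝ) →ₗ[ℝ] (Fin n → ℝ)) ∧
      ∀ x y, w x ⬝ᵥ y = x ⬝ᵥ D.standard.reflection i y := fun i =>
    ⟨T.reflection i, Subgroup.subset_closure ⟨i, rfl⟩, by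
      rw [T.det_reflection, D.standard.det_reflection], h.reflection_dotProduct i⟩
  induction hv using Subgroup.closure_induction'' with
  | mem v hv =>
    obtain ⟨i, rfl⟩ := hv
    exact hs i
  | inv_mem v hv =>
    obtain ⟨i, rfl⟩ := hv
    have hi : (D.standard.reflection i)⁻¹ = D.standard.reflection i := Module.reflection_inv _
    rw [hi]
    exact hs i
  | one => exact ⟨1, one_mem _, rfl, fun _ _ => rfl⟩
  | mul v₁ v₂ _ _ h₁ h₂ =>
    obtain ⟨w₁, hw₁, d₁, h₁⟩ := h₁
    obtain ⟨w₂, hw₂, d₂, h₂⟩ := h₂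
    refine ⟨w₂ * w₁, mul_mem hw₂ hw₁, ?_, fun x y => by
      rw [LinearEquiv.mul_apply, LinearEquiv.mul_apply, h₂, h₁]⟩
    rw [← LinearEquiv.coe_det, ← LinearEquiv.coe_det, map_mul, map_mul, Units.val_mul,
      Units.val_mul, LinearEquiv.coe_det, LinearEquiv.coe_det, LinearEquiv.coe_det,
      LinearEquiv.coe_det, d₁, d₂, mul_comm]

theorem finite_weylGroup : Finite T.weylGroup := by
  choose F hF hF' using fun w : T.weylGroup => h.exists_adjoint w.2
  refine Finite.of_injective (fun w => (⟨F w, hF w⟩ : D.standard.weylGroup)) fun w v hwv => ?_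
  have h1 : F w = F v := congrArg Subtype.val hwv
  refine Subtype.ext (LinearEquiv.ext fun x => dotProduct_eq _ _ fun y => ?_)
  rw [hF', hF', h1]

/-- The kernel of the Cartan matrix lies in the kernel of the positive definite form `coform`, whose
rows are multiples of its rows. -/
theorem isUnit_cartan : IsUnit (T.finitePart.map (Int.cast : ℤ → ℝ)) := by
  rw [← Matrix.mulVec_injective_iff_isUnit]
  refine (injective_iff_map_eq_zero (T.finitePart.map (Int.cast : ℤ → ℝ)).mulVecLin).2
    fun y hy => ?_
  obtain ⟨ε, hε, hc⟩ := D.exists_le_coform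
  have h1 : D.coform *ᵥ y = 0 := by
    ext i
    have h2 : (T.finitePart.map (Int.cast : ℤ → ℝ) *ᵥ y) i = 0 := congrFun hy i
    rw [← h.C_eq] at h2
    have h3 : (D.coform *ᵥ y) i = D.e i * (D.C.map (Int.cast : ℤ → ℝ) *ᵥ y) i := by
      simp [CartanDatum.coform, CartanDatum.gramCoroot, Matrix.mulVec, dotProduct,
        Finset.mul_sum, mul_assoc]
    rw [h3, h2, mul_zero, Pi.zero_apply]
  have h4 := hc y
  rw [h1, dotProduct_zero] at h4
  have h5 : ∑ i, y i ^ 2 = 0 :=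
    le_antisymm (by nlinarith) (Finset.sum_nonneg fun i _ => sq_nonneg _)
  ext i
  have h6 := (Finset.sum_eq_zero_iff_of_nonneg fun i _ => sq_nonneg (y i)).1 h5 i
    (Finset.mem_univ i)
  exact pow_eq_zero_iff (two_ne_zero) |>.1 h6

theorem linearIndependent_simpleRoot : LinearIndependent ℝ T.simpleRoot :=
  Matrix.linearIndependent_rows_iff_isUnit.2 h.isUnit_cartan

theorem isUnit_gram (hT : T.isUntwistedOrAEven = true) : IsUnit T.gram := by
  have h1 : T.gram = Matrix.diagonal T.mult * T.finitePart.map (Int.cast : ℤ → ℝ) := by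
    ext i j
    rw [T.gram_apply hT, Matrix.diagonal_mul, Matrix.map_apply]
  rw [h1]
  refine IsUnit.mul ?_ h.isUnit_cartan
  rw [Matrix.isUnit_diagonal, Pi.isUnit_iff]
  exact fun i => (h.mult_pos i).ne'.isUnit

theorem kappa_kappaInv (hT : T.isUntwistedOrAEven = true) (x : Fin n → ℝ) :
    T.kappa (T.kappaInv x) = x := by
  change (x ᵥ* T.gram⁻¹) ᵥ* T.gram = x
  rw [Matrix.vecMul_vecMul, Matrix.nonsing_inv_mul _
    ((Matrix.isUnit_iff_isUnit_det _).1 (h.isUnit_gram hT)), Matrix.vecMul_one]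

theorem kappaInv_kappa (hT : T.isUntwistedOrAEven = true) (x : Fin n → ℝ) :
    T.kappaInv (T.kappa x) = x := by
  change (x ᵥ* T.gram) ᵥ* T.gram⁻¹ = x
  rw [Matrix.vecMul_vecMul, Matrix.mul_nonsing_inv _
    ((Matrix.isUnit_iff_isUnit_det _).1 (h.isUnit_gram hT)), Matrix.vecMul_one]

end HasData

theorem adjacent_eq (hT : T.isUntwistedOrAEven = true) : T.adjacent = T := by
  cases T <;> first | rfl | exact absurd hT (by simp [isUntwistedOrAEven])

theorem dualVertex_eq (hT : T.isUntwistedOrAEven = true) : T.dualVertex = Equiv.refl _ := by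
  cases T <;> first | rfl | exact absurd hT (by simp [isUntwistedOrAEven])

theorem mult_eq_one (hT : ¬ T.isUntwistedOrAEven = true) (i : Fin n) : T.mult i = 1 := by
  rw [mult, if_neg hT]

/-- The coordinates of `θ̌` are the labels of the transposed diagram. -/
theorem thetaCheck_eq : T.thetaCheck = fun i => (T.colabel i.succ : ℝ) := by
  obtain ⟨D, D', h⟩ := T.exists_hasData
  by_cases hT : T.isUntwistedOrAEven = true
  -- It suffices that `κ` takes `∑ ǎ_i α̌_i` to `∑ a_i α_i = θ`.
  · rw [thetaCheck, if_pos hT, ← h.kappaInv_kappa hT fun i => (T.colabel i.succ : ℝ)]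
    congr 1
    rw [highestRoot, D.epsilon_highest (g := T.reflection) (fun i l => ?_)
      h.linearIndependent_simpleRoot (Φ := T.roots) rfl]
    · ext j
      simp only [kappa, Matrix.vecMulLinear_apply, Matrix.vecMul, dotProduct, Finset.sum_apply,
        Pi.smul_apply, smul_eq_mul]
      refine Finset.sum_congr rfl fun i _ => ?_
      rw [T.gram_apply hT, h.mark_eq, T.adjacent_eq hT, T.dualVertex_eq hT, simpleRoot_apply]
      simp only [Equiv.refl_symm, Equiv.refl_apply]
      ring
    · rw [reflection_apply, simpleRoot_apply, h.C_eq]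
  · rw [thetaCheck, if_neg hT]
    have hli : LinearIndependent ℝ T.simpleCoroot := by
      convert (Pi.basisFun ℝ (Fin n)).linearIndependent using 1
      ext1 i
      rw [Pi.basisFun_apply, simpleCoroot]
    -- The Cartan matrix of `D'` is the transpose, so the coroots of `A` are the roots of `D'`.
    rw [highestCoroot, D'.epsilon_highest (g := T.coreflection) (fun i l => ?_)
      hli (Φ := T.coroots) rfl]
    · ext j
      simp [simpleCoroot, Finset.sum_apply, Pi.single_apply, h.mark_eq', T.mult_eq_one hT]
    · rw [coreflection_apply, simpleCoroot, dotProduct_single, mul_one, simpleRoot_apply]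
      have h1 := h.mult_mul l i
      rw [T.mult_eq_one hT, T.mult_eq_one hT, one_mul, one_mul] at h1
      rw [h1]
      rfl

theorem mem_levelWeights {k : ℕ} {lam : Fin n → ℝ} : lam ∈ T.levelWeights k ↔
    ∃ m : Fin n → ℤ, (lam = fun i => (m i : ℝ)) ∧ (∀ i, 0 ≤ m i) ∧
      ∑ i : Fin n, T.colabel i.succ * m i ≤ k := by
  have h1 : lam ∈ T.levelWeights k ↔ lam ∈ T.weightLattice ∧
      (∀ i, 0 ≤ lam ⬝ᵥ T.simpleCoroot i) ∧ lam ⬝ᵥ T.thetaCheck ≤ k := Iff.rfl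
  rw [h1, mem_weightLattice, thetaCheck_eq]
  simp only [simpleCoroot, dotProduct_single, mul_one]
  constructor
  · rintro ⟨⟨m, rfl⟩, h2, h3⟩
    refine ⟨m, rfl, fun i => Int.cast_nonneg_iff.1 (h2 i), ?_⟩
    simp only [dotProduct] at h3
    simp only [mul_comm _ (m _)]
    exact_mod_cast h3
  · rintro ⟨m, rfl, h2, h3⟩
    refine ⟨⟨m, rfl⟩, fun i => Int.cast_nonneg_iff.2 (h2 i), ?_⟩
    simp only [dotProduct]
    simp only [mul_comm _ (m _)] at h3
    exact_mod_cast h3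

end AffineType
end

noncomputable section

/-! ### The alcove in terms of simple roots and marks -/

namespace CartanDatum.Realization

variable {ι V : Type*} [Fintype ι] [DecidableEq ι] {D : CartanDatum ι} [AddCommGroup V]
  [Module ℝ V] (R : D.Realization V) (K : ℝ)

theorem eval_simple_none (y : V) :
    R.eval K (AffineRoot.simple D none) y = K - ∑ i, D.mark i * R.f i y := by
  simp only [eval, AffineRoot.simple, rootFun_neg, LinearMap.neg_apply, rootFun_apply,
    Int.cast_one, one_mul]
  ring

theorem eval_simple_some (i : ι) (y : V) :
    R.eval K (AffineRoot.simple D (some i)) y = R.f i y := by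
  simp [eval, AffineRoot.simple, rootFun_apply, Pi.single_apply]

theorem mem_alcove_iff {y : V} :
    y ∈ R.alcove K ↔ (∀ i, 0 < R.f i y) ∧ ∑ i, D.mark i * R.f i y < K := by
  change (∀ i, 0 < R.eval K (AffineRoot.simple D i) y) ↔ _
  rw [Option.forall, and_comm, eval_simple_none, sub_pos]
  simp only [eval_simple_some]

end CartanDatum.Realization

namespace AffineType

variable {n : ℕ} (T : AffineType n)

/-! ### Weights in the alcove and the lattice `M` -/

namespace HasData

variable {T} {D D' : CartanDatum (Fin n)} (h : T.HasData D D')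
include h

/-- The realization on weights, with the simple coroots `κ(α̌_i)` or `α_i`. -/
def weightRealization : D'.Realization (Fin n → ℝ) where
  b i := T.mult i • T.simpleRoot i
  f i := (T.mult i)⁻¹ • LinearMap.proj i
  f_b i j := by
    rw [LinearMap.smul_apply, LinearMap.proj_apply, Pi.smul_apply, smul_eq_mul, smul_eq_mul,
      simpleRoot_apply, ← h.mult_mul, inv_mul_cancel_left₀ (h.mult_pos i).ne']

theorem weightRealization_f (i : Fin n) (x : Fin n → ℝ) :
    h.weightRealization.f i x = (T.mult i)⁻¹ * x i := rfl

theorem weightRealization_b (i : Fin n) :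
    h.weightRealization.b i = T.mult i • T.simpleRoot i := rfl

theorem weightRealization_weylGroup : h.weightRealization.weylGroup = T.weylGroup := by
  have h1 : h.weightRealization.reflection = T.reflection := by
    funext i
    ext1 x
    rw [CartanDatum.Realization.reflection_apply, reflection_apply, weightRealization_f,
      weightRealization_b, smul_smul, mul_right_comm, inv_mul_cancel₀ (h.mult_pos i).ne', one_mul]
  rw [CartanDatum.Realization.weylGroup, h1, AffineType.weylGroup]

theorem kappa_simpleCoroot (hT : T.isUntwistedOrAEven = true) (i : Fin n) :
    T.kappa (T.simpleCoroot i) = h.weightRealization.b i := by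
  ext j
  rw [weightRealization_b, kappa, Matrix.vecMulLinear_apply, simpleCoroot, Matrix.single_one_vecMul,
    Matrix.row_apply, T.gram_apply hT, Pi.smul_apply, smul_eq_mul, simpleRoot_apply]

theorem latticeM_eq : T.latticeM = AddSubgroup.closure (Set.range h.weightRealization.b) := by
  by_cases hT : T.isUntwistedOrAEven = true
  · rw [latticeM, if_pos hT, corootLattice, AddMonoidHom.map_closure, ← Set.range_comp]
    congr 2
    funext i
    exact h.kappa_simpleCoroot hT i
  · rw [latticeM, if_neg hT, rootLattice]
    congr 2
    funext i
    rw [weightRealization_b, T.mult_eq_one hT, one_smul]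

theorem mem_latticeM {x : Fin n → ℝ} :
    x ∈ T.latticeM ↔ ∃ z : Fin n → ℤ, x = h.weightRealization.corootVec z := by
  rw [h.latticeM_eq, ← Submodule.span_int_eq_addSubgroupClosure, Submodule.mem_toAddSubgroup,
    Submodule.mem_span_range_iff_exists_fun]
  refine exists_congr fun z => ?_
  simp only [CartanDatum.Realization.corootVec, Int.cast_smul_eq_zsmul]
  exact eq_comm

/-- The scaled lattice `(k + ȟ) M`, in the weight lattice. -/
theorem mem_scaled {K : ℕ} {x : T.weightLattice} :
    x ∈ (T.latticeM.map (nsmulAddMonoidHom K)).addSubgroupOf T.weightLattice ↔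
      ∃ z : Fin n → ℤ, (x : Fin n → ℝ) = (K : ℝ) • h.weightRealization.corootVec z := by
  rw [AddSubgroup.mem_addSubgroupOf, AddSubgroup.mem_map]
  constructor
  · rintro ⟨y, hy, hyx⟩
    obtain ⟨z, rfl⟩ := h.mem_latticeM.1 hy
    exact ⟨z, by rw [← hyx, nsmulAddMonoidHom_apply, Nat.cast_smul_eq_nsmul]⟩
  · rintro ⟨z, hz⟩
    exact ⟨_, h.mem_latticeM.2 ⟨z, rfl⟩, by
      rw [hz, nsmulAddMonoidHom_apply, Nat.cast_smul_eq_nsmul]⟩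

theorem smul_mem_scaled {K : ℕ} (w : T.weylGroup) (x : T.weightLattice)
    (hx : x ∈ (T.latticeM.map (nsmulAddMonoidHom K)).addSubgroupOf T.weightLattice) :
    w • x ∈ (T.latticeM.map (nsmulAddMonoidHom K)).addSubgroupOf T.weightLattice := by
  obtain ⟨z, hz⟩ := h.mem_scaled.1 hx
  have hw : (w : (Fin n → ℝ) ≃ₗ[ℝ] (Fin n → ℝ)) ∈ h.weightRealization.weylGroup := by
    rw [h.weightRealization_weylGroup]
    exact w.2
  obtain ⟨z', hz'⟩ := h.weightRealization.exists_apply_corootVec hw z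
  exact h.mem_scaled.2 ⟨z', by rw [coe_smul, hz, map_smul, hz']⟩

/-- Adding `ρ` raises the level by `ȟ - ǎ_0 = ȟ - 1`, so the last inequality is strict. -/
theorem add_rho_mem_alcove {k : ℕ} {lam : Fin n → ℝ} (hl : lam ∈ T.levelWeights k) :
    lam + T.rho ∈ h.weightRealization.alcove ((k + T.dualCoxeter : ℕ) : ℝ) := by
  obtain ⟨m, rfl, h0, h1⟩ := T.mem_levelWeights.1 hl
  rw [CartanDatum.Realization.mem_alcove_iff, rho_eq]
  constructor
  · intro i
    rw [weightRealization_f]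
    refine mul_pos (inv_pos.2 (h.mult_pos i)) ?_
    have : (0 : ℝ) ≤ m i := by exact_mod_cast h0 i
    exact add_pos_of_nonneg_of_pos this one_pos
  · have h2 : ∀ i, (D'.mark i : ℝ) * h.weightRealization.f i
        ((fun i => (m i : ℝ)) + fun _ => 1) =
        ((T.colabel i.succ * m i + T.colabel i.succ : ℤ) : ℝ) := by
      intro i
      rw [weightRealization_f, h.mark_eq']
      have := (h.mult_pos i).ne'
      simp only [Pi.add_apply]
      push_cast
      field_simp
    simp only [h2]
    have h3 : ∑ i : Fin n, (T.colabel i.succ * m i + T.colabel i.succ : ℤ) <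
        (k + T.dualCoxeter : ℕ) := by
      rw [Finset.sum_add_distrib, ← T.sum_colabel]
      push_cast
      linarith
    exact_mod_cast h3

/-- This is freeness of `W ⋉ KM` on the alcove, in the form required for the first evaluation of the
sum. -/
theorem eq_one_of_smul_sub_mem {k : ℕ} {x x' : T.weightLattice} {w : T.weylGroup}
    (hx : (x : Fin n → ℝ) ∈ h.weightRealization.alcove ((k + T.dualCoxeter : ℕ) : ℝ))
    (hx' : (x' : Fin n → ℝ) ∈ h.weightRealization.alcove ((k + T.dualCoxeter : ℕ) : ℝ))
    (hw : w • x - x' ∈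
      (T.latticeM.map (nsmulAddMonoidHom (k + T.dualCoxeter))).addSubgroupOf T.weightLattice) :
    w = 1 ∧ x = x' := by
  obtain ⟨z, hz⟩ := h.mem_scaled.1 hw
  have hw' : (w : (Fin n → ℝ) ≃ₗ[ℝ] (Fin n → ℝ)) ∈ h.weightRealization.weylGroup := by
    rw [h.weightRealization_weylGroup]
    exact w.2
  have hz' : (w : (Fin n → ℝ) ≃ₗ[ℝ] (Fin n → ℝ)) (x : Fin n → ℝ) +
      ((k + T.dualCoxeter : ℕ) : ℝ) • h.weightRealization.corootVec (-z) = x' := by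
    rw [AddSubgroup.coe_sub, coe_smul] at hz
    rw [CartanDatum.Realization.corootVec_neg, smul_neg, ← hz]
    abel
  obtain ⟨h1, h2⟩ := h.weightRealization.eq_one_of_add_mem_alcove hw' (-z) hx (by rwa [hz'])
  refine ⟨Subtype.ext h1, Subtype.ext ?_⟩
  rw [← hz', h1, h2, add_zero]
  rfl

end HasData

/-! ### Coordinates of weights -/

/-- The weight with given coordinates. -/
def weightOfInt : (Fin n → ℤ) →+ T.weightLattice where
  toFun m := ⟨fun i => (m i : ℝ), T.mem_weightLattice.2 ⟨m, rfl⟩⟩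
  map_zero' := by ext; simp
  map_add' _ _ := by ext; simp

theorem weightOfInt_surjective : Function.Surjective T.weightOfInt := by
  rintro ⟨x, hx⟩
  obtain ⟨m, rfl⟩ := T.mem_weightLattice.1 hx
  exact ⟨m, rfl⟩

theorem coe_weightOfInt (m : Fin n → ℤ) (i : Fin n) :
    (T.weightOfInt m : Fin n → ℝ) i = m i := rfl

theorem dualCoxeter_pos : 0 < T.dualCoxeter := by
  rw [← sum_colabel]
  exact Nat.succ_pos _

/-- The quotient of the weight lattice by `(k + ȟ) M` is finite. -/
theorem HasData.finite_quotient {T : AffineType n} {D D' : CartanDatum (Fin n)}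
    (h : T.HasData D D') {K : ℕ} (hK : 0 < K) : Finite (T.weightLattice ⧸
      (T.latticeM.map (nsmulAddMonoidHom K)).addSubgroupOf T.weightLattice) := by
  choose G hG using h.integral
  have hdet : (Matrix.of G).det ≠ 0 := by
    intro h0
    have h1 : (Matrix.of G).map (Int.cast : ℤ → ℝ) =
        Matrix.diagonal T.mult * T.finitePart.map (Int.cast : ℤ → ℝ) := by
      ext i j
      rw [Matrix.diagonal_mul, Matrix.map_apply, Matrix.map_apply, hG, Matrix.of_apply]
    have h2 : ((Matrix.of G).map (Int.cast : ℤ → ℝ)).det = 0 := by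
      have := (Int.castRingHom ℝ).map_det (Matrix.of G)
      rw [h0, map_zero] at this
      exact this.symm
    rw [h1, Matrix.det_mul, Matrix.det_diagonal] at h2
    exact mul_ne_zero (Finset.prod_ne_zero_iff.2 fun i _ => (h.mult_pos i).ne')
      ((Matrix.isUnit_iff_isUnit_det _).1 h.isUnit_cartan).ne_zero h2
  -- The rows of `G` generate `M`, so by Cramer's rule `det G` times any weight lies in `M`. The
  -- quotient is thus torsion, and it is finitely generated.
  have hmem : ∀ x : T.weightLattice, ((K : ℤ) * (Matrix.of G).det) • x ∈
      (T.latticeM.map (nsmulAddMonoidHom K)).addSubgroupOf T.weightLattice := by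
    intro x
    obtain ⟨m, rfl⟩ := T.weightOfInt_surjective x
    refine h.mem_scaled.2 ⟨m ᵥ* (Matrix.of G).adjugate, ?_⟩
    have h1 : (m ᵥ* (Matrix.of G).adjugate) ᵥ* Matrix.of G = (Matrix.of G).det • m := by
      rw [Matrix.vecMul_vecMul, Matrix.adjugate_mul, Matrix.vecMul_smul, Matrix.vecMul_one]
    ext j
    have h2 := congrFun h1 j
    have h3 : h.weightRealization.corootVec (m ᵥ* (Matrix.of G).adjugate) j =
        (((Matrix.of G).det • m) j : ℤ) := by
      rw [← h2, Matrix.vecMul, dotProduct, CartanDatum.Realization.corootVec, Finset.sum_apply]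
      push_cast
      refine Finset.sum_congr rfl fun i _ => ?_
      rw [h.weightRealization_b, Pi.smul_apply, Pi.smul_apply, simpleRoot_apply, smul_eq_mul,
        smul_eq_mul, hG]
      rfl
    rw [← map_zsmul, coe_weightOfInt, Pi.smul_apply (K : ℝ), h3]
    simp only [Pi.smul_apply, smul_eq_mul]
    push_cast
    ring
  have hfg : AddGroup.FG (T.weightLattice ⧸
      (T.latticeM.map (nsmulAddMonoidHom K)).addSubgroupOf T.weightLattice) :=
    AddGroup.fg_of_surjective (f := (QuotientAddGroup.mk' _).comp T.weightOfInt)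
      ((QuotientAddGroup.mk'_surjective _).comp T.weightOfInt_surjective)
  refine AddCommGroup.finite_of_fg_isAddTorsion _ fun q => ?_
  obtain ⟨x, rfl⟩ := QuotientAddGroup.mk'_surjective _ q
  rw [isOfFinAddOrder_iff_zsmul_eq_zero]
  refine ⟨(K : ℤ) * (Matrix.of G).det, mul_ne_zero (by exact_mod_cast hK.ne') hdet, ?_⟩
  rw [← map_zsmul]
  exact (QuotientAddGroup.eq_zero_iff _).2 (hmem x)

end AffineType
end

noncomputable section

namespace AffineType

variable {n : ℕ} (T : AffineType n)

/-! ### Characters of the weight lattice -/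

theorem torusExp_eq_one_iff (y : Fin n → ℝ) (x : T.weightLattice) :
    T.torusExp y x = 1 ↔ ∃ m : ℤ, (x : Fin n → ℝ) ⬝ᵥ y = m := by
  change Complex.exp (2 * Real.pi * Complex.I * ((x : Fin n → ℝ) ⬝ᵥ y : ℝ)) = 1 ↔ _
  rw [Complex.exp_eq_one_iff]
  refine exists_congr fun m => ?_
  rw [mul_comm, mul_left_inj' Complex.two_pi_I_ne_zero]
  norm_cast

theorem torusExp_add (y y' : Fin n → ℝ) (x : T.weightLattice) :
    T.torusExp (y + y') x = T.torusExp y x * T.torusExp y' x := by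
  change Complex.exp _ = Complex.exp _ * Complex.exp _
  rw [← Complex.exp_add, dotProduct_add]
  push_cast
  ring_nf

theorem torusExp_add_int (y : Fin n → ℝ) (m : Fin n → ℤ) :
    T.torusExp (y + fun i => (m i : ℝ)) = T.torusExp y := by
  refine AddChar.ext _ _ fun x => ?_
  rw [torusExp_add]
  refine mul_eq_left₀ (Complex.exp_ne_zero _) |>.2 ((T.torusExp_eq_one_iff _ x).2 ?_)
  obtain ⟨l, rfl⟩ := T.weightOfInt_surjective x
  exact ⟨l ⬝ᵥ m, by simp [dotProduct, coe_weightOfInt]⟩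

/-- Evaluation at the fundamental weights shows that a character determines its exponent modulo the
coroot lattice. -/
theorem exists_int_of_torusExp_eq {y y' : Fin n → ℝ} (hy : T.torusExp y = T.torusExp y') :
    ∃ m : Fin n → ℤ, y = y' + fun i => (m i : ℝ) := by
  have h1 : ∀ i, ∃ m : ℤ, (y - y') i = m := by
    intro i
    have h2 : T.torusExp (y - y') (T.weightOfInt (Pi.single i 1)) = 1 := by
      have h3 := T.torusExp_add (y - y') y' (T.weightOfInt (Pi.single i 1))
      rw [sub_add_cancel, hy] at h3
      have h4 : T.torusExp y' (T.weightOfInt (Pi.single i 1)) ≠ 0 := Complex.exp_ne_zero _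
      exact (mul_left_eq_self₀.1 h3.symm).resolve_right h4
    obtain ⟨m, hm⟩ := (T.torusExp_eq_one_iff _ _).1 h2
    refine ⟨m, ?_⟩
    rw [← hm]
    simp [dotProduct, coe_weightOfInt, Pi.single_apply]
  choose m hm using h1
  exact ⟨m, funext fun i => by rw [Pi.add_apply, ← hm, Pi.sub_apply]; ring⟩

theorem exists_eq_torusExp (φ : AddChar T.weightLattice ℂ)
    (hφ : ∀ x, ‖φ x‖ = 1) : ∃ y, φ = T.torusExp y := by
  choose θ hθ using fun i => (Complex.norm_eq_one_iff _).1 (hφ (T.weightOfInt (Pi.single i 1)))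
  refine ⟨fun i => θ i / (2 * Real.pi), ?_⟩
  have h1 : (φ.compAddMonoidHom T.weightOfInt).toAddMonoidHom =
      ((T.torusExp fun i => θ i / (2 * Real.pi)).compAddMonoidHom T.weightOfInt).toAddMonoidHom := by
    refine AddMonoidHom.functions_ext' _ _ _ fun i => AddMonoidHom.ext_int ?_
    change φ (T.weightOfInt (Pi.single i 1)) = Complex.exp _
    rw [← hθ]
    congr 1
    have h2 : (T.weightOfInt (Pi.single i 1) : Fin n → ℝ) ⬝ᵥ (fun i => θ i / (2 * Real.pi)) =
        θ i / (2 * Real.pi) := by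
      simp [dotProduct, coe_weightOfInt, Pi.single_apply]
    rw [AddMonoidHom.single_apply, h2]
    push_cast
    have : (Real.pi : ℂ) ≠ 0 := by exact_mod_cast Real.pi_ne_zero
    field_simp
  refine AddChar.ext _ _ fun x => ?_
  obtain ⟨m, rfl⟩ := T.weightOfInt_surjective x
  exact DFunLike.congr_fun h1 m

theorem torusExp_twist {w : T.weylGroup} {v : (Fin n → ℝ) ≃ₗ[ℝ] (Fin n → ℝ)}
    (hwv : ∀ x y, (w : (Fin n → ℝ) ≃ₗ[ℝ] (Fin n → ℝ)) x ⬝ᵥ y = x ⬝ᵥ v y) (y : Fin n → ℝ) :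
    (T.torusExp y).twist w = T.torusExp (v y) := by
  refine AddChar.ext _ _ fun x => ?_
  rw [AddChar.twist_apply]
  change Complex.exp _ = Complex.exp _
  rw [coe_smul, hwv]

/-! ### The torus points -/

/-- The element of the Cartan subalgebra whose multiple by `(k + ȟ)⁻¹` gives the torus point of a
weight of the adjacent type. -/
def torusVector (mu : Fin n → ℝ) : Fin n → ℝ :=
  if T.isUntwistedOrAEven then T.kappaInv (T.rho + mu) else T.rhoCheck + T.epsilon mu

theorem torusPoint_eq (k : ℕ) (mu : Fin n → ℝ) : T.torusPoint k mu =
    T.torusExp (((k + T.dualCoxeter : ℕ) : ℝ)⁻¹ • T.torusVector mu) := rfl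

namespace HasData

variable {T} {D D' : CartanDatum (Fin n)} (h : T.HasData D D')
include h

theorem simpleRoot_fundamentalCoweight (i j : Fin n) :
    T.simpleRoot i ⬝ᵥ T.fundamentalCoweight j = if i = j then 1 else 0 := by
  have h1 : Matrix.of T.simpleRoot *ᵥ T.fundamentalCoweight j = Pi.single j 1 := by
    rw [fundamentalCoweight, Matrix.mulVec_mulVec, Matrix.mul_nonsing_inv, Matrix.one_mulVec]
    exact (Matrix.isUnit_iff_isUnit_det _).1 h.isUnit_cartan
  have h2 := congrFun h1 i
  rw [Pi.single_apply] at h2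
  exact h2

/-- This formula covers both definitions of `t_μ'`, by the symmetry of the Gram matrix in one and by
the duality of simple roots and fundamental coweights in the other. After it the two kinds are
treated alike. -/
theorem mult_mul_torusVector (mu : Fin n → ℝ) (i : Fin n) :
    T.mult i * D.standard.f i (T.torusVector mu) = 1 + mu (T.dualVertex.symm i) := by
  rw [← h.simpleRoot_dotProduct]
  by_cases hT : T.isUntwistedOrAEven = true
  · rw [torusVector, if_pos hT, T.dualVertex_eq hT, Equiv.refl_symm, Equiv.refl_apply]
    have h1 := congrFun (h.kappa_kappaInv hT (T.rho + mu)) i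
    rw [kappa, Matrix.vecMulLinear_apply, Matrix.vecMul, dotProduct, Pi.add_apply, rho_eq] at h1
    rw [rho_eq, ← h1, dotProduct, Finset.mul_sum]
    refine Finset.sum_congr rfl fun j _ => ?_
    rw [T.gram_apply hT, h.mult_symm hT, simpleRoot_apply]
    ring
  · rw [torusVector, if_neg hT, T.mult_eq_one hT, one_mul, dotProduct_add, rhoCheck, epsilon,
      Fintype.linearCombination_apply, dotProduct_sum, dotProduct_sum]
    simp only [dotProduct_smul, h.simpleRoot_fundamentalCoweight, smul_eq_mul, mul_ite, mul_one,
      mul_zero, Finset.sum_ite_eq, Finset.mem_univ, if_true, ← Equiv.symm_apply_eq]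

theorem eq_of_f_eq {y y' : Fin n → ℝ} (hy : ∀ i, D.standard.f i y = D.standard.f i y') :
    y = y' := by
  refine Matrix.mulVec_injective_iff_isUnit.2 h.isUnit_cartan (funext fun i => ?_)
  rw [← h.C_eq]
  exact hy i

theorem sum_mark_mul_torusVector (mu : Fin n → ℝ) :
    ∑ i, D.mark i * D.standard.f i (T.torusVector mu) =
      ∑ i : Fin n, T.adjacent.colabel i.succ * (1 + mu i) := by
  rw [← Equiv.sum_comp T.dualVertex.symm fun i => T.adjacent.colabel i.succ * (1 + mu i)]
  refine Finset.sum_congr rfl fun i _ => ?_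
  rw [h.mark_eq, ← h.mult_mul_torusVector]
  ring

/-- By integrality `0 < 1 + m` means `0 ≤ m`. Since `ǎ'_0 = 1` and `ȟ' = ȟ`, the coroot level of `m
+ 1` is below `k + ȟ` exactly when that of `m` is at most `k`. -/
theorem torusVector_mem_alcove_iff (k : ℕ) (m : Fin n → ℤ) :
    T.torusVector (fun i => (m i : ℝ)) ∈ D.standard.alcove ((k + T.dualCoxeter : ℕ) : ℝ) ↔
      (fun i => (m i : ℝ)) ∈ T.adjacent.levelWeights k := by
  have h1 : ∀ i, 0 < D.standard.f i (T.torusVector fun i => (m i : ℝ)) ↔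
      0 ≤ m (T.dualVertex.symm i) := by
    intro i
    rw [← mul_pos_iff_of_pos_left (h.mult_pos i), h.mult_mul_torusVector]
    norm_cast
    omega
  have h2 : ∑ i, D.mark i * D.standard.f i (T.torusVector fun i => (m i : ℝ)) <
      ((k + T.dualCoxeter : ℕ) : ℝ) ↔ ∑ i : Fin n, T.adjacent.colabel i.succ * m i ≤ k := by
    rw [h.sum_mark_mul_torusVector, ← T.dualCoxeter_adjacent, ← T.adjacent.sum_colabel]
    simp only [mul_add, mul_one, Finset.sum_add_distrib]
    norm_cast
    push_cast
    constructor <;> intro <;> linarith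
  rw [CartanDatum.Realization.mem_alcove_iff, h2, T.adjacent.mem_levelWeights]
  simp only [h1]
  constructor
  · rintro ⟨h3, h4⟩
    exact ⟨m, rfl, fun i => by simpa using h3 (T.dualVertex i), h4⟩
  · rintro ⟨m', hm, h3, h4⟩
    obtain rfl : m = m' := funext fun i => Int.cast_injective (congrFun hm i)
    exact ⟨fun i => h3 _, h4⟩

/-- The characters that are trivial on `(k + ȟ) M`. -/
theorem torusExp_trivial_iff {K : ℕ} (hK : 0 < K) (y : Fin n → ℝ) :
    (∀ x ∈ (T.latticeM.map (nsmulAddMonoidHom K)).addSubgroupOf T.weightLattice,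
      T.torusExp ((K : ℝ)⁻¹ • y) x = 1) ↔ ∀ i, ∃ m : ℤ, T.mult i * D.standard.f i y = m := by
  have hK' : (K : ℝ) ≠ 0 := by exact_mod_cast hK.ne'
  have h1 : ∀ z : Fin n → ℤ, ((K : ℝ) • h.weightRealization.corootVec z) ⬝ᵥ ((K : ℝ)⁻¹ • y) =
      ∑ i, z i * (T.mult i * D.standard.f i y) := by
    intro z
    rw [smul_dotProduct, dotProduct_smul, smul_eq_mul, smul_eq_mul, mul_inv_cancel_left₀ hK',
      CartanDatum.Realization.corootVec, sum_dotProduct]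
    refine Finset.sum_congr rfl fun i _ => ?_
    rw [h.weightRealization_b, smul_dotProduct, smul_dotProduct, h.simpleRoot_dotProduct]
    rfl
  constructor
  · intro hy i
    choose G hG using h.integral
    have h2 : h.weightRealization.corootVec (Pi.single i 1) = fun j => (G i j : ℝ) := by
      have h3 : h.weightRealization.corootVec (Pi.single i 1) = h.weightRealization.b i := by
        simp [CartanDatum.Realization.corootVec, Pi.single_apply]
      ext j
      rw [h3, h.weightRealization_b, Pi.smul_apply, smul_eq_mul, simpleRoot_apply, hG]
    have h3 : ((K : ℝ) • h.weightRealization.corootVec (Pi.single i 1)) ∈ T.weightLattice := by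
      rw [mem_weightLattice, h2]
      exact ⟨fun j => K * G i j, by ext j; simp⟩
    obtain ⟨m, hm⟩ := (T.torusExp_eq_one_iff _ _).1
      (hy ⟨_, h3⟩ (h.mem_scaled.2 ⟨Pi.single i 1, rfl⟩))
    rw [h1] at hm
    exact ⟨m, by simpa [Pi.single_apply] using hm⟩
  · intro hy x hx
    choose m hm using hy
    obtain ⟨z, hz⟩ := h.mem_scaled.1 hx
    rw [torusExp_eq_one_iff, hz, h1]
    exact ⟨∑ i, z i * m i, by simp [hm]⟩

theorem torusPoint_eq_one (k : ℕ) (mu : T.adjacent.levelWeights k) (x : T.weightLattice)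
    (hx : x ∈ (T.latticeM.map (nsmulAddMonoidHom (k + T.dualCoxeter))).addSubgroupOf
      T.weightLattice) : T.torusPoint k mu x = 1 := by
  rw [torusPoint_eq]
  refine (h.torusExp_trivial_iff (Nat.add_pos_right k T.dualCoxeter_pos) _).2 (fun i => ?_) x hx
  obtain ⟨m, hm, -⟩ := T.adjacent.mem_levelWeights.1 mu.2
  exact ⟨1 + m (T.dualVertex.symm i), by rw [h.mult_mul_torusVector, hm]; push_cast; rfl⟩

/-- Equal characters have exponents congruent modulo `K` times the coroot lattice, and the torus
vectors lie in the open alcove, where the affine group of the Cartan subalgebra acts freely. -/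
theorem eq_of_torusPoint_twist (k : ℕ) (w : T.weylGroup) (mu mu' : T.adjacent.levelWeights k)
    (hw : (T.torusPoint k mu).twist w = T.torusPoint k mu') : w = 1 ∧ mu = mu' := by
  obtain ⟨v, hv, hwv⟩ := h.exists_adjoint w.2
  have hK : ((k + T.dualCoxeter : ℕ) : ℝ) ≠ 0 := by
    exact_mod_cast (Nat.add_pos_right k T.dualCoxeter_pos).ne'
  have hmem : ∀ mu : T.adjacent.levelWeights k,
      T.torusVector mu ∈ D.standard.alcove ((k + T.dualCoxeter : ℕ) : ℝ) := by
    intro mu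
    obtain ⟨m, hm, -⟩ := T.adjacent.mem_levelWeights.1 mu.2
    rw [hm, h.torusVector_mem_alcove_iff, ← hm]
    exact mu.2
  rw [torusPoint_eq, torusPoint_eq, T.torusExp_twist hwv] at hw
  obtain ⟨m, hm⟩ := T.exists_int_of_torusExp_eq hw
  have h1 : v (T.torusVector mu) + ((k + T.dualCoxeter : ℕ) : ℝ) • D.standard.corootVec (-m) =
      T.torusVector mu' := by
    rw [CartanDatum.Realization.corootVec_neg, D.standard_corootVec]
    rw [map_smul] at hm
    have h2 := congrArg (((k + T.dualCoxeter : ℕ) : ℝ) • ·) hm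
    simp only [smul_add, smul_inv_smul₀ hK] at h2
    rw [h2]
    module
  obtain ⟨h2, h3⟩ := D.standard.eq_one_of_add_mem_alcove hv (-m) (hmem mu) (by
    rw [h1]
    exact hmem mu')
  rw [h3, h2, add_zero] at h1
  have h4 : T.torusVector mu = T.torusVector mu' := h1
  refine ⟨Subtype.ext (LinearEquiv.ext fun x => dotProduct_eq _ _ fun y => ?_),
    Subtype.ext (funext fun i => ?_)⟩
  · rw [hwv, h2]
    rfl
  · have h5 := h.mult_mul_torusVector mu (T.dualVertex i)
    have h6 := h.mult_mul_torusVector mu' (T.dualVertex i)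
    rw [h4, h6, Equiv.symm_apply_apply] at h5
    exact (add_left_cancel h5).symm

theorem exists_torusPoint_or_odd (k : ℕ) (φ : AddChar T.weightLattice ℂ)
    (hφ : ∀ x ∈ (T.latticeM.map (nsmulAddMonoidHom (k + T.dualCoxeter))).addSubgroupOf
      T.weightLattice, φ x = 1) :
    (∃ (w : T.weylGroup) (mu : T.adjacent.levelWeights k), φ = (T.torusPoint k mu).twist w) ∨
      ∃ w : T.weylGroup, T.sign w = -1 ∧ φ.twist w = φ := by
  have hK := Nat.add_pos_right k T.dualCoxeter_pos
  have hK' : (0 : ℝ) < ((k + T.dualCoxeter : ℕ) : ℝ) := by exact_mod_cast hK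
  have hfin := h.finite_quotient hK
  -- The character factors through a finite group, so it is unitary and has a real exponent.
  have hnorm : ∀ x, ‖φ x‖ = 1 := by
    intro x
    obtain ⟨ψ, hψ⟩ := (AddChar.annihilatorEquiv _).surjective ⟨φ, hφ⟩
    have h1 : φ x = ψ x := by rw [← AddChar.annihilatorEquiv_apply, hψ]
    rw [h1, AddChar.norm_apply]
  obtain ⟨y₀, rfl⟩ := T.exists_eq_torusExp φ hnorm
  obtain ⟨v, hv, z, hz⟩ := D.exists_mem_closedAlcove hK' (((k + T.dualCoxeter : ℕ) : ℝ) • y₀)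
  set y := v (((k + T.dualCoxeter : ℕ) : ℝ) • y₀) +
    ((k + T.dualCoxeter : ℕ) : ℝ) • D.standard.corootVec z with hy
  obtain ⟨w, hw, -, hwv⟩ := h.exists_coadjoint hv
  have h1 : (T.torusExp y₀).twist (⟨w, hw⟩ : T.weylGroup) =
      T.torusExp (((k + T.dualCoxeter : ℕ) : ℝ)⁻¹ • y) := by
    rw [T.torusExp_twist hwv, hy, map_smul, smul_add, inv_smul_smul₀ hK'.ne',
      inv_smul_smul₀ hK'.ne', D.standard_corootVec, torusExp_add_int]
  by_cases hpos : ∀ i, 0 <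
      D.standard.eval ((k + T.dualCoxeter : ℕ) : ℝ) (CartanDatum.AffineRoot.simple D i) y
  · left
    have h2 : ∀ x ∈ (T.latticeM.map (nsmulAddMonoidHom (k + T.dualCoxeter))).addSubgroupOf
        T.weightLattice, T.torusExp (((k + T.dualCoxeter : ℕ) : ℝ)⁻¹ • y) x = 1 := by
      intro x hx
      rw [← h1, AddChar.twist_apply]
      exact hφ _ (h.smul_mem_scaled _ _ hx)
    -- In the interior, triviality on `KM` makes the coordinates integers; subtracting `1` from each
    -- removes `ρ` and leaves a weight of `A'`.
    obtain ⟨m, hm⟩ := Classical.skolem.1 ((h.torusExp_trivial_iff hK y).1 h2)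
    have h3 : T.torusVector (fun i => ((m (T.dualVertex i) - 1 : ℤ) : ℝ)) = y := by
      refine h.eq_of_f_eq fun i => mul_left_cancel₀ (h.mult_pos i).ne' ?_
      rw [h.mult_mul_torusVector, hm, Equiv.apply_symm_apply]
      push_cast
      ring
    have h4 := (h.torusVector_mem_alcove_iff k fun i => m (T.dualVertex i) - 1).1 (by
      rw [h3]
      exact hpos)
    refine ⟨(⟨w, hw⟩ : T.weylGroup)⁻¹, ⟨_, h4⟩, ?_⟩
    rw [torusPoint_eq, h3, ← h1, AddChar.twist_twist, mul_inv_cancel, AddChar.twist_one]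
  · right
    push Not at hpos
    obtain ⟨i, hi⟩ := hpos
    -- On a wall the affine reflection fixes `y`, so its odd linear part fixes the character;
    -- conjugation by `w` transports this to the original character.
    have h0 := le_antisymm hi (hz i)
    obtain ⟨u, hu, z', hdet, hu'⟩ :=
      D.exists_affineReflection_simple ((k + T.dualCoxeter : ℕ) : ℝ) i
    have h2 := hu' y
    rw [CartanDatum.Realization.affineReflection_apply, h0, zero_smul, sub_zero] at h2
    obtain ⟨g, hg, hgdet, hgu⟩ := h.exists_coadjoint hu
    have h3 : (T.torusExp (((k + T.dualCoxeter : ℕ) : ℝ)⁻¹ • y)).twist (⟨g, hg⟩ : T.weylGroup) =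
        T.torusExp (((k + T.dualCoxeter : ℕ) : ℝ)⁻¹ • y) := by
      rw [T.torusExp_twist hgu, map_smul]
      conv_rhs => rw [h2]
      rw [smul_add, inv_smul_smul₀ hK'.ne', D.standard_corootVec, torusExp_add_int]
    refine ⟨(⟨w, hw⟩ : T.weylGroup) * ⟨g, hg⟩ * (⟨w, hw⟩ : T.weylGroup)⁻¹, ?_, ?_⟩
    · rw [map_mul, map_mul, map_inv, mul_right_comm, mul_inv_cancel, one_mul]
      have h4 := T.cast_sign ⟨g, hg⟩
      rw [hgdet, hdet] at h4
      refine Units.ext (Int.cast_injective (α := ℝ) ?_)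
      rw [h4]
      simp
    · rw [← AddChar.twist_twist, ← AddChar.twist_twist, h1, h3, ← h1, AddChar.twist_twist,
        mul_inv_cancel, AddChar.twist_one]

end HasData

/-- The unitarity of the modular matrix. -/
theorem exists_fintype_modularS_mul_conjTranspose (k : ℕ) :
    ∃ _ : Fintype (T.adjacent.levelWeights k), T.modularS k * (T.modularS k)ᴴ = 1 := by
  obtain ⟨D, D', h⟩ := T.exists_hasData
  have hK := Nat.add_pos_right k T.dualCoxeter_pos
  have hfin := h.finite_quotient hK
  have := h.finite_weylGroup
  have := Fintype.ofFinite T.weylGroup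
  obtain ⟨hI, hsum⟩ := AddChar.finite_and_sum_alternating (sgn := T.sign)
    (h.smul_mem_scaled (K := k + T.dualCoxeter))
    (fun mu : T.adjacent.levelWeights k => T.torusPoint k mu) (h.torusPoint_eq_one k)
    (h.eq_of_torusPoint_twist k) (h.exists_torusPoint_or_odd k)
  have hI' := Fintype.ofFinite (T.adjacent.levelWeights k)
  refine ⟨hI', ?_⟩
  classical
  ext lam lam'
  set x : T.levelWeights k → T.weightLattice := fun lam =>
    ⟨lam, lam.2.1⟩ + ⟨T.rho, T.rho_mem⟩ with hx
  have hinj : x lam = x lam' ↔ lam = lam' := by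
    rw [hx, add_left_inj, Subtype.mk.injEq, Subtype.ext_iff]
  have h1 := hsum (x lam) (x lam') fun w hw => h.eq_one_of_smul_sub_mem
    (h.add_rho_mem_alcove lam.2) (h.add_rho_mem_alcove lam'.2) hw
  have hq : 0 < T.quotientOrder k := Nat.card_pos
  set q := T.quotientOrder k with hqdef
  have hc : Nat.card (T.weightLattice ⧸ (T.latticeM.map
    (nsmulAddMonoidHom (k + T.dualCoxeter))).addSubgroupOf T.weightLattice) = q := rfl
  rw [hc] at h1
  have h2 : ∀ mu, T.modularS k lam mu * (T.modularS k)ᴴ mu lam' =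
      (q : ℂ)⁻¹ * (AddChar.alternating T.sign (x lam) (T.torusPoint k mu) *
        (starRingEnd ℂ) (AddChar.alternating T.sign (x lam') (T.torusPoint k mu))) := by
    intro mu
    -- The phase has absolute value one, whatever the number of positive roots.
    have h3 : Complex.I ^ T.positiveRoots.ncard *
        (starRingEnd ℂ) (Complex.I ^ T.positiveRoots.ncard) = 1 := by
      rw [map_pow, ← mul_pow, Complex.conj_I, mul_neg, Complex.I_mul_I, neg_neg, one_pow]
    have h4 : (((Real.sqrt q)⁻¹ : ℝ) : ℂ) * (((Real.sqrt q)⁻¹ : ℝ) : ℂ) = (q : ℂ)⁻¹ := by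
      rw [← Complex.ofReal_mul, ← mul_inv, Real.mul_self_sqrt q.cast_nonneg]
      push_cast
      rfl
    rw [Matrix.conjTranspose_apply, modularS, Matrix.of_apply, Matrix.of_apply,
      altSum_eq_alternating, altSum_eq_alternating, ← starRingEnd_apply, map_mul, map_mul,
      Complex.conj_ofReal, ← hqdef, ← h4]
    linear_combination (((Real.sqrt q)⁻¹ : ℝ) : ℂ) * (((Real.sqrt q)⁻¹ : ℝ) : ℂ) *
      (AddChar.alternating T.sign (x lam) (T.torusPoint k mu) *
        (starRingEnd ℂ) (AddChar.alternating T.sign (x lam') (T.torusPoint k mu))) * h3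
  rw [Matrix.mul_apply, Finset.sum_congr rfl fun mu _ => h2 mu, ← Finset.mul_sum, h1,
    Matrix.one_apply]
  simp only [hinj]
  split_ifs
  · exact inv_mul_cancel₀ (by exact_mod_cast hq.ne')
  · exact mul_zero _

end AffineType
end

theorem mainTheorem4 {n : ℕ} (T : AffineType n) (k : ℕ) :
    ∃ _ : Fintype (T.adjacent.levelWeights k), T.modularS k * (T.modularS k)ᴴ = 1 :=
  T.exists_fintype_modularS_mul_conjTranspose k
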